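/- Work over a field $k$ of characteristic zero; operads are symmetric operads in $k$-vector spaces. An almost Poisson algebra is a vector space with a commutative associative product $a_1a_2$ and an anticommutative bracket $\{a_1,a_2\}$ (not necessarily satisfying the Jacobi identity) which is a biderivation: $\{a_1a_2,a_3\}=a_1\{a_2,a_3\}+\{a_1,a_3\}a_2$. The almost Poisson operad is the operad generated by these two binary operations subject to these identities. For an ideal $\mathcal I$ of an operad $\mathcal O$, the filtration of $\mathcal O$ by powers of $\mathcal I$ is the decreasing filtration $F^0\supseteq F^1\supseteq\cdots$ for which $F^n$ is spanned by the compositions of elements of $\mathcal O$ along rooted trees in which elements of $\mathcal I$ are used for at least $n$ of the internal vertices; its associated graded operad is $\bigoplus_{n\ge 0}F^n/F^{n+1}$ with the induced operad structure. Theorem. Let $\mathcal O$ be an operad over $k$ generated by one binary operation $a_1\cdot a_2$. Suppose that the associated graded operad of $\mathcal O$ for the filtration by powers of the ideal generated by $a_1\cdot a_2-a_2\cdot a_1$ is isomorphic, as an operad, to the almost Poisson operad. Then $\mathcal O$ is isomorphic to the almost Poisson operad. More precisely, there is an isomorphism from the almost Poisson operad to $\mathcal O$ sending the product $a_1a_2$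 to $a_1\cdot a_2+a_2\cdot a_1$ and the bracket $\{a_1,a_2\}$ to $a_1\cdot a_2-a_2\cdot a_1$. -/

import Mathlib

open Function

universe u v w

/-! ### Multilinear preliminaries -/

section Multilinear

variable {k : Type u} [Field k] {ι : Type} [Finite ι]
  {M L : Type*} [AddCommGroup M] [Module k M] [AddCommGroup L] [Module k L]
  {N : ι → Type*} [∀ i, AddCommGroup (N i)] [∀ i, Module k (N i)]

theorem multilinear_mem_of_span (f : MultilinearMap k N L) (S : ∀ i, Set (N i))
    (L' : Submodule k L) (h : ∀ b : ∀ i, N i, (∀ i, b i ∈ S i) → f b ∈ L')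
    (b : ∀ i, N i) (hb : ∀ i, b i ∈ Submodule.span k (S i)) : f b ∈ L' := by
  classical
  cases nonempty_fintype ι
  have key : ∀ s : Finset ι, ∀ b : ∀ i, N i, (∀ i ∈ s, b i ∈ Submodule.span k (S i)) →
      (∀ i, i ∉ s → b i ∈ S i) → f b ∈ L' := by
    intro s
    induction s using Finset.induction_on with
    | empty => intro b _ hb; exact h b (fun i => hb i (by simp))
    | insert i s his ih =>
      intro b hb hb'
      have e : Submodule.span k (S i) ≤ L'.comap (f.toLinearMap b i) := by
        rw [Submodule.span_le]
        intro x hx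
        change f (update b i x) ∈ L'
        apply ih
        · intro j hj
          have hji : j ≠ i := fun h => his (h ▸ hj)
          rw [update_of_ne hji]
          exact hb j (by simp [hj])
        · intro j hj
          by_cases hji : j = i
          · subst hji; simpa using hx
          · rw [update_of_ne hji]
            exact hb' j (by simp [hji, hj])
      simpa using e (hb i (by simp))
  exact key Finset.univ b (fun i _ => hb i) (by simp)

theorem multilinear_ext_of_span {f g : MultilinearMap k N L} (S : ∀ i, Set (N i))
    (hS : ∀ i, Submodule.span k (S i) = ⊤)
    (h : ∀ b : ∀ i, N i, (∀ i, b i ∈ S i) → f b = g b) : f = g := by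
  ext b
  have := multilinear_mem_of_span (f - g) S ⊥ (fun b hb => by simp [h b hb]) b
    (fun i => by rw [hS i]; trivial)
  exact sub_eq_zero.1 ((Submodule.mem_bot k).1 this)

theorem multilinear_sub_mem (f : MultilinearMap k N L) (N' : ∀ i, Submodule k (N i))
    (L' : Submodule k L) (h : ∀ b i, b i ∈ N' i → f b ∈ L') (b b' : ∀ i, N i)
    (hb : ∀ i, b i - b' i ∈ N' i) : f b - f b' ∈ L' := by
  classical
  cases nonempty_fintype ι
  have key : ∀ s : Finset ι, f b - f (s.piecewise b' b) ∈ L' := by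
    intro s
    induction s using Finset.induction_on with
    | empty => simp
    | insert i s his ih =>
      have e : f (s.piecewise b' b) - f ((insert i s).piecewise b' b) ∈ L' := by
        have e1 : s.piecewise b' b = update (s.piecewise b' b) i (b i) := by
          rw [eq_comm, update_eq_self_iff]; simp [his]
        rw [Finset.piecewise_insert, e1, update_idem, ← MultilinearMap.map_update_sub]
        exact h _ i (by simpa using hb i)
      have := L'.add_mem ih e
      simpa using this
  simpa using key Finset.univ

/-- A multilinear map vanishing as soon as one argument lies in the submodule `N' i` descends to
the quotients. -/
noncomputable def multilinearLift (N' : ∀ i, Submodule k (N i)) (f : MultilinearMap k N L)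
    (h : ∀ b i, b i ∈ N' i → f b = 0) : MultilinearMap k (fun i => N i ⧸ N' i) L where
  toFun q := f (fun i => surjInv (Submodule.mkQ_surjective (N' i)) (q i))
  map_update_add' := by
    intro dec m i x y
    have key : ∀ b b' : ∀ i, N i, (∀ i, (N' i).mkQ (b i) = (N' i).mkQ (b' i)) → f b = f b' := by
      intro b b' hb
      have := multilinear_sub_mem f N' ⊥ (fun b i hb => by simpa using h b i hb) b b'
        (fun i => (Submodule.Quotient.eq _).1 (hb i))
      exact sub_eq_zero.1 (by simpa using this)
    set r : ∀ i, (N i ⧸ N' i) → N i := fun i => surjInv (Submodule.mkQ_surjective (N' i)) with hr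
    have hr' : ∀ i q, (N' i).mkQ (r i q) = q := fun i => surjInv_eq _
    have e : ∀ z : N i ⧸ N' i, ∀ z' : N i, (N' i).mkQ z' = z →
        f (fun j => r j (update m i z j)) = f (update (fun j => r j (m j)) i z') := by
      intro z z' hz
      apply key
      intro j
      rw [hr']
      by_cases hj : j = i
      · subst hj; simp [← hz]
      · rw [update_of_ne hj, update_of_ne hj, hr']
    rw [e _ (r i x + r i y) (by rw [map_add, hr', hr']), e x (r i x) (hr' _ _),
      e y (r i y) (hr' _ _), MultilinearMap.map_update_add]
  map_update_smul' := by
    intro dec m i c x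
    have key : ∀ b b' : ∀ i, N i, (∀ i, (N' i).mkQ (b i) = (N' i).mkQ (b' i)) → f b = f b' := by
      intro b b' hb
      have := multilinear_sub_mem f N' ⊥ (fun b i hb => by simpa using h b i hb) b b'
        (fun i => (Submodule.Quotient.eq _).1 (hb i))
      exact sub_eq_zero.1 (by simpa using this)
    set r : ∀ i, (N i ⧸ N' i) → N i := fun i => surjInv (Submodule.mkQ_surjective (N' i)) with hr
    have hr' : ∀ i q, (N' i).mkQ (r i q) = q := fun i => surjInv_eq _
    have e : ∀ z : N i ⧸ N' i, ∀ z' : N i, (N' i).mkQ z' = z →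
        f (fun j => r j (update m i z j)) = f (update (fun j => r j (m j)) i z') := by
      intro z z' hz
      apply key
      intro j
      rw [hr']
      by_cases hj : j = i
      · subst hj; simp [← hz]
      · rw [update_of_ne hj, update_of_ne hj, hr']
    rw [e _ (c • r i x) (by rw [map_smul, hr']), e x (r i x) (hr' _ _),
      MultilinearMap.map_update_smul]

theorem multilinearLift_mk (N' : ∀ i, Submodule k (N i)) (f : MultilinearMap k N L)
    (h : ∀ b i, b i ∈ N' i → f b = 0) (b : ∀ i, N i) :
    multilinearLift N' f h (fun i => (N' i).mkQ (b i)) = f b := by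
  have := multilinear_sub_mem f N' ⊥ (fun b i hb => by simpa using h b i hb)
    (fun i => surjInv (Submodule.mkQ_surjective (N' i)) ((N' i).mkQ (b i))) b
    (fun i => (Submodule.Quotient.eq _).1 (surjInv_eq (Submodule.mkQ_surjective (N' i)) _))
  exact sub_eq_zero.1 ((Submodule.mem_bot k).1 this)

/-- The map induced on quotients by a map `f` that is linear in `a : M` and multilinear in
`b : ∀ i, N i`. -/
noncomputable def multilinearMapQ (f : M →ₗ[k] MultilinearMap k N L) (M' : Submodule k M)
    (N' : ∀ i, Submodule k (N i)) (L' : Submodule k L)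
    (h₁ : ∀ a b, a ∈ M' → f a b ∈ L') (h₂ : ∀ a b i, b i ∈ N' i → f a b ∈ L') :
    (M ⧸ M') →ₗ[k] MultilinearMap k (fun i => N i ⧸ N' i) (L ⧸ L') :=
  M'.liftQ
    { toFun := fun a => multilinearLift N' (L'.mkQ.compMultilinearMap (f a))
        (fun b i hb => by simpa using h₂ a b i hb)
      map_add' := fun a a' => by
        ext q
        choose b hb using fun i => Submodule.mkQ_surjective (N' i) (q i)
        obtain rfl : (fun i => (N' i).mkQ (b i)) = q := funext hb
        simp only [add_apply, multilinearLift_mk,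
          LinearMap.compMultilinearMap_apply, map_add]
      map_smul' := fun c a => by
        ext q
        choose b hb using fun i => Submodule.mkQ_surjective (N' i) (q i)
        obtain rfl : (fun i => (N' i).mkQ (b i)) = q := funext hb
        simp only [smul_apply, multilinearLift_mk,
          LinearMap.compMultilinearMap_apply, map_smul, RingHom.id_apply] }
    (fun a ha => by
      rw [LinearMap.mem_ker]
      ext q
      choose b hb using fun i => Submodule.mkQ_surjective (N' i) (q i)
      obtain rfl : (fun i => (N' i).mkQ (b i)) = q := funext hb
      simp only [LinearMap.coe_mk, AddHom.coe_mk, multilinearLift_mk,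
        LinearMap.compMultilinearMap_apply]
      simpa using h₁ a b ha)

theorem multilinearMapQ_mk (f : M →ₗ[k] MultilinearMap k N L) (M' : Submodule k M)
    (N' : ∀ i, Submodule k (N i)) (L' : Submodule k L)
    (h₁ : ∀ a b, a ∈ M' → f a b ∈ L') (h₂ : ∀ a b i, b i ∈ N' i → f a b ∈ L')
    (a : M) (b : ∀ i, N i) :
    multilinearMapQ f M' N' L' h₁ h₂ (M'.mkQ a) (fun i => (N' i).mkQ (b i)) =
      L'.mkQ (f a b) := by
  simp only [multilinearMapQ, Submodule.mkQ_apply, Submodule.liftQ_apply, LinearMap.coe_mk,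
    AddHom.coe_mk]
  exact multilinearLift_mk N' _ _ b

/-- Reindexing a multilinear map along a bijection, with dependent factors. -/
def multilinearReindex {ι' : Type} {N' : ι' → Type*} [∀ i, AddCommGroup (N' i)]
    [∀ i, Module k (N' i)] (e : ι ≃ ι') (f : MultilinearMap k (fun i => N' (e i)) L) :
    MultilinearMap k N' L where
  toFun b := f (fun i => b (e i))
  map_update_add' := by
    classical
    intro dec m i x y
    obtain ⟨j, rfl⟩ := e.surjective i
    have h : ∀ z, (fun i => update m (e j) z (e i)) = update (fun i => m (e i)) j z :=
      fun z => update_comp_eq_of_injective' m e.injective j z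
    simp only [h, MultilinearMap.map_update_add]
  map_update_smul' := by
    classical
    intro dec m i c x
    obtain ⟨j, rfl⟩ := e.surjective i
    have h : ∀ z, (fun i => update m (e j) z (e i)) = update (fun i => m (e i)) j z :=
      fun z => update_comp_eq_of_injective' m e.injective j z
    simp only [h, MultilinearMap.map_update_smul]

end Multilinear

/-! ### Operads -/

/-- The data underlying a symmetric operad in vector spaces over `k`, written in the
coordinate-free way: `obj X` is the space of operations whose inputs are labelled by the finite
set `X` (so that `obj (Fin n)` is the arity `n` component), `relabel` is the action of bijections
(so that `obj (Fin n)` is a representation of the symmetric group), `one` is the unit, and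
`comp a b` is the composition `γ(a; b)`, where the operation `b y` is inserted into the input `y`
of `a`. -/
structure PreOperad (k : Type u) [Field k] where
  obj : (X : Type) → [Finite X] → Type v
  [addCommGroup : ∀ (X : Type) [Finite X], AddCommGroup (obj X)]
  [module : ∀ (X : Type) [Finite X], Module k (obj X)]
  relabel : ∀ {X Y : Type} [Finite X] [Finite Y], X ≃ Y → (obj X →ₗ[k] obj Y)
  one : obj Unit
  comp : ∀ {Y : Type} [Finite Y] {X : Y → Type} [∀ y, Finite (X y)],
    obj Y →ₗ[k] MultilinearMap k (fun y => obj (X y)) (obj (Σ y, X y))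

attribute [instance] PreOperad.addCommGroup PreOperad.module

/-- The linear map `a ↦ γ(a; b)`. -/
def PreOperad.compEval {k : Type u} [Field k] (P : PreOperad.{u, v} k) {Y : Type} [Finite Y]
    {X : Y → Type} [∀ y, Finite (X y)] (b : ∀ y, P.obj (X y)) :
    P.obj Y →ₗ[k] P.obj (Σ y, X y) where
  toFun a := P.comp a b
  map_add' := by simp
  map_smul' := by simp

/-- A symmetric operad in vector spaces over `k`: functoriality in bijections, equivariance,
unitality and associativity of the composition. -/
structure Operad (k : Type u) [Field k] extends PreOperad.{u, v} k where
  relabel_refl : ∀ {X : Type} [Finite X] (a : obj X), relabel (Equiv.refl X) a = a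
  relabel_trans : ∀ {X Y Z : Type} [Finite X] [Finite Y] [Finite Z] (e : X ≃ Y) (f : Y ≃ Z)
    (a : obj X), relabel (e.trans f) a = relabel f (relabel e a)
  comp_relabel_right : ∀ {Y : Type} [Finite Y] {X X' : Y → Type} [∀ y, Finite (X y)]
    [∀ y, Finite (X' y)] (e : ∀ y, X y ≃ X' y) (a : obj Y) (b : ∀ y, obj (X y)),
    comp a (fun y => relabel (e y) (b y)) = relabel (Equiv.sigmaCongrRight e) (comp a b)
  comp_relabel_left : ∀ {Y Y' : Type} [Finite Y] [Finite Y'] {X : Y' → Type} [∀ y, Finite (X y)]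
    (e : Y ≃ Y') (a : obj Y) (b : ∀ y, obj (X y)),
    comp (relabel e a) b = relabel (Equiv.sigmaCongrLeft e) (comp a (fun y => b (e y)))
  one_comp : ∀ {X : Type} [Finite X] (b : obj X),
    relabel (Equiv.uniqueSigma (fun _ : Unit => X)) (comp one (fun _ => b)) = b
  comp_one : ∀ {Y : Type} [Finite Y] (a : obj Y),
    relabel (Equiv.sigmaPUnit Y) (comp a (fun _ => one)) = a
  comp_assoc : ∀ {Z : Type} [Finite Z] {Y : Z → Type} [∀ z, Finite (Y z)]
    {X : ∀ z, Y z → Type} [∀ z y, Finite (X z y)]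
    (a : obj Z) (b : ∀ z, obj (Y z)) (c : ∀ z y, obj (X z y)),
    comp a (fun z => comp (b z) (c z)) =
      relabel (Equiv.sigmaAssoc X)
        (comp (X := fun p : Σ z, Y z => X p.1 p.2) (comp a b) (fun p => c p.1 p.2))

namespace Operad

variable {k : Type u} [Field k]

/-- It is enough to check the axioms of an operad on spanning sets. -/
def ofSpan (P : PreOperad.{u, v} k) (S : ∀ (X : Type) [Finite X], Set (P.obj X))
    (hS : ∀ (X : Type) [Finite X], Submodule.span k (S X) = ⊤)
    (relabel_refl : ∀ {X : Type} [Finite X] (a : P.obj X), a ∈ S X →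
      P.relabel (Equiv.refl X) a = a)
    (relabel_trans : ∀ {X Y Z : Type} [Finite X] [Finite Y] [Finite Z] (e : X ≃ Y) (f : Y ≃ Z)
      (a : P.obj X), a ∈ S X → P.relabel (e.trans f) a = P.relabel f (P.relabel e a))
    (comp_relabel_right : ∀ {Y : Type} [Finite Y] {X X' : Y → Type} [∀ y, Finite (X y)]
      [∀ y, Finite (X' y)] (e : ∀ y, X y ≃ X' y) (a : P.obj Y) (b : ∀ y, P.obj (X y)),
      a ∈ S Y → (∀ y, b y ∈ S (X y)) →
      P.comp a (fun y => P.relabel (e y) (b y)) =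
        P.relabel (Equiv.sigmaCongrRight e) (P.comp a b))
    (comp_relabel_left : ∀ {Y Y' : Type} [Finite Y] [Finite Y'] {X : Y' → Type}
      [∀ y, Finite (X y)] (e : Y ≃ Y') (a : P.obj Y) (b : ∀ y, P.obj (X y)),
      a ∈ S Y → (∀ y, b y ∈ S (X y)) →
      P.comp (P.relabel e a) b =
        P.relabel (Equiv.sigmaCongrLeft e) (P.comp a (fun y => b (e y))))
    (one_comp : ∀ {X : Type} [Finite X] (b : P.obj X), b ∈ S X →
      P.relabel (Equiv.uniqueSigma (fun _ : Unit => X)) (P.comp P.one (fun _ => b)) = b)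
    (comp_one : ∀ {Y : Type} [Finite Y] (a : P.obj Y), a ∈ S Y →
      P.relabel (Equiv.sigmaPUnit Y) (P.comp a (fun _ => P.one)) = a)
    (comp_assoc : ∀ {Z : Type} [Finite Z] {Y : Z → Type} [∀ z, Finite (Y z)]
      {X : ∀ z, Y z → Type} [∀ z y, Finite (X z y)]
      (a : P.obj Z) (b : ∀ z, P.obj (Y z)) (c : ∀ z y, P.obj (X z y)),
      a ∈ S Z → (∀ z, b z ∈ S (Y z)) → (∀ z y, c z y ∈ S (X z y)) →
      P.comp a (fun z => P.comp (b z) (c z)) =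
        P.relabel (Equiv.sigmaAssoc X)
          (P.comp (X := fun p : Σ z, Y z => X p.1 p.2) (P.comp a b) (fun p => c p.1 p.2))) :
    Operad.{u, v} k where
  toPreOperad := P
  relabel_refl {X} _ a := by
    have : P.relabel (Equiv.refl X) = LinearMap.id :=
      LinearMap.ext_on (hS X) (fun a ha => relabel_refl a ha)
    rw [this]; rfl
  relabel_trans {X Y Z} _ _ _ e f a := by
    have : P.relabel (e.trans f) = P.relabel f ∘ₗ P.relabel e :=
      LinearMap.ext_on (hS X) (fun a ha => relabel_trans e f a ha)
    rw [this]; rfl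
  comp_relabel_right {Y} _ {X X'} _ _ e a b := by
    let A : P.obj Y →ₗ[k] MultilinearMap k (fun y => P.obj (X y)) (P.obj (Σ y, X' y)) :=
      MultilinearMap.compLinearMapₗ (fun y => P.relabel (e y)) ∘ₗ P.comp
    let B : P.obj Y →ₗ[k] MultilinearMap k (fun y => P.obj (X y)) (P.obj (Σ y, X' y)) :=
      (P.relabel (Equiv.sigmaCongrRight e)).compMultilinearMapₗ k ∘ₗ P.comp
    have : A = B := LinearMap.ext_on (hS Y) fun a ha =>
      multilinear_ext_of_span (fun y => S (X y)) (fun y => hS (X y)) fun b hb =>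
        comp_relabel_right e a b ha hb
    exact congrArg (fun F => F a b) this
  comp_relabel_left {Y Y'} _ _ {X} _ e a b := by
    let A : P.obj Y →ₗ[k] P.obj (Σ y, X y) := P.compEval b ∘ₗ P.relabel e
    let B : P.obj Y →ₗ[k] P.obj (Σ y, X y) :=
      P.relabel (Equiv.sigmaCongrLeft e) ∘ₗ P.compEval (fun y => b (e y))
    have : A = B := LinearMap.ext_on (hS Y) fun a ha => by
      let A' : MultilinearMap k (fun y => P.obj (X y)) (P.obj (Σ y, X y)) :=
        P.comp (P.relabel e a)
      let B' : MultilinearMap k (fun y => P.obj (X y)) (P.obj (Σ y, X y)) :=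
        multilinearReindex e ((P.relabel (Equiv.sigmaCongrLeft e)).compMultilinearMap (P.comp a))
      have : A' = B' := multilinear_ext_of_span (fun y => S (X y)) (fun y => hS (X y))
        fun b hb => comp_relabel_left e a b ha hb
      exact congrArg (fun F => F b) this
    exact congrArg (fun F => F a) this
  one_comp {X} _ b := by
    let A : P.obj X →ₗ[k] P.obj X :=
      P.relabel (Equiv.uniqueSigma (fun _ : Unit => X)) ∘ₗ
        { toFun := fun b => P.comp P.one (fun _ => b)
          map_add' := fun x y => by
            have h : ∀ z : P.obj X, update (fun _ : Unit => (0 : P.obj X)) () z = fun _ => z :=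
              fun z => by funext u; cases u; simp
            have := (P.comp (X := fun _ => X) P.one).map_update_add (fun _ => 0) () x y
            simpa only [h] using this
          map_smul' := fun c x => by
            have h : ∀ z : P.obj X, update (fun _ : Unit => (0 : P.obj X)) () z = fun _ => z :=
              fun z => by funext u; cases u; simp
            have := (P.comp (X := fun _ => X) P.one).map_update_smul (fun _ => 0) () c x
            simpa only [h, RingHom.id_apply] using this }
    have : A = LinearMap.id := LinearMap.ext_on (hS X) fun b hb => one_comp b hb
    exact congrArg (fun F => F b) this
  comp_one {Y} _ a := by
    let A : P.obj Y →ₗ[k] P.obj Y :=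
      P.relabel (Equiv.sigmaPUnit Y) ∘ₗ P.compEval (fun _ => P.one)
    have : A = LinearMap.id := LinearMap.ext_on (hS Y) fun a ha => comp_one a ha
    exact congrArg (fun F => F a) this
  comp_assoc {Z} _ {Y} _ {X} _ a b c := by
    have step1 : ∀ a ∈ S Z, ∀ b : ∀ z, P.obj (Y z), (∀ z, b z ∈ S (Y z)) →
        ∀ c : ∀ p : Σ z, Y z, P.obj (X p.1 p.2),
        P.comp a (fun z => P.comp (b z) (fun y => c ⟨z, y⟩)) =
        P.relabel (Equiv.sigmaAssoc X)
          (P.comp (X := fun p : Σ z, Y z => X p.1 p.2) (P.comp a b) c) := by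
      intro a ha b hb c
      let A : MultilinearMap k (fun p : Σ z, Y z => P.obj (X p.1 p.2))
          (P.obj (Σ z, Σ y, X z y)) := (P.comp a).compMultilinearMap (fun z => P.comp (b z))
      let B : MultilinearMap k (fun p : Σ z, Y z => P.obj (X p.1 p.2))
          (P.obj (Σ z, Σ y, X z y)) :=
        (P.relabel (Equiv.sigmaAssoc X)).compMultilinearMap (P.comp (P.comp a b))
      have : A = B := multilinear_ext_of_span (fun p => S (X p.1 p.2)) (fun p => hS _)
        fun c hc => comp_assoc a b (fun z y => c ⟨z, y⟩) ha hb (fun z y => hc ⟨z, y⟩)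
      exact congrArg (fun F => F c) this
    let A : P.obj Z →ₗ[k] P.obj (Σ z, Σ y, X z y) :=
      P.compEval (fun z => P.comp (b z) (c z))
    let B : P.obj Z →ₗ[k] P.obj (Σ z, Σ y, X z y) :=
      P.relabel (Equiv.sigmaAssoc X) ∘ₗ
        P.compEval (X := fun p : Σ z, Y z => X p.1 p.2) (fun p => c p.1 p.2) ∘ₗ P.compEval b
    have : A = B := LinearMap.ext_on (hS Z) fun a ha => by
      let A' : MultilinearMap k (fun z => P.obj (Y z)) (P.obj (Σ z, Σ y, X z y)) :=
        (P.comp a).compLinearMap (fun z => P.compEval (c z))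
      let B' : MultilinearMap k (fun z => P.obj (Y z)) (P.obj (Σ z, Σ y, X z y)) :=
        (P.relabel (Equiv.sigmaAssoc X) ∘ₗ P.compEval
          (X := fun p : Σ z, Y z => X p.1 p.2) (fun p => c p.1 p.2)).compMultilinearMap (P.comp a)
      have : A' = B' := multilinear_ext_of_span (fun z => S (Y z)) (fun z => hS _)
        fun b hb => step1 a ha b hb (fun p => c p.1 p.2)
      exact congrArg (fun F => F b) this
    exact congrArg (fun F => F a) this

/-- An isomorphism of operads. -/
structure Iso (P : Operad.{u, v} k) (Q : Operad.{u, w} k) where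
  equiv : ∀ (X : Type) [Finite X], P.obj X ≃ₗ[k] Q.obj X
  map_relabel : ∀ {X Y : Type} [Finite X] [Finite Y] (e : X ≃ Y) (a : P.obj X),
    equiv Y (P.relabel e a) = Q.relabel e (equiv X a)
  map_one : equiv Unit P.one = Q.one
  map_comp : ∀ {Y : Type} [Finite Y] {X : Y → Type} [∀ y, Finite (X y)] (a : P.obj Y)
    (b : ∀ y, P.obj (X y)),
    equiv (Σ y, X y) (P.comp a b) = Q.comp (equiv Y a) (fun y => equiv (X y) (b y))

variable (P : Operad.{u, v} k)

/-! ### Suboperads, ideals, quotients -/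

/-- A suboperad. -/
structure Suboperad where
  carrier : ∀ (X : Type) [Finite X], Submodule k (P.obj X)
  relabel_mem : ∀ {X Y : Type} [Finite X] [Finite Y] (e : X ≃ Y) {a : P.obj X},
    a ∈ carrier X → P.relabel e a ∈ carrier Y
  one_mem : P.one ∈ carrier Unit
  comp_mem : ∀ {Y : Type} [Finite Y] {X : Y → Type} [∀ y, Finite (X y)] {a : P.obj Y}
    {b : ∀ y, P.obj (X y)}, a ∈ carrier Y → (∀ y, b y ∈ carrier (X y)) →
    P.comp a b ∈ carrier (Σ y, X y)

/-- `P` is generated, as an operad, by the set `S` of its operations: the only suboperad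
containing `S` is `P`. -/
def IsGeneratedBy (S : Set (Σ n : ℕ, P.obj (Fin n))) : Prop :=
  ∀ Q : P.Suboperad, (∀ s ∈ S, s.2 ∈ Q.carrier (Fin s.1)) →
    ∀ (X : Type) [Finite X], Q.carrier X = ⊤

/-- An operadic ideal. -/
structure OperadIdeal where
  carrier : ∀ (X : Type) [Finite X], Submodule k (P.obj X)
  relabel_mem : ∀ {X Y : Type} [Finite X] [Finite Y] (e : X ≃ Y) {a : P.obj X},
    a ∈ carrier X → P.relabel e a ∈ carrier Y
  comp_mem_left : ∀ {Y : Type} [Finite Y] {X : Y → Type} [∀ y, Finite (X y)] {a : P.obj Y}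
    (b : ∀ y, P.obj (X y)), a ∈ carrier Y → P.comp a b ∈ carrier (Σ y, X y)
  comp_mem_right : ∀ {Y : Type} [Finite Y] {X : Y → Type} [∀ y, Finite (X y)] (a : P.obj Y)
    {b : ∀ y, P.obj (X y)} (y : Y), b y ∈ carrier (X y) → P.comp a b ∈ carrier (Σ y, X y)

/-- The ideal generated by a set of operations: the intersection of all ideals containing it. -/
def idealSpan (S : Set (Σ n : ℕ, P.obj (Fin n))) : P.OperadIdeal where
  carrier X _ := ⨅ (I : P.OperadIdeal) (_ : ∀ s ∈ S, s.2 ∈ I.carrier (Fin s.1)), I.carrier X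
  relabel_mem e a ha := by
    simp only [Submodule.mem_iInf] at ha ⊢
    exact fun I hI => I.relabel_mem e (ha I hI)
  comp_mem_left b ha := by
    simp only [Submodule.mem_iInf] at ha ⊢
    exact fun I hI => I.comp_mem_left b (ha I hI)
  comp_mem_right a b y hb := by
    simp only [Submodule.mem_iInf] at hb ⊢
    exact fun I hI => I.comp_mem_right a y (hb I hI)

/-- The composition on the quotient by an ideal. -/
noncomputable def quotientPre (I : P.OperadIdeal) : PreOperad.{u, v} k where
  obj X _ := P.obj X ⧸ I.carrier X
  relabel {X Y} _ _ e :=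
    (I.carrier X).mapQ (I.carrier Y) (P.relabel e) (fun _ ha => I.relabel_mem e ha)
  one := (I.carrier Unit).mkQ P.one
  comp {Y} _ {X} _ := multilinearMapQ P.comp (I.carrier Y) (fun y => I.carrier (X y))
    (I.carrier (Σ y, X y)) (fun _ b ha => I.comp_mem_left b ha)
    (fun a _ i hb => I.comp_mem_right a i hb)

/-- The projection of `P` to the quotient by an ideal. -/
noncomputable def toQuotient (I : P.OperadIdeal) (X : Type) [Finite X] :
    P.obj X →ₗ[k] (P.quotientPre I).obj X :=
  (I.carrier X).mkQ

theorem toQuotient_surjective (I : P.OperadIdeal) (X : Type) [Finite X] :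
    Surjective (P.toQuotient I X) :=
  (I.carrier X).mkQ_surjective

theorem comp_toQuotient (I : P.OperadIdeal) {Y : Type} [Finite Y] {X : Y → Type}
    [∀ y, Finite (X y)] (a : P.obj Y) (b : ∀ y, P.obj (X y)) :
    (P.quotientPre I).comp (P.toQuotient I Y a) (fun y => P.toQuotient I (X y) (b y)) =
      P.toQuotient I (Σ y, X y) (P.comp a b) :=
  multilinearMapQ_mk P.comp (I.carrier Y) (fun y => I.carrier (X y))
    (I.carrier (Σ y, X y)) (fun _ b ha => I.comp_mem_left b ha)
    (fun a _ i hb => I.comp_mem_right a i hb) a b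

theorem relabel_toQuotient (I : P.OperadIdeal) {X Y : Type} [Finite X] [Finite Y]
    (e : X ≃ Y) (a : P.obj X) :
    (P.quotientPre I).relabel e (P.toQuotient I X a) = P.toQuotient I Y (P.relabel e a) :=
  rfl

/-- The quotient of an operad by an ideal. -/
noncomputable def quotient (I : P.OperadIdeal) : Operad.{u, v} k where
  toPreOperad := P.quotientPre I
  relabel_refl {X} _ a := by
    obtain ⟨a, rfl⟩ := P.toQuotient_surjective I X a
    rw [relabel_toQuotient, P.relabel_refl]
  relabel_trans {X Y Z} _ _ _ e f a := by
    obtain ⟨a, rfl⟩ := P.toQuotient_surjective I X a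
    rw [relabel_toQuotient, relabel_toQuotient, relabel_toQuotient, P.relabel_trans]
  comp_relabel_right {Y} _ {X X'} _ _ e a b := by
    obtain ⟨a, rfl⟩ := P.toQuotient_surjective I Y a
    choose b' hb using fun y => P.toQuotient_surjective I (X y) (b y)
    obtain rfl : (fun y => P.toQuotient I (X y) (b' y)) = b := funext hb
    simp only [relabel_toQuotient, comp_toQuotient, P.comp_relabel_right]
  comp_relabel_left {Y Y'} _ _ {X} _ e a b := by
    obtain ⟨a, rfl⟩ := P.toQuotient_surjective I Y a
    choose b' hb using fun y => P.toQuotient_surjective I (X y) (b y)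
    obtain rfl : (fun y => P.toQuotient I (X y) (b' y)) = b := funext hb
    rw [relabel_toQuotient, comp_toQuotient, P.comp_relabel_left,
      comp_toQuotient P I a (fun y => b' (e y)), relabel_toQuotient]
  one_comp {X} _ b := by
    obtain ⟨b, rfl⟩ := P.toQuotient_surjective I X b
    have := comp_toQuotient P I P.one (fun _ : Unit => b)
    refine (congrArg _ this).trans ?_
    rw [relabel_toQuotient, P.one_comp]
  comp_one {Y} _ a := by
    obtain ⟨a, rfl⟩ := P.toQuotient_surjective I Y a
    have := comp_toQuotient P I a (fun _ => P.one)
    refine (congrArg _ this).trans ?_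
    rw [relabel_toQuotient, P.comp_one]
  comp_assoc {Z} _ {Y} _ {X} _ a b c := by
    obtain ⟨a, rfl⟩ := P.toQuotient_surjective I Z a
    choose b' hb using fun y => P.toQuotient_surjective I (Y y) (b y)
    obtain rfl : (fun y => P.toQuotient I (Y y) (b' y)) = b := funext hb
    choose c' hc using fun z y => P.toQuotient_surjective I (X z y) (c z y)
    obtain rfl : (fun z y => P.toQuotient I (X z y) (c' z y)) = c :=
      funext fun z => funext fun y => hc z y
    simp only [comp_toQuotient]
    rw [P.comp_assoc, relabel_toQuotient]

/-! ### Filtrations and the associated graded operad -/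

/-- A decreasing filtration of an operad. -/
structure Filtration where
  F : ℕ → ∀ (X : Type) [Finite X], Submodule k (P.obj X)
  relabel_mem : ∀ {n : ℕ} {X Y : Type} [Finite X] [Finite Y] (e : X ≃ Y) {a : P.obj X},
    a ∈ F n X → P.relabel e a ∈ F n Y
  F_zero : ∀ (X : Type) [Finite X], F 0 X = ⊤
  F_succ_le : ∀ (n : ℕ) (X : Type) [Finite X], F (n + 1) X ≤ F n X
  comp_mem : ∀ {n : ℕ} {Y : Type} [Finite Y] {X : Y → Type} [∀ y, Finite (X y)] {m : Y → ℕ}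
    {a : P.obj Y} {b : ∀ y, P.obj (X y)}, a ∈ F n Y → (∀ y, b y ∈ F (m y) (X y)) →
    P.comp a b ∈ F (n + ∑ᶠ y, m y) (Σ y, X y)

namespace Filtration

variable {P} (F : P.Filtration)

/-- The homogeneous component `Fⁿ(X) / Fⁿ⁺¹(X)`. -/
abbrev Piece (n : ℕ) (X : Type) [Finite X] : Type v :=
  ↥(F.F n X) ⧸ (F.F (n + 1) X).submoduleOf (F.F n X)

/-- The composition of `P`, restricted to the steps of the filtration. -/
noncomputable def stepComp {Y : Type} [Finite Y] {X : Y → Type} [∀ y, Finite (X y)] (n : ℕ) (m : Y → ℕ) :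
    F.F n Y →ₗ[k] MultilinearMap k (fun y => F.F (m y) (X y))
      (F.F (n + ∑ᶠ y, m y) (Σ y, X y)) where
  toFun a := ((P.comp a.1).compLinearMap (fun y => (F.F (m y) (X y)).subtype)).codRestrict _
    (fun b => F.comp_mem a.2 (fun y => (b y).2))
  map_add' a a' := by ext b; simp; rfl
  map_smul' c a := by ext b; simp; rfl

theorem antitone {n m : ℕ} (h : n ≤ m) (X : Type) [Finite X] : F.F m X ≤ F.F n X := by
  induction h with
  | refl => exact le_rfl
  | step _ ih => exact (F.F_succ_le _ X).trans ih

/-- The composition induced on the homogeneous components. -/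
noncomputable def pieceComp {Y : Type} [Finite Y] {X : Y → Type} [∀ y, Finite (X y)] (n : ℕ)
    (m : Y → ℕ) : F.Piece n Y →ₗ[k] MultilinearMap k (fun y => F.Piece (m y) (X y))
      (F.Piece (n + ∑ᶠ y, m y) (Σ y, X y)) :=
  multilinearMapQ (F.stepComp n m) _ _ _
    (fun a b ha => by
      rw [Submodule.submoduleOf, Submodule.mem_comap] at ha ⊢
      have := F.comp_mem (n := n + 1) ha (fun y => (b y).2)
      exact F.antitone (by omega) _ this)
    (fun a b y hb => by
      classical
      rw [Submodule.submoduleOf, Submodule.mem_comap] at hb ⊢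
      have h := F.comp_mem (m := fun z => m z + if z = y then 1 else 0) a.2
        (b := fun z => (b z).1) (fun z => by
          by_cases hz : z = y
          · subst hz; simp only [if_true]; exact hb
          · simp [hz])
      have e : (∑ᶠ z, (m z + if z = y then 1 else 0)) = (∑ᶠ z, m z) + 1 := by
        cases nonempty_fintype Y
        simp [finsum_eq_sum_of_fintype, Finset.sum_add_distrib]
      rw [e, ← add_assoc] at h
      exact h)

open Classical in
/-- The composition of the associated graded operad, with a homogeneous element in the root:
it extends the maps `pieceComp n m` multilinearly to the direct sum over all degrees `m y`. -/
noncomputable def grComp {Y : Type} [Finite Y] {X : Y → Type} [∀ y, Finite (X y)] (n : ℕ) :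
    F.Piece n Y →ₗ[k] MultilinearMap k (fun y => DirectSum ℕ (fun m => F.Piece m (X y)))
      (DirectSum ℕ (fun n => F.Piece n (Σ y, X y))) :=
  (MultilinearMap.fromDirectSumEquiv
    (M := fun (y : Y) (m : ℕ) => F.Piece m (X y))).toLinearMap ∘ₗ
  LinearMap.pi (fun m : Y → ℕ =>
    (DirectSum.lof k ℕ (fun n => F.Piece n (Σ y, X y))
      (n + ∑ᶠ y, m y)).compMultilinearMapₗ k ∘ₗ F.pieceComp n m)

/-- The underlying data of the associated graded operad `⨁ₙ Fⁿ / Fⁿ⁺¹`. -/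
noncomputable def grPre : PreOperad.{u, v} k where
  obj X _ := DirectSum ℕ (fun n => F.Piece n X)
  relabel {X Y} _ _ e := DirectSum.lmap (fun n =>
    Submodule.mapQ _ _ ((P.relabel e).restrict (fun _ ha => F.relabel_mem (n := n) e ha))
      (fun _ ha => F.relabel_mem e ha))
  one := DirectSum.lof k ℕ (fun n => F.Piece n Unit) 0
    (Submodule.mkQ _ ⟨P.one, by rw [F.F_zero]; trivial⟩)
  comp {Y} _ {X} _ := DirectSum.toModule k ℕ _ (fun n => F.grComp n)

/-- The class in the associated graded object, in degree `n`, of an element of `Fⁿ`. -/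
noncomputable def symbol (n : ℕ) {X : Type} [Finite X] (a : P.obj X) (ha : a ∈ F.F n X) :
    F.grPre.obj X :=
  DirectSum.lof k ℕ (fun n => F.Piece n X) n (Submodule.mkQ _ ⟨a, ha⟩)

theorem symbol_congr {n m : ℕ} {X : Type} [Finite X] {a b : P.obj X} (ha : a ∈ F.F n X)
    (hb : b ∈ F.F m X) (hnm : n = m) (hab : a = b) : F.symbol n a ha = F.symbol m b hb := by
  subst hnm; subst hab; rfl

theorem span_symbol (X : Type) [Finite X] :
    Submodule.span k {s : F.grPre.obj X | ∃ n a ha, s = F.symbol n a ha} = ⊤ := by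
  rw [eq_top_iff]
  rintro s -
  induction s using DirectSum.induction_on with
  | zero => exact Submodule.zero_mem _
  | of n x =>
    obtain ⟨⟨a, ha⟩, rfl⟩ := Submodule.mkQ_surjective _ x
    exact Submodule.subset_span ⟨n, a, ha, rfl⟩
  | add x y hx hy => exact Submodule.add_mem _ hx hy

theorem grPre_comp_symbol {Y : Type} [Finite Y] {X : Y → Type} [∀ y, Finite (X y)] (n : ℕ)
    (m : Y → ℕ) (a : P.obj Y) (ha : a ∈ F.F n Y) (b : ∀ y, P.obj (X y))
    (hb : ∀ y, b y ∈ F.F (m y) (X y)) :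
    F.grPre.comp (F.symbol n a ha) (fun y => F.symbol (m y) (b y) (hb y)) =
      F.symbol (n + ∑ᶠ y, m y) (P.comp a b) (F.comp_mem ha hb) := by
  classical
  change (DirectSum.toModule k ℕ _ (fun n => F.grComp (X := X) n)
    (DirectSum.lof k ℕ (fun n => F.Piece n Y) n (Submodule.mkQ _ ⟨a, ha⟩)))
    (fun y => DirectSum.lof k ℕ (fun n => F.Piece n (X y)) (m y)
      (Submodule.mkQ _ ⟨b y, hb y⟩)) = _
  rw [DirectSum.toModule_lof]
  refine (MultilinearMap.fromDirectSumEquiv_lof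
    (M := fun (y : Y) (m : ℕ) => F.Piece m (X y)) _ m _).trans ?_
  exact congrArg (DirectSum.lof k ℕ (fun n => F.Piece n (Σ y, X y)) (n + ∑ᶠ y, m y))
    (multilinearMapQ_mk _ _ _ _ _ _ (⟨a, ha⟩ : F.F n Y)
    (fun y => (⟨b y, hb y⟩ : F.F (m y) (X y))))

theorem grPre_relabel_symbol {X Y : Type} [Finite X] [Finite Y] (e : X ≃ Y) (n : ℕ)
    (a : P.obj X) (ha : a ∈ F.F n X) :
    F.grPre.relabel e (F.symbol n a ha) = F.symbol n (P.relabel e a) (F.relabel_mem e ha) := by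
  exact DirectSum.lmap_lof (R := k) (M := fun n => F.Piece n X) (N := fun n => F.Piece n Y) _ n _

theorem grPre_one : F.grPre.one = F.symbol 0 P.one (by rw [F.F_zero]; trivial) := rfl

/-- The associated graded operad `gr_F P = ⨁ₙ Fⁿ P / Fⁿ⁺¹ P`. -/
noncomputable def gr : Operad.{u, v} k :=
  ofSpan F.grPre (fun X _ => {s | ∃ n a ha, s = F.symbol n a ha}) (fun X _ => F.span_symbol X)
    (by
      rintro X _ _ ⟨n, a, ha, rfl⟩
      rw [grPre_relabel_symbol]
      exact F.symbol_congr _ _ rfl (P.relabel_refl a))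
    (by
      rintro X Y Z _ _ _ e f _ ⟨n, a, ha, rfl⟩
      rw [grPre_relabel_symbol, grPre_relabel_symbol, grPre_relabel_symbol]
      exact F.symbol_congr _ _ rfl (P.relabel_trans e f a))
    (by
      rintro Y _ X X' _ _ e _ b ⟨n, a, ha, rfl⟩ hb
      choose m b' hb' h using hb
      obtain rfl : b = fun y => F.symbol (m y) (b' y) (hb' y) := funext h
      simp only [grPre_relabel_symbol, grPre_comp_symbol]
      exact F.symbol_congr _ _ rfl (P.comp_relabel_right e a b'))
    (by
      rintro Y Y' _ _ X _ e _ b ⟨n, a, ha, rfl⟩ hb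
      choose m b' hb' h using hb
      obtain rfl : b = fun y => F.symbol (m y) (b' y) (hb' y) := funext h
      rw [grPre_relabel_symbol, grPre_comp_symbol, grPre_comp_symbol F n (fun y => m (e y)) a ha
        (fun y => b' (e y)) (fun y => hb' (e y)), grPre_relabel_symbol]
      exact F.symbol_congr _ _ (by rw [finsum_comp_equiv e]) (P.comp_relabel_left e a b'))
    (by
      rintro X _ _ ⟨n, b, hb, rfl⟩
      have := F.grPre_comp_symbol 0 (fun _ => n) P.one (by rw [F.F_zero]; trivial)
        (fun _ : Unit => b) (fun _ => hb)
      refine (congrArg _ this).trans ?_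
      rw [grPre_relabel_symbol]
      exact F.symbol_congr _ _ (by simp [finsum_eq_sum_of_fintype]) (P.one_comp b))
    (by
      rintro Y _ _ ⟨n, a, ha, rfl⟩
      have := F.grPre_comp_symbol n (fun _ => 0) a ha
        (fun _ => P.one) (fun _ => by rw [F.F_zero]; trivial)
      refine (congrArg _ this).trans ?_
      rw [grPre_relabel_symbol]
      exact F.symbol_congr _ _ (by simp) (P.comp_one a))
    (by
      rintro Z _ Y _ X _ _ b c ⟨n, a, ha, rfl⟩ hb hc
      choose m b' hb' h using hb
      obtain rfl : b = fun y => F.symbol (m y) (b' y) (hb' y) := funext h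
      choose l c' hc' h' using hc
      obtain rfl : c = fun z y => F.symbol (l z y) (c' z y) (hc' z y) :=
        funext fun z => funext fun y => h' z y
      simp only [grPre_comp_symbol]
      rw [grPre_relabel_symbol]
      refine F.symbol_congr _ _ ?_ (P.comp_assoc a b' c')
      cases nonempty_fintype Z
      let _ := fun z => Fintype.ofFinite (Y z)
      simp only [finsum_eq_sum_of_fintype, Finset.sum_add_distrib, Fintype.sum_sigma, add_assoc])

end Filtration

/-- `TreeComp I n X c` means that the operation `c` is the composition of operations of `P` along
a rooted tree (with leaves labelled by `X`) in which, for `n` chosen internal vertices, an element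
of `I` is used. Such a tree is either the trivial tree without vertices, or it has a root vertex,
decorated by some operation `a` (which may be chosen to be counted if it belongs to `I`), and a
tree attached to each input of `a`. -/
inductive TreeComp (I : P.OperadIdeal) : ℕ → ∀ (X : Type) [Finite X], P.obj X → Prop
  | trivial : TreeComp I 0 Unit P.one
  | node {Y : Type} [Finite Y] {X : Y → Type} [∀ y, Finite (X y)] (m : Y → ℕ) (a : P.obj Y)
      (b : ∀ y, P.obj (X y)) (hb : ∀ y, TreeComp I (m y) (X y) (b y)) :
      TreeComp I (∑ᶠ y, m y) (Σ y, X y) (P.comp a b)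
  | nodeIdeal {Y : Type} [Finite Y] {X : Y → Type} [∀ y, Finite (X y)] (m : Y → ℕ) (a : P.obj Y)
      (ha : a ∈ I.carrier Y) (b : ∀ y, P.obj (X y)) (hb : ∀ y, TreeComp I (m y) (X y) (b y)) :
      TreeComp I (1 + ∑ᶠ y, m y) (Σ y, X y) (P.comp a b)
  | relabel {X Y : Type} [Finite X] [Finite Y] {n : ℕ} (e : X ≃ Y) (c : P.obj X)
      (hc : TreeComp I n X c) : TreeComp I n Y (P.relabel e c)

theorem finsum_sigma_add {Z : Type} [Finite Z] {Y : Z → Type} [∀ z, Finite (Y z)] (l : Z → ℕ)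
    (m : (Σ z, Y z) → ℕ) :
    ∑ᶠ z, (l z + ∑ᶠ y, m ⟨z, y⟩) = ∑ᶠ z, l z + ∑ᶠ p, m p := by
  cases nonempty_fintype Z
  let _ := fun z => Fintype.ofFinite (Y z)
  simp only [finsum_eq_sum_of_fintype, Finset.sum_add_distrib, Fintype.sum_sigma]

variable {P}

theorem TreeComp.congr {I : P.OperadIdeal} {n m : ℕ} {X : Type} [Finite X] {a b : P.obj X}
    (h : P.TreeComp I n X a) (hnm : n = m) (hab : a = b) : P.TreeComp I m X b := by
  subst hnm; subst hab; exact h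

theorem eq_relabel_symm {X Y : Type} [Finite X] [Finite Y] (e : X ≃ Y) {a : P.obj X}
    {b : P.obj Y} (h : P.relabel e a = b) : P.relabel e.symm b = a := by
  rw [← h, ← P.relabel_trans, Equiv.self_trans_symm, P.relabel_refl]

theorem TreeComp.comp {I : P.OperadIdeal} {n : ℕ} {Y : Type} [Finite Y] {a : P.obj Y}
    (ha : P.TreeComp I n Y a) : ∀ {X : Y → Type} [∀ y, Finite (X y)] (m : Y → ℕ)
    (b : ∀ y, P.obj (X y)) (_ : ∀ y, P.TreeComp I (m y) (X y) (b y)),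
    P.TreeComp I (n + ∑ᶠ y, m y) (Σ y, X y) (P.comp a b) := by
  induction ha with
  | trivial =>
    intro X _ m b hb
    obtain ⟨X₀, rfl⟩ : ∃ X₀, X = fun _ => X₀ := ⟨X (), rfl⟩
    have : Finite X₀ := ‹∀ _ : Unit, Finite X₀› ()
    exact ((hb ()).relabel (Equiv.uniqueSigma (fun _ : Unit => X₀)).symm).congr
      (by simp [finsum_eq_sum_of_fintype]) (eq_relabel_symm _ (P.one_comp (b ())))
  | @node Z _ Y _ l a b hb ih =>
    intro X _ m c hc
    have h := P.comp_assoc (X := fun z y => X ⟨z, y⟩) a b (fun z y => c ⟨z, y⟩)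
    have := (TreeComp.node (I := I) _ a _ (fun z => ih z (X := fun y => X ⟨z, y⟩)
      (fun y => m ⟨z, y⟩) (fun y => c ⟨z, y⟩) (fun y => hc ⟨z, y⟩))).relabel
      (Equiv.sigmaAssoc (fun z y => X ⟨z, y⟩)).symm
    refine this.congr ?_ (eq_relabel_symm _ h.symm)
    exact finsum_sigma_add l m
  | @nodeIdeal Z _ Y _ l a ha b hb ih =>
    intro X _ m c hc
    have h := P.comp_assoc (X := fun z y => X ⟨z, y⟩) a b (fun z y => c ⟨z, y⟩)
    have := (TreeComp.nodeIdeal (I := I) _ a ha _ (fun z => ih z (X := fun y => X ⟨z, y⟩)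
      (fun y => m ⟨z, y⟩) (fun y => c ⟨z, y⟩) (fun y => hc ⟨z, y⟩))).relabel
      (Equiv.sigmaAssoc (fun z y => X ⟨z, y⟩)).symm
    refine this.congr ?_ (eq_relabel_symm _ h.symm)
    rw [finsum_sigma_add l m, add_assoc]
  | relabel e c hc ih =>
    intro X _ m b hb
    refine ((ih (fun y => m (e y)) (fun y => b (e y)) (fun y => hb (e y))).relabel
      (Equiv.sigmaCongrLeft e)).congr ?_ (P.comp_relabel_left e c b).symm
    rw [finsum_comp_equiv e]

/-- The filtration of an operad by powers of an ideal `I`: the `n`-th step is spanned by the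
compositions along rooted trees in which elements of `I` are used for at least `n` vertices. -/
def idealFiltration (I : P.OperadIdeal) : P.Filtration where
  F n X _ := Submodule.span k {c | ∃ m, n ≤ m ∧ P.TreeComp I m X c}
  relabel_mem {n X Y} _ _ e a ha := by
    have h : Submodule.span k {c | ∃ m, n ≤ m ∧ P.TreeComp I m X c} ≤
        (Submodule.span k {c | ∃ m, n ≤ m ∧ P.TreeComp I m Y c}).comap (P.relabel e) := by
      rw [Submodule.span_le]
      rintro c ⟨m, hm, hc⟩
      exact Submodule.subset_span ⟨m, hm, hc.relabel e⟩
    exact h ha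
  F_zero X _ := by
    rw [eq_top_iff]
    rintro a -
    refine Submodule.subset_span ⟨_, le_rfl, ?_⟩
    exact ((TreeComp.node (I := I) (fun _ => 0) a _ (fun _ => TreeComp.trivial)).relabel
      (Equiv.sigmaPUnit X)).congr (by simp) (P.comp_one a)
  F_succ_le n X _ := Submodule.span_mono fun c ⟨m, hm, hc⟩ => ⟨m, by omega, hc⟩
  comp_mem {n Y} _ {X} _ m a b ha hb := by
    refine multilinear_mem_of_span (P.comp a) _ _ ?_ b hb
    intro b hb
    choose l hl hb using hb
    have h : Submodule.span k {c | ∃ m, n ≤ m ∧ P.TreeComp I m Y c} ≤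
        (Submodule.span k {c | ∃ l, n + ∑ᶠ y, m y ≤ l ∧ P.TreeComp I l (Σ y, X y) c}).comap
          (P.compEval b) := by
      rw [Submodule.span_le]
      rintro c ⟨i, hi, hc⟩
      refine Submodule.subset_span ⟨_, ?_, hc.comp l b hb⟩
      cases nonempty_fintype Y
      simp only [finsum_eq_sum_of_fintype]
      exact Nat.add_le_add hi (Finset.sum_le_sum fun y _ => hl y)
    exact h ha

end Operad

/-! ### The operad of almost Poisson algebras -/

/-- Binary trees, with vertices labelled by elements of `G` and leaves labelled by elements of
`X`, that is, iterations of the binary operations in `G` applied to the variables in `X`. -/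
inductive BinTree (G X : Type) : Type
  | leaf (x : X) : BinTree G X
  | node (g : G) (l r : BinTree G X) : BinTree G X

namespace BinTree

variable {G X Y Z : Type}

open Classical in
/-- The number of leaves labelled `x`. -/
noncomputable def occ : BinTree G X → X → ℕ
  | leaf y, x => if y = x then 1 else 0
  | node _ l r, x => occ l x + occ r x

/-- Each variable occurs exactly once. -/
def IsMultilinear (t : BinTree G X) : Prop := ∀ x, t.occ x = 1

/-- Renaming of variables. -/
def map (f : X → Y) : BinTree G X → BinTree G Y
  | leaf x => leaf (f x)
  | node g l r => node g (l.map f) (r.map f)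

/-- Substitution of the tree `s y` for the variable `y`, for all `y`. -/
def subst {X : Y → Type} (s : ∀ y, BinTree G (X y)) : BinTree G Y → BinTree G (Σ y, X y)
  | leaf y => (s y).map (Sigma.mk y)
  | node g l r => node g (l.subst s) (r.subst s)

theorem occ_map {f : X → Y} (hf : Injective f) (t : BinTree G X) (x : X) :
    (t.map f).occ (f x) = t.occ x := by
  induction t with
  | leaf y => by_cases h : y = x <;> simp [map, occ, hf.eq_iff, h]
  | node g l r hl hr => simp [map, occ, hl, hr]

theorem occ_map_of_notMem {f : X → Y} (t : BinTree G X) (y : Y) (hy : ∀ x, f x ≠ y) :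
    (t.map f).occ y = 0 := by
  induction t with
  | leaf x => simp [map, occ, hy]
  | node g l r hl hr => simp [map, occ, hl, hr]

theorem occ_subst {X : Y → Type} (s : ∀ y, BinTree G (X y)) (t : BinTree G Y) (y : Y) (x : X y) :
    (t.subst s).occ ⟨y, x⟩ = t.occ y * (s y).occ x := by
  induction t with
  | leaf z =>
    by_cases h : z = y
    · subst h
      simp [subst, occ, occ_map sigma_mk_injective]
    · simp only [subst, occ, h, if_false, zero_mul]
      exact occ_map_of_notMem _ _ (fun x' hx => h (congrArg Sigma.fst hx))
  | node g l r hl hr => simp [subst, occ, hl, hr, add_mul]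

theorem IsMultilinear.map {t : BinTree G X} (ht : t.IsMultilinear) (e : X ≃ Y) :
    (t.map e).IsMultilinear := fun y => by
  obtain ⟨x, rfl⟩ := e.surjective y
  rw [occ_map e.injective, ht]

theorem IsMultilinear.subst {X : Y → Type} {s : ∀ y, BinTree G (X y)} {t : BinTree G Y}
    (ht : t.IsMultilinear) (hs : ∀ y, (s y).IsMultilinear) : (t.subst s).IsMultilinear :=
  fun ⟨y, x⟩ => by rw [occ_subst, ht, hs]

theorem map_id' (t : BinTree G X) (f : X → X) (hf : ∀ x, f x = x) : t.map f = t := by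
  induction t with
  | leaf x => simp [map, hf]
  | node g l r hl hr => simp [map, hl, hr]

theorem map_map (f : X → Y) (g : Y → Z) (t : BinTree G X) :
    (t.map f).map g = t.map (fun x => g (f x)) := by
  induction t with
  | leaf x => rfl
  | node g l r hl hr => simp [map, hl, hr]

theorem map_congr {f g : X → Y} (h : ∀ x, f x = g x) (t : BinTree G X) : t.map f = t.map g := by
  rw [funext h]

theorem subst_map_right {X X' : Y → Type} (f : ∀ y, X y → X' y) (s : ∀ y, BinTree G (X y))
    (t : BinTree G Y) :
    t.subst (fun y => (s y).map (f y)) = (t.subst s).map (fun p => ⟨p.1, f p.1 p.2⟩) := by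
  induction t with
  | leaf y => simp [subst, map_map]
  | node g l r hl hr => simp [subst, map, hl, hr]

theorem subst_map_left {Y' : Type} {X : Y' → Type} (f : Y → Y') (s : ∀ y, BinTree G (X y))
    (t : BinTree G Y) :
    (t.map f).subst s = (t.subst (fun y => s (f y))).map (fun p => ⟨f p.1, p.2⟩) := by
  induction t with
  | leaf y => simp [subst, map, map_map]
  | node g l r hl hr => simp [subst, map, hl, hr]

theorem subst_leaf (t : BinTree G Y) :
    t.subst (fun _ => leaf ()) = t.map (fun y => ⟨y, ()⟩) := by
  induction t with
  | leaf y => rfl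
  | node g l r hl hr => simp [subst, map, hl, hr]

theorem subst_subst {Y : Z → Type} {X : ∀ z, Y z → Type} (s : ∀ z, BinTree G (Y z))
    (r : ∀ z y, BinTree G (X z y)) (t : BinTree G Z) :
    t.subst (fun z => (s z).subst (r z)) =
      ((t.subst s).subst (fun p => r p.1 p.2)).map (Equiv.sigmaAssoc X) := by
  induction t with
  | leaf z =>
    simp only [subst]
    rw [subst_map_left, map_map]
    exact map_congr (fun p => rfl) _
  | node g l r hl hr => simp [subst, map, hl, hr]

end BinTree

open Operad

variable (k : Type u) [Field k] (G : Type)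

/-- Multilinear trees: each variable occurs exactly once. -/
abbrev MultilinearTree (G X : Type) : Type := {t : BinTree G X // t.IsMultilinear}

/-- The composition of the free operad, with a tree in the root: the multilinear extension of the
substitution of trees. -/
noncomputable def freeComp {Y : Type} [Finite Y] {X : Y → Type} (t : MultilinearTree G Y) :
    MultilinearMap k (fun y => MultilinearTree G (X y) →₀ k)
      (MultilinearTree G (Σ y, X y) →₀ k) := by
  classical
  exact (MultilinearMap.fromDirectSumEquiv (M := fun (y : Y) (_ : MultilinearTree G (X y)) => k)
    (fun s => letI := Fintype.ofFinite Y
      MultilinearMap.mkPiRing k Y (Finsupp.single ⟨t.1.subst (fun y => (s y).1),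
        t.2.subst (fun y => (s y).2)⟩ (1 : k)))).compLinearMap
    (fun y => (finsuppLEquivDirectSum k k (MultilinearTree G (X y))).toLinearMap)

/-- The underlying data of the free operad. -/
noncomputable def freePre : PreOperad.{u, u} k where
  obj X _ := MultilinearTree G X →₀ k
  relabel e := Finsupp.lmapDomain k k (fun t => ⟨t.1.map e, t.2.map e⟩)
  one := Finsupp.single ⟨BinTree.leaf (), fun _ => by simp [BinTree.occ]⟩ 1
  comp := Finsupp.lift _ k _ (freeComp k G)

variable {G}

/-- A tree as an element of the free operad. -/
noncomputable def freeTree {X : Type} [Finite X] (t : BinTree G X) (ht : t.IsMultilinear) :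
    (freePre k G).obj X :=
  Finsupp.single (⟨t, ht⟩ : MultilinearTree G X) (1 : k)

theorem freeTree_congr {X : Type} [Finite X] {t s : BinTree G X} (ht : t.IsMultilinear)
    (hs : s.IsMultilinear) (h : t = s) : freeTree k t ht = freeTree k s hs := by
  subst h; rfl

theorem freePre_relabel {X Y : Type} [Finite X] [Finite Y] (e : X ≃ Y) (t : BinTree G X)
    (ht : t.IsMultilinear) :
    (freePre k G).relabel e (freeTree k t ht) = freeTree k (t.map e) (ht.map e) := by
  exact Finsupp.mapDomain_single

theorem freePre_comp {Y : Type} [Finite Y] {X : Y → Type} [∀ y, Finite (X y)] (t : BinTree G Y)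
    (ht : t.IsMultilinear) (s : ∀ y, BinTree G (X y)) (hs : ∀ y, (s y).IsMultilinear) :
    (freePre k G).comp (freeTree k t ht) (fun y => freeTree k (s y) (hs y)) =
      freeTree k (t.subst s) (ht.subst hs) := by
  classical
  change (Finsupp.lift _ k _ (freeComp k G (X := X)) (Finsupp.single (⟨t, ht⟩ :
    MultilinearTree G Y) (1 : k))) (fun y => Finsupp.single (⟨s y, hs y⟩ :
    MultilinearTree G (X y)) (1 : k)) = Finsupp.single ⟨t.subst s, ht.subst hs⟩ (1 : k)
  simp only [Finsupp.lift_apply, zero_smul, Finsupp.sum_single_index, one_smul, freeComp,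
    MultilinearMap.compLinearMap_apply, LinearEquiv.coe_coe, finsuppLEquivDirectSum_single]
  refine (MultilinearMap.fromDirectSumEquiv_lof
    (M := fun (y : Y) (_ : MultilinearTree G (X y)) => k) _ (fun y => ⟨s y, hs y⟩) _).trans ?_
  simp

theorem span_freeTree (X : Type) [Finite X] :
    Submodule.span k {a : (freePre k G).obj X | ∃ t ht, a = freeTree k t ht} = ⊤ := by
  rw [eq_top_iff]
  rintro a -
  induction a using Finsupp.induction_linear with
  | zero => exact Submodule.zero_mem _
  | add a b ha hb => exact Submodule.add_mem _ ha hb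
  | single t c =>
    have h : (Finsupp.single t c : MultilinearTree G X →₀ k) = c • Finsupp.single t 1 := by simp
    exact h ▸ Submodule.smul_mem _ c (Submodule.subset_span ⟨t.1, t.2, rfl⟩)

variable (G) in
/-- The free operad generated by a set `G` of binary operations (without any symmetry): its
component `X` has the multilinear binary trees with leaves labelled by `X` as a basis. -/
noncomputable def freeOperad : Operad.{u, u} k :=
  ofSpan (freePre k G) (fun X _ => {a | ∃ t ht, a = freeTree k t ht})
    (fun X _ => span_freeTree k X)
    (by
      rintro X _ _ ⟨t, ht, rfl⟩
      rw [freePre_relabel]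
      exact freeTree_congr k _ _ (t.map_id' _ fun _ => rfl))
    (by
      rintro X Y Z _ _ _ e f _ ⟨t, ht, rfl⟩
      rw [freePre_relabel, freePre_relabel, freePre_relabel]
      exact freeTree_congr k _ _ (t.map_map e f).symm)
    (by
      rintro Y _ X X' _ _ e _ b ⟨t, ht, rfl⟩ hb
      choose s hs h using hb
      obtain rfl : b = fun y => freeTree k (s y) (hs y) := funext h
      simp only [freePre_relabel, freePre_comp]
      exact freeTree_congr k _ _ (t.subst_map_right (fun y => e y) s))
    (by
      rintro Y Y' _ _ X _ e _ b ⟨t, ht, rfl⟩ hb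
      choose s hs h using hb
      obtain rfl : b = fun y => freeTree k (s y) (hs y) := funext h
      simp only [freePre_relabel, freePre_comp]
      exact freeTree_congr k _ _ (t.subst_map_left e s))
    (by
      rintro X _ _ ⟨t, ht, rfl⟩
      have := freePre_comp k (BinTree.leaf ()) (fun _ => by simp [BinTree.occ]) (fun _ : Unit => t)
        (fun _ => ht)
      refine (congrArg _ this).trans ?_
      rw [freePre_relabel]
      exact freeTree_congr k _ _ ((BinTree.map_map _ _ t).trans (t.map_id' _ fun _ => rfl)))
    (by
      rintro Y _ _ ⟨t, ht, rfl⟩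
      have := freePre_comp k t ht (fun _ => BinTree.leaf ()) (fun _ _ => by simp [BinTree.occ])
      refine (congrArg _ this).trans ?_
      rw [freePre_relabel]
      refine freeTree_congr k _ _ ?_
      rw [BinTree.subst_leaf, BinTree.map_map]
      exact t.map_id' _ fun _ => rfl)
    (by
      rintro Z _ Y _ X _ _ b c ⟨t, ht, rfl⟩ hb hc
      choose s hs h using hb
      obtain rfl : b = fun y => freeTree k (s y) (hs y) := funext h
      choose r hr h' using hc
      obtain rfl : c = fun z y => freeTree k (r z y) (hr z y) :=
        funext fun z => funext fun y => h' z y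
      simp only [freePre_comp, freePre_relabel]
      exact freeTree_congr k _ _ (t.subst_subst s r))

/-- The two operations of an almost Poisson algebra: the product and the bracket. -/
inductive AlmostPoissonOp : Type
  | mul
  | bracket

namespace AlmostPoisson

/-- The variables. -/
abbrev x {n : ℕ} (i : Fin n) : BinTree AlmostPoissonOp (Fin n) := BinTree.leaf i

/-- The product of two terms. -/
abbrev mul {n : ℕ} (s t : BinTree AlmostPoissonOp (Fin n)) : BinTree AlmostPoissonOp (Fin n) :=
  BinTree.node AlmostPoissonOp.mul s t

/-- The bracket of two terms. -/
abbrev br {n : ℕ} (s t : BinTree AlmostPoissonOp (Fin n)) : BinTree AlmostPoissonOp (Fin n) :=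
  BinTree.node AlmostPoissonOp.bracket s t

theorem isMultilinear_two (f : AlmostPoissonOp) (i j : Fin 2) (h : i ≠ j) :
    (BinTree.node f (x i) (x j)).IsMultilinear := by
  intro l
  simp only [BinTree.occ]
  split_ifs <;> omega

theorem isMultilinear_left (f g : AlmostPoissonOp) (i j l : Fin 3) (h : i ≠ j) (h' : i ≠ l)
    (h'' : j ≠ l) : (BinTree.node f (BinTree.node g (x i) (x j)) (x l)).IsMultilinear := by
  intro m
  simp only [BinTree.occ]
  split_ifs <;> omega

theorem isMultilinear_right (f g : AlmostPoissonOp) (i j l : Fin 3) (h : i ≠ j) (h' : i ≠ l)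
    (h'' : j ≠ l) : (BinTree.node f (x i) (BinTree.node g (x j) (x l))).IsMultilinear := by
  intro m
  simp only [BinTree.occ]
  split_ifs <;> omega

/-- The defining relations of almost Poisson algebras: the product is commutative and
associative, the bracket is anticommutative, and `{a₁a₂, a₃} = a₁{a₂, a₃} + {a₁, a₃}a₂` (by
anticommutativity, the bracket is then a derivation in each argument). -/
inductive Relation : (Σ n : ℕ, (freeOperad k AlmostPoissonOp).obj (Fin n)) → Prop
  | mul_comm : Relation ⟨2,
      freeTree k (mul (x 0) (x 1)) (isMultilinear_two _ _ _ (by decide)) -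
      freeTree k (mul (x 1) (x 0)) (isMultilinear_two _ _ _ (by decide))⟩
  | br_anticomm : Relation ⟨2,
      freeTree k (br (x 0) (x 1)) (isMultilinear_two _ _ _ (by decide)) +
      freeTree k (br (x 1) (x 0)) (isMultilinear_two _ _ _ (by decide))⟩
  | mul_assoc : Relation ⟨3,
      freeTree k (mul (mul (x 0) (x 1)) (x 2))
        (isMultilinear_left _ _ _ _ _ (by decide) (by decide) (by decide)) -
      freeTree k (mul (x 0) (mul (x 1) (x 2)))
        (isMultilinear_right _ _ _ _ _ (by decide) (by decide) (by decide))⟩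
  | leibniz : Relation ⟨3,
      freeTree k (br (mul (x 0) (x 1)) (x 2))
        (isMultilinear_left _ _ _ _ _ (by decide) (by decide) (by decide)) -
      freeTree k (mul (x 0) (br (x 1) (x 2)))
        (isMultilinear_right _ _ _ _ _ (by decide) (by decide) (by decide)) -
      freeTree k (mul (br (x 0) (x 2)) (x 1))
        (isMultilinear_left _ _ _ _ _ (by decide) (by decide) (by decide))⟩

/-- The operadic ideal generated by the relations of almost Poisson algebras. -/
noncomputable def relations : (freeOperad k AlmostPoissonOp).OperadIdeal :=
  idealSpan _ {s | Relation k s}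

end AlmostPoisson

/-- The operad of almost Poisson algebras. -/
noncomputable def almostPoisson : Operad.{u, u} k :=
  (freeOperad k AlmostPoissonOp).quotient (AlmostPoisson.relations k)

/-- The product `a₁a₂` in the almost Poisson operad. -/
noncomputable def almostPoissonMul : (almostPoisson k).obj (Fin 2) :=
  toQuotient _ (AlmostPoisson.relations k) (Fin 2)
    (freeTree k (AlmostPoisson.mul (AlmostPoisson.x 0) (AlmostPoisson.x 1))
      (AlmostPoisson.isMultilinear_two _ _ _ (by decide)))

/-- The bracket `{a₁, a₂}` in the almost Poisson operad. -/
noncomputable def almostPoissonBracket : (almostPoisson k).obj (Fin 2) :=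
  toQuotient _ (AlmostPoisson.relations k) (Fin 2)
    (freeTree k (AlmostPoisson.br (AlmostPoisson.x 0) (AlmostPoisson.x 1))
      (AlmostPoisson.isMultilinear_two _ _ _ (by decide)))

/-! ### Operads generated by one binary operation -/

namespace Operad

variable {k} (O : Operad.{u, v} k) (μ : O.obj (Fin 2))

/-- The opposite `a₂ · a₁` of a binary operation `a₁ · a₂`. -/
def opp : O.obj (Fin 2) := O.relabel (Equiv.swap 0 1) μ

/-- The ideal generated by `{a₁, a₂} = a₁ · a₂ - a₂ · a₁`. -/
def commutatorIdeal : O.OperadIdeal := O.idealSpan {⟨2, μ - O.opp μ⟩}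

end Operad

/-! ### Combinatorics of binary trees -/

/-! Write ab and {a, b} for the operations μ + μᵒᵖ and μ - μᵒᵖ of O. As 2 is invertible they
generate O, so O is a quotient of the free operad on two binary operations (`commutatorHom`), and
the filtration counts brackets: Fⁿ is spanned by the values of trees with at least n brackets
(`commutatorFiltration_eq`). A tree with r leaves has r - 1 vertices, so Fⁿ is zero in every arity r
≤ n.

The given isomorphism ψ from the associated graded operad is not assumed to respect any grading. In
arity two, however, the transposition separates product and bracket, so ψ carries their classes to
nonzero multiples of the product and the bracket. Trees of fixed arity with a fixed number of
brackets are then rescaled by one common nonzero factor. This gives the main tool,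
`mem_relations_iff`: an element of the free operad homogeneous of degree n in the bracket is an
almost Poisson relation if and only if its value in O lies in Fⁿ⁺¹. One direction puts the
associator in F¹ and the defect of the Leibniz rule in F²; the other forbids a non-relation of
degree n to fall into Fⁿ⁺¹.

It remains to see that both defects vanish. Symmetry leaves one parameter at each stage. Modulo F²
the associator is α(a{b,c} - 2b{c,a} + c{a,b}); once α = 0 it is β({a,{b,c}} - 2{b,{c,a}} +
{c,{a,b}}); the Leibniz defect is γ({a,{b,c}} - {b,{c,a}}). In arity four each parameter is the
coefficient of a non-relation which has to vanish: α by the pentagon of rebracketings modulo F², γ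
by bracketing the associator with d modulo F³, β modulo F⁴ because {-, d}, by then a derivation of
the product, is a derivation of the associator. The polynomial Poisson plane detects the first two
non-relations. The third holds in every Poisson algebra, so it is detected by an anticommutative
algebra without the Jacobi identity.

Hence the map from the free operad factors through the almost Poisson operad. It is injective there:
an element of the kernel loses its part of lowest degree, a relation by `mem_relations_iff`, until
nothing is left.

The arity four computations are made with elements: every ideal of the free operad is recovered from
the values at the variables of its relatively free algebra (`mem_of_freeEval_relVar_eq_zero`). -/

/-- The family of types with values `A` and `B`. -/
def pairType (A B : Type) : Fin 2 → Type
  | 0 => A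
  | 1 => B

instance (A B : Type) [Finite A] [Finite B] (i : Fin 2) : Finite (pairType A B i) :=
  match i with
  | 0 => ‹Finite A›
  | 1 => ‹Finite B›

namespace BinTree

variable {G X Y : Type}

/-- The family of trees with values `s` and `t`. -/
def pair {A B : Type} (s : BinTree G A) (t : BinTree G B) :
    ∀ i, BinTree G (pairType A B i)
  | 0 => s
  | 1 => t

/-- The sum of the weights of the vertices of a tree. -/
def weight (c : G → ℕ) : BinTree G X → ℕ
  | leaf _ => 0
  | node g l r => c g + l.weight c + r.weight c

theorem weight_map (c : G → ℕ) (f : X → Y) (t : BinTree G X) :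
    (t.map f).weight c = t.weight c := by
  induction t with
  | leaf x => rfl
  | node g l r hl hr => simp [map, weight, hl, hr]

/-- A binary tree has one leaf more than vertices. This is what bounds the number of brackets by the
arity and makes the filtration finite. -/
theorem sum_occ [Fintype X] (t : BinTree G X) : ∑ x, t.occ x = t.weight (fun _ => 1) + 1 := by
  classical
  induction t with
  | leaf x => simp [occ, weight]
  | node g l r hl hr => simp only [occ, weight, Finset.sum_add_distrib, hl, hr]; omega

theorem IsMultilinear.weight_one [Fintype X] {t : BinTree G X} (ht : t.IsMultilinear) :
    t.weight (fun _ => 1) + 1 = Fintype.card X := by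
  rw [← sum_occ]
  simp [ht _]

theorem weight_subst_sum (c : G → ℕ) [Fintype Y] {X : Y → Type} (s : ∀ y, BinTree G (X y))
    (t : BinTree G Y) :
    (t.subst s).weight c = t.weight c + ∑ y, t.occ y * (s y).weight c := by
  classical
  induction t with
  | leaf y => simp [subst, weight, weight_map, occ]
  | node g l r hl hr =>
    simp only [subst, weight, hl, hr, occ, add_mul, Finset.sum_add_distrib]; omega

/-- Each variable occurs once, so each substituted tree contributes its weight once: weights are
additive under operadic composition. -/
theorem IsMultilinear.weight_subst (c : G → ℕ) [Finite Y] {X : Y → Type}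
    (s : ∀ y, BinTree G (X y)) {t : BinTree G Y} (ht : t.IsMultilinear) :
    (t.subst s).weight c = t.weight c + ∑ᶠ y, (s y).weight c := by
  cases nonempty_fintype Y
  simp [weight_subst_sum, ht _, finsum_eq_sum_of_fintype]

theorem exists_restrict (p : X → Prop) (t : BinTree G X) (h : ∀ x, t.occ x ≠ 0 → p x) :
    ∃ s : BinTree G {x // p x}, s.map Subtype.val = t := by
  induction t with
  | leaf x => exact ⟨leaf ⟨x, h x (by simp [occ])⟩, rfl⟩
  | node g l r hl hr =>
    obtain ⟨l', rfl⟩ := hl fun x hx => h x (by simp [occ, hx])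
    obtain ⟨r', rfl⟩ := hr fun x hx => h x (by simp [occ, hx])
    exact ⟨node g l' r', rfl⟩

theorem exists_multilinear_restrict (t : BinTree G X) (h : ∀ x, t.occ x ≤ 1) :
    ∃ s : BinTree G {x // t.occ x = 1}, s.IsMultilinear ∧ s.map Subtype.val = t := by
  obtain ⟨s, hs⟩ := exists_restrict (fun x => t.occ x = 1) t
    (fun x hx => by have := h x; omega)
  refine ⟨s, fun x => ?_, hs⟩
  rw [← occ_map Subtype.val_injective, hs, x.2]

theorem isMultilinear_unit : (leaf () : BinTree G Unit).IsMultilinear := fun _ => by simp [occ]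

theorem isMultilinear_node (g : G) :
    (node g (leaf 0) (leaf 1) : BinTree G (Fin 2)).IsMultilinear := by
  intro l
  simp only [occ]
  split_ifs <;> omega

theorem IsMultilinear.pair {A B : Type} {s : BinTree G A} {t : BinTree G B}
    (hs : s.IsMultilinear) (ht : t.IsMultilinear) (i : Fin 2) : (pair s t i).IsMultilinear :=
  match i with
  | 0 => hs
  | 1 => ht

/-- Every multilinear tree is obtained, up to relabelling, from the tree without vertices by
joining two multilinear trees at a root. -/
theorem IsMultilinear.induction {motive : ∀ (X : Type) [Finite X], BinTree G X → Prop}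
    (unit : motive Unit (leaf ()))
    (relabel : ∀ {X Y : Type} [Finite X] [Finite Y] (e : X ≃ Y) (t : BinTree G X),
      t.IsMultilinear → motive X t → motive Y (t.map e))
    (node : ∀ {A B : Type} [Finite A] [Finite B] (g : G) (s : BinTree G A) (t : BinTree G B),
      s.IsMultilinear → t.IsMultilinear → motive A s → motive B t →
      motive (Σ i, pairType A B i) ((BinTree.node g (leaf 0) (leaf 1)).subst (BinTree.pair s t)))
    {X : Type} [Finite X] {t : BinTree G X} (ht : t.IsMultilinear) : motive X t := by
  -- The two subtrees at the root are multilinear only over their own sets of labels, so the label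
  -- set must vary and the induction is on a bound for the number of vertices.
  have key : ∀ n : ℕ, ∀ (X : Type) [Finite X] (t : BinTree G X), t.IsMultilinear →
      t.weight (fun _ => 1) ≤ n → motive X t := by
    intro n
    induction n with
    | zero =>
      intro X _ t ht hn
      cases t with
      | leaf x =>
        have hx : ∀ y, x = y := fun y => by
          have := ht y
          simp only [occ] at this
          by_contra h
          simp [h] at this
        exact relabel ⟨fun _ => x, fun _ => (), fun _ => rfl, hx⟩ _ isMultilinear_unit unit
      | node g l r => simp [weight] at hn
    | succ n ih =>
      intro X _ t ht hn
      cases t with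
      | leaf x => exact ih X _ ht (by simp [weight])
      | node g l r =>
        have hlr : ∀ x, l.occ x + r.occ x = 1 := ht
        simp only [weight] at hn
        obtain ⟨l', hl, hl'⟩ := exists_multilinear_restrict l (fun x => by have := hlr x; omega)
        obtain ⟨r', hr, hr'⟩ := exists_multilinear_restrict r (fun x => by have := hlr x; omega)
        have wl := l'.weight_map (fun _ => 1) Subtype.val
        have wr := r'.weight_map (fun _ => 1) Subtype.val
        rw [hl'] at wl
        rw [hr'] at wr
        -- Gluing of the two label sets; it is bijective because each variable occurs in exactly one
        -- of the two subtrees.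
        let f : (Σ i, pairType {x // l.occ x = 1} {x // r.occ x = 1} i) → X
          | ⟨0, a⟩ => a.1
          | ⟨1, a⟩ => a.1
        have hf : Bijective f := by
          constructor
          · rintro ⟨i, a⟩ ⟨j, b⟩ h
            match i, j, a, b, h with
            | 0, 0, a, b, h => exact congrArg (Sigma.mk (0 : Fin 2)) (Subtype.ext h)
            | 1, 1, a, b, h => exact congrArg (Sigma.mk (1 : Fin 2)) (Subtype.ext h)
            | 0, 1, ⟨a, ha⟩, ⟨b, hb⟩, h =>
              have : a = b := h
              have := hlr b
              subst a; omega
            | 1, 0, ⟨a, ha⟩, ⟨b, hb⟩, h =>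
              have : a = b := h
              have := hlr b
              subst a; omega
          · intro x
            by_cases h : l.occ x = 1
            · exact ⟨⟨0, ⟨x, h⟩⟩, rfl⟩
            · exact ⟨⟨1, ⟨x, by have := hlr x; omega⟩⟩, rfl⟩
        have := relabel (Equiv.ofBijective f hf) _
          ((isMultilinear_node g).subst (hl.pair hr))
          (node g l' r' hl hr (ih _ l' hl (by omega)) (ih _ r' hr (by omega)))
        have e : ((BinTree.node g (leaf 0) (leaf 1)).subst (BinTree.pair l' r')).map f
            = BinTree.node g l r := by
          have h1 : (l'.map (Sigma.mk (0 : Fin 2))).map f = l :=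
            (BinTree.map_map (Y := Σ i, pairType _ _ i) _ f l').trans hl'
          have h2 : (r'.map (Sigma.mk (1 : Fin 2))).map f = r :=
            (BinTree.map_map (Y := Σ i, pairType _ _ i) _ f r').trans hr'
          exact congrArg₂ _ h1 h2
        exact e ▸ this
  exact key _ X t ht le_rfl

end BinTree

/-! ### Morphisms of operads and the universal property of the free operad -/

namespace Operad

variable {k : Type u} [Field k]

/-- A morphism of operads. -/
structure Hom (P : Operad.{u, v} k) (Q : Operad.{u, w} k) where
  toLin : ∀ (X : Type) [Finite X], P.obj X →ₗ[k] Q.obj X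
  map_relabel : ∀ {X Y : Type} [Finite X] [Finite Y] (e : X ≃ Y) (a : P.obj X),
    toLin Y (P.relabel e a) = Q.relabel e (toLin X a)
  map_one : toLin Unit P.one = Q.one
  map_comp : ∀ {Y : Type} [Finite Y] {X : Y → Type} [∀ y, Finite (X y)] (a : P.obj Y)
    (b : ∀ y, P.obj (X y)),
    toLin (Σ y, X y) (P.comp a b) = Q.comp (toLin Y a) (fun y => toLin (X y) (b y))

/-- The preimage of an ideal. -/
def OperadIdeal.comap {P : Operad.{u, v} k} {Q : Operad.{u, w} k} (I : Q.OperadIdeal)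
    (φ : Hom P Q) : P.OperadIdeal where
  carrier X _ := (I.carrier X).comap (φ.toLin X)
  relabel_mem e a ha := by
    rw [Submodule.mem_comap, φ.map_relabel]; exact I.relabel_mem e ha
  comp_mem_left b ha := by
    rw [Submodule.mem_comap, φ.map_comp]; exact I.comp_mem_left _ ha
  comp_mem_right a b y hb := by
    rw [Submodule.mem_comap, φ.map_comp]; exact I.comp_mem_right _ y hb

/-- The zero ideal. -/
def zeroIdeal (P : Operad.{u, v} k) : P.OperadIdeal where
  carrier X _ := ⊥
  relabel_mem e a ha := by simp [(Submodule.mem_bot k).1 ha]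
  comp_mem_left b ha := by simp [(Submodule.mem_bot k).1 ha]
  comp_mem_right a b y hb := (Submodule.mem_bot k).2 <|
    (P.comp a).map_coord_zero y ((Submodule.mem_bot k).1 hb)

/-- The projection to the quotient by an ideal. -/
noncomputable def Hom.toQuotient {P : Operad.{u, v} k} (I : P.OperadIdeal) :
    Hom P (P.quotient I) where
  toLin X _ := P.toQuotient I X
  map_relabel _ _ := rfl
  map_one := rfl
  map_comp a b := (P.comp_toQuotient I a b).symm

/-- Composition of a morphism and an isomorphism. -/
def Iso.compHom {P : Operad.{u, v} k} {Q : Operad.{u, w} k} {R : Operad.{u, v} k}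
    (ψ : Iso Q R) (φ : Hom P Q) : Hom P R where
  toLin X _ := (ψ.equiv X).toLinearMap ∘ₗ φ.toLin X
  map_relabel e a := by simp [φ.map_relabel, ψ.map_relabel]
  map_one := by simp [φ.map_one, ψ.map_one]
  map_comp a b := by simp [φ.map_comp, ψ.map_comp]

theorem idealSpan_le {P : Operad.{u, v} k} {S : Set (Σ n : ℕ, P.obj (Fin n))}
    {I : P.OperadIdeal} (h : ∀ s ∈ S, s.2 ∈ I.carrier (Fin s.1)) (X : Type) [Finite X] :
    (P.idealSpan S).carrier X ≤ I.carrier X :=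
  iInf₂_le I h

theorem subset_idealSpan {P : Operad.{u, v} k} {S : Set (Σ n : ℕ, P.obj (Fin n))} {n : ℕ}
    {a : P.obj (Fin n)} (h : ⟨n, a⟩ ∈ S) : a ∈ (P.idealSpan S).carrier (Fin n) := by
  simp only [idealSpan, Submodule.mem_iInf]
  exact fun I hI => hI _ h

/-- The family of operations with values `a` and `b`. -/
def _root_.PreOperad.pair (P : PreOperad.{u, v} k) {A B : Type} [Finite A] [Finite B]
    (a : P.obj A) (b : P.obj B) : ∀ i, P.obj (pairType A B i)
  | 0 => a
  | 1 => b

end Operad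

/-! ### Operations of an operad defined by trees -/

namespace BinTree

variable {G X Y : Type}

/-- The type of leaves of a tree. -/
def Leaves : BinTree G X → Type
  | leaf _ => Unit
  | node _ l r => Σ i, pairType l.Leaves r.Leaves i

instance finite_leaves (t : BinTree G X) : Finite t.Leaves := by
  induction t with
  | leaf x => exact inferInstanceAs (Finite Unit)
  | node g l r hl hr => exact inferInstanceAs (Finite (Σ i, pairType l.Leaves r.Leaves i))

/-- The label of a leaf. -/
def label : (t : BinTree G X) → t.Leaves → X
  | leaf x, _ => x
  | node _ l _, ⟨0, p⟩ => l.label p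
  | node _ _ r, ⟨1, p⟩ => r.label p

theorem occ_ne_zero_iff (t : BinTree G X) (x : X) : t.occ x ≠ 0 ↔ ∃ p, t.label p = x := by
  induction t with
  | leaf y =>
    by_cases h : y = x
    · exact iff_of_true (by simp [occ, h]) ⟨(), h⟩
    · exact iff_of_false (by simp [occ, h]) fun ⟨_, hp⟩ => h hp
  | node g l r hl hr =>
    rw [occ, ne_eq, Nat.add_eq_zero_iff, not_and_or]
    refine (or_congr hl hr).trans ⟨?_, ?_⟩
    · rintro (⟨p, hp⟩ | ⟨p, hp⟩)
      · exact ⟨⟨0, p⟩, hp⟩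
      · exact ⟨⟨1, p⟩, hp⟩
    · rintro ⟨⟨i, p⟩, hp⟩
      match i, p, hp with
      | 0, p, hp => exact Or.inl ⟨p, hp⟩
      | 1, p, hp => exact Or.inr ⟨p, hp⟩

theorem label_injective (t : BinTree G X) (h : ∀ x, t.occ x ≤ 1) : Injective t.label := by
  induction t with
  | leaf y => exact fun _ _ _ => rfl
  | node g l r hl hr =>
    have hlr : ∀ x, l.occ x + r.occ x ≤ 1 := h
    have disj : ∀ p q, l.label p ≠ r.label q := fun p q e => by
      have h1 := (occ_ne_zero_iff l _).2 ⟨p, rfl⟩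
      have h2 := (occ_ne_zero_iff r _).2 ⟨q, e.symm⟩
      have := hlr (l.label p)
      omega
    rintro ⟨i, p⟩ ⟨j, q⟩ hpq
    match i, j, p, q, hpq with
    | 0, 0, p, q, hpq =>
      exact congrArg (Sigma.mk (0 : Fin 2)) (hl (fun x => by have := hlr x; omega) hpq)
    | 1, 1, p, q, hpq =>
      exact congrArg (Sigma.mk (1 : Fin 2)) (hr (fun x => by have := hlr x; omega) hpq)
    | 0, 1, p, q, hpq => exact (disj p q hpq).elim
    | 1, 0, p, q, hpq => exact (disj q p hpq.symm).elim

theorem IsMultilinear.label_bijective {t : BinTree G X} (ht : t.IsMultilinear) :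
    Bijective t.label :=
  ⟨t.label_injective fun x => (ht x).le,
    fun x => (t.occ_ne_zero_iff x).1 (by rw [ht x]; exact one_ne_zero)⟩

/-- The bijection between leaves and labels of a multilinear tree. -/
noncomputable def IsMultilinear.labelEquiv {t : BinTree G X} (ht : t.IsMultilinear) :
    t.Leaves ≃ X :=
  Equiv.ofBijective t.label ht.label_bijective

variable {k : Type u} [Field k] (Q : Operad.{u, w} k) (gen : G → Q.obj (Fin 2))

/-- The composition along a tree of the operations given by its vertices. -/
def shape : (t : BinTree G X) → Q.obj t.Leaves
  | leaf _ => Q.one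
  | node g l r => Q.comp (gen g) (Q.pair (shape l) (shape r))

/-- A bijection between types of pairs. -/
def pairEquiv {A A' B B' : Type} (e : A ≃ A') (f : B ≃ B') :
    ∀ i, pairType A B i ≃ pairType A' B' i
  | 0 => e
  | 1 => f

theorem relabel_pair {A A' B B' : Type} [Finite A] [Finite A'] [Finite B] [Finite B']
    (e : A ≃ A') (f : B ≃ B') (a : Q.obj A) (b : Q.obj B) :
    Q.pair (Q.relabel e a) (Q.relabel f b) =
      fun i => Q.relabel (pairEquiv e f i) (Q.pair a b i) := by
  funext i
  match i with
  | 0 => rfl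
  | 1 => rfl

/-- Renaming labels changes the type of leaves only up to a bijection. Shapes live on leaves and not
on labels, so `f` need not be injective nor surjective; in `shape_subst` it is `Sigma.mk y`. -/
theorem shape_map (f : X → Y) (t : BinTree G X) : ∃ e : (t.map f).Leaves ≃ t.Leaves,
    (∀ p, (t.map f).label p = f (t.label (e p))) ∧
      Q.relabel e ((t.map f).shape Q gen) = t.shape Q gen := by
  induction t with
  | leaf x => exact ⟨Equiv.refl _, fun _ => rfl, Q.relabel_refl _⟩
  | node g l r hl hr =>
    obtain ⟨el, h1, h2⟩ := hl
    obtain ⟨er, h3, h4⟩ := hr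
    refine ⟨Equiv.sigmaCongrRight (pairEquiv el er), ?_, ?_⟩
    · rintro ⟨i, p⟩
      match i, p with
      | 0, p => exact h1 p
      | 1, p => exact h3 p
    · have := Q.comp_relabel_right (pairEquiv el er) (gen g)
        (Q.pair ((l.map f).shape Q gen) ((r.map f).shape Q gen))
      rw [← relabel_pair, h2, h4] at this
      exact this.symm

/-- At a leaf this is the left unit axiom of `Q`, at a vertex its associativity axiom; the bijection
of leaves is carried along because it must also match the labels. -/
theorem shape_subst {X : Y → Type} (s : ∀ y, BinTree G (X y)) (t : BinTree G Y) :
    ∃ e : (t.subst s).Leaves ≃ Σ p : t.Leaves, (s (t.label p)).Leaves,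
    (∀ p, (t.subst s).label p = ⟨t.label (e p).1, (s _).label (e p).2⟩) ∧
      Q.relabel e ((t.subst s).shape Q gen) =
        Q.comp (t.shape Q gen) (fun p => (s (t.label p)).shape Q gen) := by
  induction t with
  | leaf y =>
    obtain ⟨e, h1, h2⟩ := shape_map Q gen (Sigma.mk y) (s y)
    refine ⟨e.trans (Equiv.uniqueSigma (fun _ : Unit => (s y).Leaves)).symm, h1, ?_⟩
    refine (Q.relabel_trans _ _ _).trans ?_
    exact (congrArg _ h2).trans (eq_relabel_symm _ (Q.one_comp ((s y).shape Q gen)))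
  | node g l r hl hr =>
    obtain ⟨el, h1, h2⟩ := hl
    obtain ⟨er, h3, h4⟩ := hr
    let Z : ∀ i, pairType l.Leaves r.Leaves i → Type := fun i p =>
      (s ((node g l r).label ⟨i, p⟩)).Leaves
    have : ∀ i p, Finite (Z i p) := fun i p => finite_leaves _
    let E : ∀ i, pairType (l.subst s).Leaves (r.subst s).Leaves i ≃ Σ p, Z i p
      | 0 => el
      | 1 => er
    have key := Q.comp_assoc (X := Z) (gen g) (Q.pair (l.shape Q gen) (r.shape Q gen))
      (fun i p => (s ((node g l r).label ⟨i, p⟩)).shape Q gen)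
    have key2 := Q.comp_relabel_right E (gen g)
      (Q.pair ((l.subst s).shape Q gen) ((r.subst s).shape Q gen))
    have e : (fun i => Q.relabel (E i)
        (Q.pair ((l.subst s).shape Q gen) ((r.subst s).shape Q gen) i)) =
        fun i => Q.comp (Q.pair (l.shape Q gen) (r.shape Q gen) i)
          (fun p => (s ((node g l r).label ⟨i, p⟩)).shape Q gen) := by
      funext i
      match i with
      | 0 => exact h2
      | 1 => exact h4
    rw [e, key] at key2
    refine ⟨(Equiv.sigmaCongrRight E).trans (Equiv.sigmaAssoc Z).symm, ?_, ?_⟩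
    · rintro ⟨i, p⟩
      match i, p with
      | 0, p => exact h1 p
      | 1, p => exact h3 p
    · refine (Q.relabel_trans _ _ _).trans ?_
      exact eq_relabel_symm _ key2

/-- The operation given by a multilinear tree. -/
noncomputable def IsMultilinear.toOperation [Finite X] {t : BinTree G X} (ht : t.IsMultilinear) :
    Q.obj X :=
  Q.relabel ht.labelEquiv (t.shape Q gen)

theorem IsMultilinear.toOperation_map [Finite X] [Finite Y] {t : BinTree G X}
    (ht : t.IsMultilinear) (e : X ≃ Y) :
    (ht.map e).toOperation Q gen = Q.relabel e (ht.toOperation Q gen) := by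
  obtain ⟨f, h1, h2⟩ := shape_map Q gen e t
  rw [toOperation, toOperation, ← h2, ← Q.relabel_trans, ← Q.relabel_trans]
  congr 1
  congr 1
  ext p
  exact h1 p

theorem IsMultilinear.toOperation_subst [Finite Y] {X : Y → Type} [∀ y, Finite (X y)]
    {t : BinTree G Y} (ht : t.IsMultilinear) {s : ∀ y, BinTree G (X y)}
    (hs : ∀ y, (s y).IsMultilinear) :
    (ht.subst hs).toOperation Q gen =
      Q.comp (ht.toOperation Q gen) (fun y => (hs y).toOperation Q gen) := by
  obtain ⟨e, h1, h2⟩ : ∃ e : (t.subst s).Leaves ≃ Σ p : t.Leaves, (s (ht.labelEquiv p)).Leaves,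
      (∀ p, (t.subst s).label p = ⟨t.label (e p).1, (s _).label (e p).2⟩) ∧
      Q.relabel e ((t.subst s).shape Q gen) =
        Q.comp (t.shape Q gen) (fun p => (s (ht.labelEquiv p)).shape Q gen) :=
    shape_subst Q gen s t
  have h3 := Q.comp_relabel_left ht.labelEquiv (t.shape Q gen) (fun y => (s y).shape Q gen)
  simp only [toOperation]
  rw [Q.comp_relabel_right (fun y => (hs y).labelEquiv), h3]
  refine Eq.trans ?_ (congrArg (fun a => Q.relabel (Equiv.sigmaCongrRight fun y =>
    (hs y).labelEquiv) (Q.relabel (Equiv.sigmaCongrLeft ht.labelEquiv) a)) h2)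
  rw [← Q.relabel_trans, ← Q.relabel_trans]
  congr 1
  congr 1
  ext p
  · exact congrArg Sigma.fst (h1 p)
  · exact (Sigma.ext_iff.1 (h1 p)).2

end BinTree

namespace Operad

variable {k : Type u} [Field k] {G : Type}

/-- The linear maps underlying `freeLift`. -/
noncomputable def freeLiftLin (Q : Operad.{u, w} k) (gen : G → Q.obj (Fin 2)) (X : Type)
    [Finite X] : (freePre k G).obj X →ₗ[k] Q.obj X :=
  Finsupp.linearCombination k (fun t : MultilinearTree G X => t.2.toOperation Q gen)

theorem freeLiftLin_freeTree (Q : Operad.{u, w} k) (gen : G → Q.obj (Fin 2)) {X : Type}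
    [Finite X] (t : BinTree G X) (ht : t.IsMultilinear) :
    freeLiftLin Q gen X (freeTree k t ht) = ht.toOperation Q gen :=
  (Finsupp.linearCombination_single k _ _).trans (one_smul _ _)

/-- The morphism from the free operad determined by the images of the generators. -/
noncomputable def freeLift (Q : Operad.{u, w} k) (gen : G → Q.obj (Fin 2)) :
    Hom (freeOperad k G) Q where
  toLin X _ := freeLiftLin Q gen X
  map_relabel {X Y} _ _ e a := by
    have : freeLiftLin Q gen Y ∘ₗ (freePre k G).relabel e =
        Q.relabel e ∘ₗ freeLiftLin Q gen X :=
      LinearMap.ext_on (span_freeTree k X) (by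
        rintro _ ⟨t, ht, rfl⟩
        simp only [LinearMap.comp_apply, freePre_relabel, freeLiftLin_freeTree,
          ht.toOperation_map])
    exact LinearMap.congr_fun this a
  map_one := by
    refine (Finsupp.linearCombination_single k _ _).trans ?_
    rw [one_smul]
    exact (congrArg (fun e => Q.relabel e Q.one) (Equiv.ext fun _ => rfl)).trans
      (Q.relabel_refl Q.one)
  map_comp {Y} _ {X} _ a b := by
    let A : (freePre k G).obj Y →ₗ[k] MultilinearMap k (fun y => (freePre k G).obj (X y))
        (Q.obj (Σ y, X y)) := (freeLiftLin Q gen _).compMultilinearMapₗ k ∘ₗ (freePre k G).comp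
    let B : (freePre k G).obj Y →ₗ[k] MultilinearMap k (fun y => (freePre k G).obj (X y))
        (Q.obj (Σ y, X y)) :=
      MultilinearMap.compLinearMapₗ (fun y => freeLiftLin Q gen (X y)) ∘ₗ Q.comp ∘ₗ
        freeLiftLin Q gen Y
    have : A = B := LinearMap.ext_on (span_freeTree k Y) (by
      rintro _ ⟨t, ht, rfl⟩
      refine multilinear_ext_of_span _ (fun y => span_freeTree k (X y)) fun b hb => ?_
      choose s hs h using hb
      obtain rfl : b = fun y => freeTree k (s y) (hs y) := funext h
      change freeLiftLin Q gen _ ((freePre k G).comp _ _) =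
        Q.comp (freeLiftLin Q gen _ _) (fun y => freeLiftLin Q gen _ _)
      rw [freePre_comp]
      simp only [freeLiftLin_freeTree]
      exact ht.toOperation_subst Q gen hs)
    exact congrArg (fun F => F a b) this

/-- The linear maps underlying a morphism from the free operad. -/
noncomputable def Hom.app {Q : Operad.{u, w} k} (φ : Hom (freeOperad k G) Q) (X : Type)
    [Finite X] : (freePre k G).obj X →ₗ[k] Q.obj X := φ.toLin X

theorem Hom.app_relabel {Q : Operad.{u, w} k} (φ : Hom (freeOperad k G) Q) {X Y : Type}
    [Finite X] [Finite Y] (e : X ≃ Y) (a : (freePre k G).obj X) :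
    φ.app Y ((freePre k G).relabel e a) = Q.relabel e (φ.app X a) := φ.map_relabel e a

theorem freeLift_freeTree (Q : Operad.{u, w} k) (gen : G → Q.obj (Fin 2)) {X : Type} [Finite X]
    (t : BinTree G X) (ht : t.IsMultilinear) :
    (freeLift Q gen).toLin X (freeTree k t ht) = ht.toOperation Q gen :=
  freeLiftLin_freeTree Q gen t ht

/-- The bijections between `Unit` and the members of a pair. -/
def unitEquivPair : ∀ i, Unit ≃ pairType Unit Unit i
  | 0 => Equiv.refl _
  | 1 => Equiv.refl _

theorem freeLift_node (Q : Operad.{u, w} k) (gen : G → Q.obj (Fin 2)) (g : G) :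
    (freeLift Q gen).toLin (Fin 2) (freeTree k _ (BinTree.isMultilinear_node g)) = gen g := by
  rw [freeLift_freeTree]
  refine Eq.trans ?_ (Q.comp_one (gen g))
  have h : Q.pair Q.one Q.one = fun i => Q.relabel (unitEquivPair i) Q.one := by
    funext i
    match i with
    | 0 => exact (Q.relabel_refl _).symm
    | 1 => exact (Q.relabel_refl _).symm
  let E : (Σ i, pairType Unit Unit i) ≃ Fin 2 := (BinTree.isMultilinear_node g).labelEquiv
  change Q.relabel E (Q.comp (gen g) (Q.pair Q.one Q.one)) = _
  rw [h, Q.comp_relabel_right]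
  refine (Q.relabel_trans _ _ _).symm.trans ?_
  refine congrArg (fun e => Q.relabel e (Q.comp (gen g) fun _ => Q.one)) (Equiv.ext ?_)
  rintro ⟨i, p⟩
  match i with
  | 0 => rfl
  | 1 => rfl

end Operad

/-! ### Evaluation of trees in algebras -/

section Eval

variable {k : Type u} [Field k] {G X Y : Type} {A : Type*} [AddCommGroup A] [Module k A]
  {B : Type*} [AddCommGroup B] [Module k B]

namespace BinTree

/-- The value of a tree in an algebra with bilinear operations `op`. -/
def eval (op : G → A →ₗ[k] A →ₗ[k] A) (v : X → A) : BinTree G X → A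
  | leaf x => v x
  | node g l r => op g (l.eval op v) (r.eval op v)

variable (op : G → A →ₗ[k] A →ₗ[k] A)

theorem eval_map (f : X → Y) (v : Y → A) (t : BinTree G X) :
    (t.map f).eval op v = t.eval op (fun x => v (f x)) := by
  induction t with
  | leaf x => rfl
  | node g l r hl hr => simp [map, eval, hl, hr]

theorem eval_subst {X : Y → Type} (s : ∀ y, BinTree G (X y)) (v : (Σ y, X y) → A)
    (t : BinTree G Y) :
    (t.subst s).eval op v = t.eval op (fun y => (s y).eval op (fun x => v ⟨y, x⟩)) := by
  induction t with
  | leaf y => simp [subst, eval, eval_map]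
  | node g l r hl hr => simp [subst, eval, hl, hr]

theorem eval_update_of_occ_eq_zero [DecidableEq X] (v : X → A) (x : X) (a : A)
    (t : BinTree G X) (h : t.occ x = 0) : t.eval op (update v x a) = t.eval op v := by
  induction t with
  | leaf y =>
    have : y ≠ x := fun e => by simp [occ, e] at h
    simp [eval, this]
  | node g l r hl hr =>
    simp only [occ, Nat.add_eq_zero_iff] at h
    simp [eval, hl h.1, hr h.2]

/-- The path from the root to the unique leaf labelled `x` is a composite of one-sided
multiplications. -/
theorem exists_eval_update [DecidableEq X] (v : X → A) (x : X) (t : BinTree G X)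
    (h : t.occ x = 1) : ∃ φ : A →ₗ[k] A, ∀ a, t.eval op (update v x a) = φ a := by
  induction t with
  | leaf y =>
    have : y = x := by by_contra e; simp [occ, e] at h
    subst this
    exact ⟨LinearMap.id, fun a => by simp [eval]⟩
  | node g l r hl hr =>
    simp only [occ] at h
    obtain ⟨h1, h2⟩ | ⟨h1, h2⟩ : (l.occ x = 1 ∧ r.occ x = 0) ∨ (l.occ x = 0 ∧ r.occ x = 1) := by
      omega
    · obtain ⟨φ, hφ⟩ := hl h1
      exact ⟨(op g).flip (r.eval op v) ∘ₗ φ, fun a => by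
        simp [eval, hφ, eval_update_of_occ_eq_zero op v x a r h2]⟩
    · obtain ⟨φ, hφ⟩ := hr h2
      exact ⟨op g (l.eval op v) ∘ₗ φ, fun a => by
        simp [eval, hφ, eval_update_of_occ_eq_zero op v x a l h1]⟩

/-- The multilinear map given by a multilinear tree. -/
def IsMultilinear.evalMultilinear {t : BinTree G X} (ht : t.IsMultilinear) :
    MultilinearMap k (fun _ : X => A) A where
  toFun v := t.eval op v
  map_update_add' v x a b := by
    obtain ⟨φ, hφ⟩ := exists_eval_update op v x t (ht x)
    simp [hφ]
  map_update_smul' v x c a := by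
    obtain ⟨φ, hφ⟩ := exists_eval_update op v x t (ht x)
    simp [hφ]

end BinTree

namespace Operad

variable (op : G → A →ₗ[k] A →ₗ[k] A) (op' : G → B →ₗ[k] B →ₗ[k] B)

/-- The value of an element of the free operad in an algebra. -/
noncomputable def freeEval {X : Type} [Finite X] (v : X → A) : (freePre k G).obj X →ₗ[k] A :=
  Finsupp.linearCombination k (fun t : MultilinearTree G X => t.1.eval op v)

theorem freeEval_freeTree [Finite X] (v : X → A) (t : BinTree G X) (ht : t.IsMultilinear) :
    freeEval op v (freeTree k t ht) = t.eval op v :=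
  (Finsupp.linearCombination_single k _ _).trans (one_smul _ _)

theorem freeEval_relabel [Finite X] [Finite Y] (e : X ≃ Y) (v : Y → A)
    (a : (freePre k G).obj X) :
    freeEval op v ((freePre k G).relabel e a) = freeEval op (fun x => v (e x)) a := by
  have : freeEval op v ∘ₗ (freePre k G).relabel e = freeEval op (fun x => v (e x)) :=
    LinearMap.ext_on (span_freeTree k X) (by
      rintro _ ⟨t, ht, rfl⟩
      rw [LinearMap.comp_apply, freePre_relabel, freeEval_freeTree, freeEval_freeTree,
        BinTree.eval_map])
  exact LinearMap.congr_fun this a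

theorem freeEval_comp [Finite Y] {X : Y → Type} [∀ y, Finite (X y)] (v : (Σ y, X y) → A)
    (a : (freePre k G).obj Y) (b : ∀ y, (freePre k G).obj (X y)) :
    freeEval op v ((freePre k G).comp a b) =
      freeEval op (fun y => freeEval op (fun x => v ⟨y, x⟩) (b y)) a := by
  have : freeEval op v ∘ₗ (freePre k G).compEval b =
      freeEval op (fun y => freeEval op (fun x => v ⟨y, x⟩) (b y)) :=
    LinearMap.ext_on (span_freeTree k Y) (by
      rintro _ ⟨t, ht, rfl⟩
      rw [freeEval_freeTree]
      let C : MultilinearMap k (fun y => (freePre k G).obj (X y)) A :=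
        (freeEval op v).compMultilinearMap ((freePre k G).comp (freeTree k t ht))
      let D : MultilinearMap k (fun y => (freePre k G).obj (X y)) A :=
        (ht.evalMultilinear op).compLinearMap (fun y => freeEval op (fun x => v ⟨y, x⟩))
      have : C = D := multilinear_ext_of_span _ (fun y => span_freeTree k (X y)) fun b hb => by
        choose s hs h using hb
        obtain rfl : b = fun y => freeTree k (s y) (hs y) := funext h
        change freeEval op v ((freePre k G).comp _ _) =
          t.eval op fun y => freeEval op (fun x => v ⟨y, x⟩) (freeTree k (s y) (hs y))
        rw [freePre_comp, freeEval_freeTree, BinTree.eval_subst]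
        simp only [freeEval_freeTree]
      exact congrArg (fun F => F b) this)
  exact LinearMap.congr_fun this a

/-- The multilinear map given by an element of the free operad. -/
noncomputable def freeEvalMultilinear [Finite X] (a : (freePre k G).obj X) :
    MultilinearMap k (fun _ : X => A) A where
  toFun v := freeEval op v a
  map_update_add' v x p q := by
    have : freeEval op (update v x (p + q)) =
        freeEval op (update v x p) + freeEval op (update v x q) :=
      LinearMap.ext_on (span_freeTree k X) (by
        rintro _ ⟨t, ht, rfl⟩
        simp only [LinearMap.add_apply, freeEval_freeTree]
        exact (ht.evalMultilinear op).map_update_add v x p q)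
    exact LinearMap.congr_fun this a
  map_update_smul' v x c p := by
    have : freeEval op (update v x (c • p)) = c • freeEval op (update v x p) :=
      LinearMap.ext_on (span_freeTree k X) (by
        rintro _ ⟨t, ht, rfl⟩
        simp only [LinearMap.smul_apply, freeEval_freeTree]
        exact (ht.evalMultilinear op).map_update_smul v x c p)
    exact LinearMap.congr_fun this a

theorem freeEval_map [Finite X] (φ : A →ₗ[k] B)
    (hφ : ∀ g a b, φ (op g a b) = op' g (φ a) (φ b)) (v : X → A) (a : (freePre k G).obj X) :
    freeEval op' (fun x => φ (v x)) a = φ (freeEval op v a) := by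
  have key : ∀ t : BinTree G X, t.eval op' (fun x => φ (v x)) = φ (t.eval op v) := by
    intro t
    induction t with
    | leaf x => rfl
    | node g l r hl hr => simp [BinTree.eval, hl, hr, hφ]
  have : freeEval op' (fun x => φ (v x)) = φ ∘ₗ freeEval op v :=
    LinearMap.ext_on (span_freeTree k X) (by
      rintro _ ⟨t, ht, rfl⟩
      rw [LinearMap.comp_apply, freeEval_freeTree, freeEval_freeTree, key])
  exact LinearMap.congr_fun this a

/-- The ideal of identities of an algebra. -/
noncomputable def identities : (freeOperad k G).OperadIdeal where
  carrier X _ := ⨅ v : X → A, LinearMap.ker (freeEval op v)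
  relabel_mem e a ha := (Submodule.mem_iInf _).2 fun v =>
    (freeEval_relabel op e v a).trans ((Submodule.mem_iInf _).1 ha _)
  comp_mem_left {_ _ _ _ a} b ha := (Submodule.mem_iInf _).2 fun v =>
    (freeEval_comp op v a b).trans ((Submodule.mem_iInf _).1 ha _)
  comp_mem_right a b y hb := (Submodule.mem_iInf _).2 fun v =>
    (freeEval_comp op v a b).trans
      ((freeEvalMultilinear op a).map_coord_zero y ((Submodule.mem_iInf _).1 hb _))

theorem mem_identities [Finite X] {a : (freePre k G).obj X} :
    a ∈ (identities op).carrier X ↔ ∀ v : X → A, freeEval op v a = 0 :=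
  (Submodule.mem_iInf (M := (freePre k G).obj X) _).trans Iff.rfl

end Operad

end Eval

/-! ### The relatively free algebra of an ideal of the free operad -/

namespace BinTree

variable {G X Y : Type}

/-- Substitution of trees with a common set of labels. -/
def bind (s : Y → BinTree G X) : BinTree G Y → BinTree G X
  | leaf y => s y
  | node g l r => node g (l.bind s) (r.bind s)

theorem occ_bind [Fintype Y] (s : Y → BinTree G X) (t : BinTree G Y) (x : X) :
    (t.bind s).occ x = ∑ y, t.occ y * (s y).occ x := by
  classical
  induction t with
  | leaf y => simp [bind, occ]
  | node g l r hl hr => simp [bind, occ, hl, hr, add_mul, Finset.sum_add_distrib]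

theorem map_subst_eq_bind {Z : Y → Type} (s : ∀ y, BinTree G (Z y)) (e : (Σ y, Z y) → X)
    (t : BinTree G Y) :
    (t.subst s).map e = t.bind (fun y => (s y).map (fun z => e ⟨y, z⟩)) := by
  induction t with
  | leaf y => simp [subst, bind, map_map]
  | node g l r hl hr => simp [subst, bind, map, hl, hr]

end BinTree

namespace Operad

variable {k : Type u} [Field k] {G X Y : Type}

variable (k G X) in
/-- The free algebra with a set `G` of bilinear operations and variables in `X`. -/
abbrev TreeAlgebra : Type u := BinTree G X →₀ k

/-- The operations of the free algebra. -/
noncomputable def treeOp (g : G) : TreeAlgebra k G X →ₗ[k] TreeAlgebra k G X →ₗ[k]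
    TreeAlgebra k G X :=
  Finsupp.linearCombination k (fun s => Finsupp.lmapDomain k k (fun t => BinTree.node g s t))

theorem treeOp_single (g : G) (s t : BinTree G X) :
    treeOp g (Finsupp.single s (1 : k)) (Finsupp.single t 1) =
      Finsupp.single (BinTree.node g s t) 1 := by
  simp [treeOp]

theorem eval_treeOp_single (s : Y → BinTree G X) (t : BinTree G Y) :
    t.eval (treeOp (k := k)) (fun y => Finsupp.single (s y) 1) = Finsupp.single (t.bind s) 1 := by
  induction t with
  | leaf y => rfl
  | node g l r hl hr => simp [BinTree.eval, BinTree.bind, hl, hr, treeOp_single]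

/-- The projection of the free algebra to its multilinear part. -/
noncomputable def multilinearPart (X : Type) [Finite X] :
    TreeAlgebra k G X →ₗ[k] (freePre k G).obj X :=
  Finsupp.lsubtypeDomain {t : BinTree G X | t.IsMultilinear}

theorem multilinearPart_single [Finite X] (t : BinTree G X) (ht : t.IsMultilinear) :
    multilinearPart X (Finsupp.single t (1 : k)) = freeTree k t ht := by
  classical
  refine Finsupp.ext fun s => ?_
  change Finsupp.single t (1 : k) s.1 = Finsupp.single (⟨t, ht⟩ : MultilinearTree G X) 1 s
  rw [Finsupp.single_apply, Finsupp.single_apply]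
  exact if_congr (Subtype.ext_iff (a1 := ⟨t, ht⟩) (a2 := s)).symm rfl rfl

theorem multilinearPart_single_eq_zero [Finite X] (t : BinTree G X) (ht : ¬ t.IsMultilinear) :
    multilinearPart X (Finsupp.single t (1 : k)) = 0 := by
  refine Finsupp.ext fun s => ?_
  change Finsupp.single t (1 : k) s.1 = 0
  exact Finsupp.single_eq_of_ne fun h => ht (h ▸ s.2)

/-- When every variable occurs exactly once in the whole family, the sets of labels of the members
partition `X`. -/
theorem exists_sigma_equiv [Finite X] [Fintype Y] (s : Y → BinTree G X)
    (h : ∀ x, ∑ y, (s y).occ x = 1) :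
    ∃ e : (Σ y, {x // (s y).occ x = 1}) ≃ X, ∀ p, e p = p.2.1 := by
  classical
  refine ⟨Equiv.ofBijective (fun p => p.2.1) ⟨?_, fun x => ?_⟩, fun _ => rfl⟩
  · rintro ⟨y, x, hx⟩ ⟨z, x', hx'⟩ (rfl : x = x')
    obtain rfl : y = z := by
      by_contra hyz
      have h1 := Finset.sum_le_univ_sum_of_nonneg (s := {y, z})
        (f := fun y => (s y).occ x) (fun _ => Nat.zero_le _)
      rw [Finset.sum_pair hyz, h x] at h1
      omega
    rfl
  · by_contra hx
    push Not at hx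
    have : ∀ y, (s y).occ x = 0 := fun y => by
      have h1 := Finset.single_le_sum (f := fun y => (s y).occ x) (fun _ _ => Nat.zero_le _)
        (Finset.mem_univ y)
      rw [h x] at h1
      have h2 : (s y).occ x ≠ 1 := fun h2 => hx ⟨y, x, h2⟩ rfl
      omega
    have h1 := h x
    simp [this] at h1

/-- If the trees `s y` together use every variable exactly once, the value of `a` at them is, up to
relabelling, an operadic composite of `a`, so it stays in the ideal. Otherwise every monomial of the
value repeats or omits a variable, and its multilinear part is zero. -/
theorem multilinearPart_freeEval_mem (K : (freeOperad k G).OperadIdeal) [Finite X] [Finite Y]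
    (s : Y → BinTree G X) (a : (freePre k G).obj Y) (ha : a ∈ K.carrier Y) :
    multilinearPart X (freeEval treeOp (fun y => Finsupp.single (s y) (1 : k)) a) ∈
      K.carrier X := by
  cases nonempty_fintype Y
  by_cases h : ∀ x, ∑ y, (s y).occ x = 1
  · have hle : ∀ y x, (s y).occ x ≤ 1 := fun y x =>
      (Finset.single_le_sum (f := fun y => (s y).occ x) (fun _ _ => Nat.zero_le _)
        (Finset.mem_univ y)).trans (h x).le
    choose r hr hr' using fun y => BinTree.exists_multilinear_restrict (s y) (hle y)
    obtain ⟨e, he⟩ := exists_sigma_equiv s h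
    have key : multilinearPart X ∘ₗ freeEval treeOp (fun y => Finsupp.single (s y) (1 : k)) =
        (freePre k G).relabel e ∘ₗ (freePre k G).compEval (fun y => freeTree k (r y) (hr y)) :=
      LinearMap.ext_on (span_freeTree k Y) (by
        rintro _ ⟨t, ht, rfl⟩
        change multilinearPart X (freeEval treeOp _ (freeTree k t ht)) =
          (freePre k G).relabel e ((freePre k G).comp (freeTree k t ht) _)
        rw [freeEval_freeTree, eval_treeOp_single, freePre_comp, freePre_relabel]
        have e1 : (t.subst r).map e = t.bind s := by
          rw [BinTree.map_subst_eq_bind]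
          congr 1
          funext y
          exact (BinTree.map_congr (fun z => he ⟨y, z⟩) _).trans (hr' y)
        rw [multilinearPart_single _ (e1 ▸ (ht.subst hr).map e)]
        exact freeTree_congr k _ _ e1.symm)
    have := K.relabel_mem e (K.comp_mem_left (fun y => freeTree k (r y) (hr y)) ha)
    exact (LinearMap.congr_fun key a).symm ▸ this
  · have key : multilinearPart X ∘ₗ freeEval treeOp (fun y => Finsupp.single (s y) (1 : k)) = 0 :=
      LinearMap.ext_on (span_freeTree k Y) (by
        rintro _ ⟨t, ht, rfl⟩
        rw [LinearMap.comp_apply, freeEval_freeTree, eval_treeOp_single]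
        refine multilinearPart_single_eq_zero _ fun hm => h fun x => ?_
        have := hm x
        rw [BinTree.occ_bind] at this
        simpa [ht _] using this)
    have h0 := LinearMap.congr_fun key a
    exact h0.symm ▸ (K.carrier X).zero_mem

variable (K : (freeOperad k G).OperadIdeal)

variable (X) in
/-- The consequences, in the free algebra, of the identities in `K`. -/
noncomputable def consequences : Submodule k (TreeAlgebra k G X) :=
  Submodule.span k {p | ∃ (Y : Type) (_ : Finite Y) (a : (freePre k G).obj Y)
    (v : Y → TreeAlgebra k G X), a ∈ K.carrier Y ∧ p = freeEval treeOp v a}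

theorem mem_span_range_single (p : TreeAlgebra k G X) :
    p ∈ Submodule.span k (Set.range fun t : BinTree G X => (Finsupp.single t 1 : _ →₀ k)) := by
  rw [Finsupp.mem_span_range_iff_exists_finsupp]
  exact ⟨p, by simp⟩

/-- The consequences of `K` in the free algebra contain no multilinear identities beyond `K` itself.
By multilinearity of the value in `v`, only substitutions of monomials have to be examined. -/
theorem multilinearPart_mem [Finite X] {p : TreeAlgebra k G X} (hp : p ∈ consequences X K) :
    multilinearPart X p ∈ K.carrier X := by
  have : consequences X K ≤ (K.carrier X).comap (multilinearPart X) := by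
    rw [consequences, Submodule.span_le]
    rintro _ ⟨Y, _, a, v, ha, rfl⟩
    let f : MultilinearMap k (fun _ : Y => TreeAlgebra k G X) ((freeOperad k G).obj X) :=
      (multilinearPart (k := k) (G := G) X).compMultilinearMap (freeEvalMultilinear treeOp a)
    exact multilinear_mem_of_span f (fun _ => Set.range fun t => Finsupp.single t 1) (K.carrier X)
      (fun b hb => by
        choose s hs using hb
        obtain rfl : (fun y => Finsupp.single (s y) 1) = b := funext hs
        exact multilinearPart_freeEval_mem K s a ha) v (fun y => mem_span_range_single (v y))
  exact this hp

theorem node_mem {A B : Type} [Finite A] [Finite B] (g : G) (a : (freePre k G).obj A)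
    (b : (freePre k G).obj B) (h : a ∈ K.carrier A ∨ b ∈ K.carrier B) :
    (freePre k G).comp (freeTree k _ (BinTree.isMultilinear_node g))
      ((freePre k G).pair a b) ∈ K.carrier (Σ i, pairType A B i) :=
  h.elim (fun h => K.comp_mem_right _ 0 h) (fun h => K.comp_mem_right _ 1 h)

/-- The consequences form a two-sided ideal: the product of a value of `a` and a value of `b` is a
value of the composite of `g` with `a` and `b`, which lies in `K` as soon as `a` or `b` does. -/
theorem treeOp_mem (g : G) (p q : TreeAlgebra k G X)
    (h : p ∈ consequences X K ∨ q ∈ consequences X K) :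
    treeOp g p q ∈ consequences X K := by
  let pairVal {A B : Type} (v : A → TreeAlgebra k G X) (w : B → TreeAlgebra k G X) :
      (Σ i, pairType A B i) → TreeAlgebra k G X := fun p => match p with
    | ⟨0, x⟩ => v x
    | ⟨1, x⟩ => w x
  have key : ∀ {A B : Type} [Finite A] [Finite B] (a : (freePre k G).obj A)
      (b : (freePre k G).obj B) (v : A → TreeAlgebra k G X) (w : B → TreeAlgebra k G X),
      a ∈ K.carrier A ∨ b ∈ K.carrier B →
      treeOp g (freeEval treeOp v a) (freeEval treeOp w b) ∈ consequences X K := by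
    intro A B _ _ a b v w h
    refine Submodule.subset_span ⟨_, inferInstance, _, pairVal v w, node_mem K g a b h, ?_⟩
    rw [freeEval_comp, freeEval_freeTree]
    rfl
  -- An arbitrary factor is a value of the unit operation, so the statement for two values covers
  -- it.
  have one : ∀ q : TreeAlgebra k G X, q = freeEval treeOp (fun _ : Unit => q)
      (freeTree k (BinTree.leaf ()) BinTree.isMultilinear_unit) := fun q => by
    rw [freeEval_freeTree]; rfl
  rcases h with h | h
  · have : consequences X K ≤ (consequences X K).comap ((treeOp g).flip q) := by
      conv_lhs => rw [consequences]
      rw [Submodule.span_le]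
      rintro _ ⟨Y, _, a, v, ha, rfl⟩
      have := key a (freeTree k (BinTree.leaf ())
        BinTree.isMultilinear_unit) v (fun _ => q) (Or.inl ha)
      rw [← one] at this
      exact this
    exact this h
  · have : consequences X K ≤ (consequences X K).comap (treeOp g p) := by
      conv_lhs => rw [consequences]
      rw [Submodule.span_le]
      rintro _ ⟨Y, _, b, w, hb, rfl⟩
      have := key (freeTree k (BinTree.leaf ())
        BinTree.isMultilinear_unit) b (fun _ => p) w (Or.inr hb)
      rw [← one] at this
      exact this
    exact this h

variable (X) in
/-- The relatively free algebra with variables in `X` defined by the identities in `K`. -/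
abbrev RelFree : Type u := TreeAlgebra k G X ⧸ consequences X K

/-- The operations of the relatively free algebra. -/
noncomputable def relOp (g : G) : RelFree X K →ₗ[k] RelFree X K →ₗ[k] RelFree X K :=
  (consequences X K).liftQ
    { toFun := fun p => (consequences X K).mapQ (consequences X K) (treeOp g p)
        (fun _ hq => treeOp_mem K g _ _ (Or.inr hq))
      map_add' := fun p p' => Submodule.linearMap_qext _ (LinearMap.ext fun q => by simp)
      map_smul' := fun c p => Submodule.linearMap_qext _ (LinearMap.ext fun q => by simp) }
    (fun p hp => LinearMap.mem_ker.2 <| Submodule.linearMap_qext _ <| LinearMap.ext fun q => by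
      simpa using treeOp_mem K g _ _ (Or.inl hp))

theorem freeEval_relOp_eq_zero [Finite Y] {a : (freePre k G).obj Y} (ha : a ∈ K.carrier Y)
    (v : Y → RelFree X K) : freeEval (relOp K) v a = 0 := by
  choose w hw using fun y => (consequences X K).mkQ_surjective (v y)
  obtain rfl : (fun y => (consequences X K).mkQ (w y)) = v := funext hw
  rw [freeEval_map treeOp (relOp K) (consequences X K).mkQ (fun _ _ _ => rfl),
    Submodule.mkQ_apply, Submodule.Quotient.mk_eq_zero]
  exact Submodule.subset_span ⟨Y, inferInstance, a, w, ha, rfl⟩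

/-- The variables of the relatively free algebra. -/
noncomputable def relVar (x : X) : RelFree X K :=
  (consequences X K).mkQ (Finsupp.single (BinTree.leaf x) 1)

/-- The converse of `freeEval_relOp_eq_zero`, at generic arguments. Vanishing means that the
multilinear polynomial `a` is a consequence of `K`, and it is its own multilinear part. Membership
in an operadic ideal thereby becomes an equation between elements of an algebra. -/
theorem mem_of_freeEval_relVar_eq_zero [Finite X] {a : (freePre k G).obj X}
    (ha : freeEval (relOp K) (relVar K) a = 0) : a ∈ K.carrier X := by
  have h := freeEval_map treeOp (relOp K) (consequences X K).mkQ (fun _ _ _ => rfl)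
    (fun x : X => Finsupp.single (BinTree.leaf x) 1) a
  have h' := h.symm.trans ha
  rw [Submodule.mkQ_apply, Submodule.Quotient.mk_eq_zero] at h'
  have h2 := multilinearPart_mem K h'
  have h3 : multilinearPart X ∘ₗ freeEval treeOp
      (fun x : X => (Finsupp.single (BinTree.leaf x) 1 : TreeAlgebra k G X)) = LinearMap.id :=
    LinearMap.ext_on (span_freeTree k X) (by
      rintro _ ⟨t, ht, rfl⟩
      have e : t.bind BinTree.leaf = t := by
        clear ht
        induction t with
        | leaf x => rfl
        | node g l r hl hr => simp [BinTree.bind, hl, hr]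
      rw [LinearMap.comp_apply, freeEval_freeTree, eval_treeOp_single, e,
        multilinearPart_single _ ht, LinearMap.id_apply])
  have h4 := LinearMap.congr_fun h3 a
  rw [LinearMap.comp_apply] at h4
  rw [h4] at h2
  exact h2

end Operad

/-! ### Trees in operads -/

namespace BinTree

variable {G X Y : Type}

theorem exists_eq_leaf {t : BinTree G X} (h : t.weight (fun _ => 1) = 0) : ∃ x, t = leaf x := by
  cases t with
  | leaf x => exact ⟨x, rfl⟩
  | node g l r => simp [weight] at h

theorem exists_eq_node {t : BinTree G X} (h : t.weight (fun _ => 1) = 1) :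
    ∃ g x y, t = node g (leaf x) (leaf y) := by
  cases t with
  | leaf x => simp [weight] at h
  | node g l r =>
    simp only [weight] at h
    obtain ⟨x, rfl⟩ := exists_eq_leaf (t := l) (by omega)
    obtain ⟨y, rfl⟩ := exists_eq_leaf (t := r) (by omega)
    exact ⟨g, x, y, rfl⟩

theorem exists_eq_node_node {t : BinTree G X} (h : t.weight (fun _ => 1) = 2) :
    ∃ g g' x y z, t = node g (leaf x) (node g' (leaf y) (leaf z)) ∨
      t = node g (node g' (leaf x) (leaf y)) (leaf z) := by
  cases t with
  | leaf x => simp [weight] at h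
  | node g l r =>
    simp only [weight] at h
    obtain hl | hl : l.weight (fun _ => 1) = 0 ∨ l.weight (fun _ => 1) = 1 := by omega
    · obtain ⟨x, rfl⟩ := exists_eq_leaf hl
      obtain ⟨g', y, z, rfl⟩ := exists_eq_node (t := r) (by omega)
      exact ⟨g, g', x, y, z, Or.inl rfl⟩
    · obtain ⟨g', x, y, rfl⟩ := exists_eq_node hl
      obtain ⟨z, rfl⟩ := exists_eq_leaf (t := r) (by omega)
      exact ⟨g, g', x, y, z, Or.inr rfl⟩

/-- The product of the scalars attached to the vertices of a tree. -/
def scalar {k : Type u} [Field k] (c : G → k) : BinTree G X → k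
  | leaf _ => 1
  | node g l r => c g * (l.scalar c * r.scalar c)

theorem scalar_map {k : Type u} [Field k] (c : G → k) (f : X → Y) (t : BinTree G X) :
    (t.map f).scalar c = t.scalar c := by
  induction t with
  | leaf x => rfl
  | node g l r hl hr => simp [map, scalar, hl, hr]

section

variable {k : Type u} [Field k] (Q : Operad.{u, w} k) (gen : G → Q.obj (Fin 2))

theorem toOperation_unit : isMultilinear_unit.toOperation Q gen = Q.one := by
  rw [← freeLift_freeTree]
  exact (freeLift Q gen).map_one

theorem toOperation_generator (g : G) : (isMultilinear_node g).toOperation Q gen = gen g := by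
  rw [← freeLift_freeTree]
  exact freeLift_node Q gen g

theorem IsMultilinear.toOperation_node {A B : Type} [Finite A] [Finite B] (g : G)
    {s : BinTree G A} {t : BinTree G B} (hs : s.IsMultilinear) (ht : t.IsMultilinear) :
    ((isMultilinear_node g).subst (hs.pair ht)).toOperation Q gen =
      Q.comp (gen g) (fun i => (hs.pair ht i).toOperation Q gen) := by
  rw [(isMultilinear_node g).toOperation_subst Q gen (hs.pair ht), toOperation_generator]

end

end BinTree

/-! ### Spans of trees by weight, and classes of trees in the associated graded operad -/

namespace Operad

variable {k : Type u} [Field k] {G : Type}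

/-- If two morphisms from the free operad agree on the generators up to scalars, then they agree
on trees up to scalars. -/
theorem Hom.freeTree_eq_smul {Q : Operad.{u, w} k} (φ ρ : Hom (freeOperad k G) Q) (c : G → k)
    (h : ∀ g, ρ.toLin (Fin 2) (freeTree k _ (BinTree.isMultilinear_node g)) =
      c g • φ.toLin (Fin 2) (freeTree k _ (BinTree.isMultilinear_node g)))
    {X : Type} [Finite X] (t : BinTree G X) (ht : t.IsMultilinear) :
    ρ.toLin X (freeTree k t ht) = t.scalar c • φ.toLin X (freeTree k t ht) := by
  refine ht.induction (motive := fun X _ t => ∀ ht : t.IsMultilinear,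
    ρ.toLin X (freeTree k t ht) = t.scalar c • φ.toLin X (freeTree k t ht)) ?_ ?_ ?_ ht
  · intro ht
    rw [BinTree.scalar, one_smul]
    exact ρ.map_one.trans φ.map_one.symm
  · intro X Y _ _ e t ht ih _
    have h1 := ρ.map_relabel e (freeTree k t ht)
    have h2 := φ.map_relabel e (freeTree k t ht)
    rw [ih ht, map_smul, ← h2] at h1
    rw [BinTree.scalar_map, ← freePre_relabel]
    exact h1
  · intro A B _ _ g s t hs ht ihs iht _
    rw [← freePre_comp k _ (BinTree.isMultilinear_node g) _ (hs.pair ht)]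
    have h1 := ρ.map_comp (freeTree k _ (BinTree.isMultilinear_node g))
      (fun i => freeTree k _ (hs.pair ht i))
    have h2 := φ.map_comp (freeTree k _ (BinTree.isMultilinear_node g))
      (fun i => freeTree k _ (hs.pair ht i))
    have h3 : (fun i => ρ.toLin _ (freeTree k _ (hs.pair ht i))) = fun i =>
        (BinTree.pair s t i).scalar c • φ.toLin _ (freeTree k _ (hs.pair ht i)) := by
      funext i
      match i with
      | 0 => exact ihs hs
      | 1 => exact iht ht
    rw [h3, h, map_smul, smul_apply, MultilinearMap.map_smul_univ, ← h2,
      smul_smul] at h1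
    refine h1.trans (congrArg (· • _) ?_)
    rw [Fin.prod_univ_two]
    exact congrArg (c g * ·) (congrArg₂ (· * ·) (BinTree.scalar_map c _ s).symm
      (BinTree.scalar_map c _ t).symm)

/-- The span of the operations given by the trees of weight at least `n`. -/
def treeSpan (Q : Operad.{u, w} k) (gen : G → Q.obj (Fin 2)) (c : G → ℕ) (n : ℕ) (X : Type)
    [Finite X] : Submodule k (Q.obj X) :=
  Submodule.span k {a | ∃ (t : BinTree G X) (ht : t.IsMultilinear), n ≤ t.weight c ∧
    a = ht.toOperation Q gen}

section TreeSpan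

variable (Q : Operad.{u, w} k) (gen : G → Q.obj (Fin 2)) (c : G → ℕ)

theorem treeSpan_relabel {n : ℕ} {X Y : Type} [Finite X] [Finite Y] (e : X ≃ Y) {a : Q.obj X}
    (ha : a ∈ treeSpan Q gen c n X) : Q.relabel e a ∈ treeSpan Q gen c n Y := by
  have : treeSpan Q gen c n X ≤ (treeSpan Q gen c n Y).comap (Q.relabel e) := by
    rw [treeSpan, Submodule.span_le]
    rintro _ ⟨t, ht, hn, rfl⟩
    refine Submodule.subset_span ⟨_, ht.map e, ?_, (ht.toOperation_map Q gen e).symm⟩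
    rwa [BinTree.weight_map]
  exact this ha

theorem treeSpan_comp {n : ℕ} {Y : Type} [Finite Y] {X : Y → Type} [∀ y, Finite (X y)]
    {m : Y → ℕ} {a : Q.obj Y} {b : ∀ y, Q.obj (X y)} (ha : a ∈ treeSpan Q gen c n Y)
    (hb : ∀ y, b y ∈ treeSpan Q gen c (m y) (X y)) :
    Q.comp a b ∈ treeSpan Q gen c (n + ∑ᶠ y, m y) (Σ y, X y) := by
  refine multilinear_mem_of_span (Q.comp a) _ _ ?_ b hb
  intro b hb
  choose s hs hm hb using hb
  obtain rfl : b = fun y => (hs y).toOperation Q gen := funext hb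
  have : treeSpan Q gen c n Y ≤ (treeSpan Q gen c (n + ∑ᶠ y, m y) (Σ y, X y)).comap
      (Q.compEval fun y => (hs y).toOperation Q gen) := by
    conv_lhs => rw [treeSpan]
    rw [Submodule.span_le]
    rintro _ ⟨t, ht, hn, rfl⟩
    refine Submodule.subset_span ⟨_, ht.subst hs, ?_, (ht.toOperation_subst Q gen hs).symm⟩
    rw [ht.weight_subst]
    cases nonempty_fintype Y
    simp only [finsum_eq_sum_of_fintype]
    exact Nat.add_le_add hn (Finset.sum_le_sum fun y _ => hm y)
  exact this ha

theorem treeSpan_mono {n m : ℕ} (h : n ≤ m) (X : Type) [Finite X] :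
    treeSpan Q gen c m X ≤ treeSpan Q gen c n X :=
  Submodule.span_mono fun _ ⟨t, ht, hn, e⟩ => ⟨t, ht, h.trans hn, e⟩

theorem one_mem_treeSpan : Q.one ∈ treeSpan Q gen c 0 Unit :=
  Submodule.subset_span ⟨_, BinTree.isMultilinear_unit, Nat.zero_le _,
    (BinTree.toOperation_unit Q gen).symm⟩

theorem generator_mem_treeSpan (g : G) : gen g ∈ treeSpan Q gen c (c g) (Fin 2) :=
  Submodule.subset_span ⟨_, BinTree.isMultilinear_node g, by simp [BinTree.weight],
    (BinTree.toOperation_generator Q gen g).symm⟩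

/-- The suboperad spanned by the operations given by trees. -/
def treeSuboperad : Q.Suboperad where
  carrier X _ := treeSpan Q gen c 0 X
  relabel_mem e _ ha := treeSpan_relabel Q gen c e ha
  one_mem := one_mem_treeSpan Q gen c
  comp_mem ha hb := treeSpan_mono Q gen c (Nat.zero_le _) _ (treeSpan_comp Q gen c ha hb)

/-- The ideal spanned by the operations given by trees of positive weight, in an operad spanned by
the operations given by trees. -/
def treeIdeal (h : ∀ (X : Type) [Finite X], treeSpan Q gen c 0 X = ⊤) : Q.OperadIdeal where
  carrier X _ := treeSpan Q gen c 1 X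
  relabel_mem e _ ha := treeSpan_relabel Q gen c e ha
  comp_mem_left {Y _ X _ a} b ha := by
    have := treeSpan_comp Q gen c (m := fun _ => 0) (b := b) ha
      (fun y => by rw [h]; trivial)
    simpa using this
  comp_mem_right {Y _ X _} a b y hb := by
    classical
    have := treeSpan_comp Q gen c (n := 0) (m := fun z => if z = y then 1 else 0) (a := a) (b := b)
      (by rw [h]; trivial) (fun z => by
        by_cases hz : z = y
        · subst hz; simpa using hb
        · rw [if_neg hz, h]; trivial)
    cases nonempty_fintype Y
    simpa [finsum_eq_sum_of_fintype] using this

/-- Weights add under composition, so each vertex taken from `I` contributes at least one to the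
weight. -/
theorem treeComp_mem_treeSpan {I : Q.OperadIdeal}
    (h : ∀ (X : Type) [Finite X], treeSpan Q gen c 0 X = ⊤)
    (hI : ∀ (X : Type) [Finite X], I.carrier X ≤ treeSpan Q gen c 1 X) {n : ℕ} {X : Type}
    [Finite X] {a : Q.obj X} (ha : Q.TreeComp I n X a) : a ∈ treeSpan Q gen c n X := by
  induction ha with
  | trivial => exact one_mem_treeSpan Q gen c
  | node m a b hb ih =>
    have := treeSpan_comp Q gen c (n := 0) (a := a) (by rw [h]; trivial) ih
    rwa [zero_add] at this
  | nodeIdeal m a ha b hb ih => exact treeSpan_comp Q gen c (hI _ ha) ih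
  | relabel e a ha ih => exact treeSpan_relabel Q gen c e ih

end TreeSpan

theorem mem_idealFiltration_one {P : Operad.{u, v} k} (I : P.OperadIdeal) {X : Type} [Finite X]
    {a : P.obj X} (ha : a ∈ I.carrier X) : a ∈ (idealFiltration I).F 1 X := by
  refine Submodule.subset_span ⟨1, le_rfl, ?_⟩
  exact ((TreeComp.nodeIdeal (I := I) (fun _ => 0) a ha _ (fun _ => TreeComp.trivial)).relabel
    (Equiv.sigmaPUnit X)).congr (by simp) (P.comp_one a)

namespace Filtration

variable {P : Operad.{u, v} k} (F : P.Filtration) (gen : G → P.obj (Fin 2)) (c : G → ℕ)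
  (hgen : ∀ g, gen g ∈ F.F (c g) (Fin 2))

theorem toOperation_mem (hgen : ∀ g, gen g ∈ F.F (c g) (Fin 2)) {X : Type} [Finite X]
    {t : BinTree G X} (ht : t.IsMultilinear) :
    ht.toOperation P gen ∈ F.F (t.weight c) X := by
  refine ht.induction (motive := fun X _ t => ∀ ht : t.IsMultilinear,
    ht.toOperation P gen ∈ F.F (t.weight c) X) ?_ ?_ ?_ ht
  · intro _
    rw [BinTree.weight, F.F_zero]; trivial
  · intro X Y _ _ e t ht ih _
    rw [ht.toOperation_map, BinTree.weight_map]
    exact F.relabel_mem e (ih ht)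
  · intro A B _ _ g s t hs ht ihs iht _
    rw [hs.toOperation_node P gen g ht, (BinTree.isMultilinear_node g).weight_subst]
    refine F.comp_mem ?_ fun i => ?_
    · simpa [BinTree.weight] using hgen g
    · match i with
      | 0 => exact ihs hs
      | 1 => exact iht ht

/-- The classes of generators in the associated graded operad. -/
noncomputable def symbolGen (g : G) : F.gr.obj (Fin 2) := F.symbol (c g) (gen g) (hgen g)

/-- Composition in the associated graded operad is composition of representatives, so the class of a
tree, in the degree given by its weight, is the same tree in the classes of the generators. -/
theorem toOperation_symbolGen {X : Type} [Finite X] {t : BinTree G X} (ht : t.IsMultilinear) :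
    ht.toOperation F.gr (F.symbolGen gen c hgen) =
      F.symbol (t.weight c) (ht.toOperation P gen) (F.toOperation_mem gen c hgen ht) := by
  refine ht.induction (motive := fun X _ t => ∀ ht : t.IsMultilinear,
    ht.toOperation F.gr (F.symbolGen gen c hgen) =
      F.symbol (t.weight c) (ht.toOperation P gen) (F.toOperation_mem gen c hgen ht)) ?_ ?_ ?_ ht
  · intro _
    rw [BinTree.toOperation_unit]
    exact F.grPre_one.trans (F.symbol_congr _ _ rfl (BinTree.toOperation_unit P gen).symm)
  · intro X Y _ _ e t ht ih _
    rw [ht.toOperation_map, ih ht]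
    exact (F.grPre_relabel_symbol e _ _ _).trans
      (F.symbol_congr _ _ (BinTree.weight_map _ _ _).symm (ht.toOperation_map P gen e).symm)
  · intro A B _ _ g s t hs ht ihs iht _
    rw [hs.toOperation_node _ _ g ht]
    have h : (fun i => (hs.pair ht i).toOperation F.gr (F.symbolGen gen c hgen)) = fun i =>
        F.symbol _ ((hs.pair ht i).toOperation P gen)
          (F.toOperation_mem gen c hgen (hs.pair ht i)) := by
      funext i
      match i with
      | 0 => exact ihs hs
      | 1 => exact iht ht
    rw [h]
    refine (F.grPre_comp_symbol _ _ _ (hgen g) _ _).trans (F.symbol_congr _ _ ?_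
      (hs.toOperation_node P gen g ht).symm)
    rw [(BinTree.isMultilinear_node g).weight_subst]
    simp [BinTree.weight]

/-- The class in degree `n` as a linear map. -/
noncomputable def symbolLin (n : ℕ) (X : Type) [Finite X] : F.F n X →ₗ[k] F.gr.obj X :=
  DirectSum.lof k ℕ (fun n => F.Piece n X) n ∘ₗ Submodule.mkQ _

theorem symbol_eq_zero_iff (n : ℕ) {X : Type} [Finite X] {a : P.obj X} (ha : a ∈ F.F n X) :
    F.symbol n a ha = 0 ↔ a ∈ F.F (n + 1) X := by
  have h : F.symbol n a ha = 0 ↔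
      ((F.F (n + 1) X).submoduleOf (F.F n X)).mkQ (⟨a, ha⟩ : F.F n X) = 0 :=
    map_eq_zero_iff (DirectSum.of (fun n => F.Piece n X) n) (DirectSum.of_injective n)
  rw [h, Submodule.mkQ_apply, Submodule.Quotient.mk_eq_zero]
  rfl

/-- If the filtration is given by the weights of trees, then the classes of trees span the
associated graded operad. -/
theorem freeLift_symbolGen_surjective
    (hF : ∀ n (X : Type) [Finite X], F.F n X = treeSpan P gen c n X) (X : Type) [Finite X] :
    Surjective ((freeLift F.gr (F.symbolGen gen c hgen)).toLin X) := by
  rw [← LinearMap.range_eq_top, eq_top_iff]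
  refine (F.span_symbol X).symm.le.trans (Submodule.span_le.2 ?_)
  rintro _ ⟨n, a, ha, rfl⟩
  have : F.F n X ≤ ((LinearMap.range ((freeLift F.gr (F.symbolGen gen c hgen)).toLin X)).comap
      (F.symbolLin n X)).map (F.F n X).subtype := by
    conv_lhs => rw [hF]
    rw [treeSpan, Submodule.span_le]
    rintro _ ⟨t, ht, hn, rfl⟩
    have hm := F.antitone hn X (F.toOperation_mem gen c hgen ht)
    refine ⟨⟨_, hm⟩, ?_, rfl⟩
    suffices ∃ f, (freeLift F.gr (F.symbolGen gen c hgen)).toLin X f =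
      F.symbol n (ht.toOperation P gen) hm from this
    obtain h | h := hn.eq_or_lt
    · refine ⟨freeTree k t ht, ?_⟩
      exact (freeLift_freeTree F.gr (F.symbolGen gen c hgen) t ht).trans
        ((F.toOperation_symbolGen gen c hgen ht).trans (F.symbol_congr _ _ h.symm rfl))
    -- A tree heavier than `n` has class zero in degree `n`.
    · have h0 := (F.symbol_eq_zero_iff n hm).2
        (F.antitone h X (F.toOperation_mem gen c hgen ht))
      exact ⟨0, ((freeLift F.gr (F.symbolGen gen c hgen)).toLin X).map_zero.trans h0.symm⟩
  obtain ⟨⟨b, hb⟩, h1, h2⟩ := this ha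
  obtain rfl : b = a := h2
  exact h1

end Filtration

end Operad

/-! ### Almost Poisson algebras -/

namespace AlmostPoisson

/-- The weights for which the weight of a tree is its number of brackets. -/
def degree : AlmostPoissonOp → ℕ
  | AlmostPoissonOp.mul => 0
  | AlmostPoissonOp.bracket => 1

/-- The weights for which the weight of a tree is its number of products. -/
def codegree : AlmostPoissonOp → ℕ
  | AlmostPoissonOp.mul => 1
  | AlmostPoissonOp.bracket => 0

theorem codegree_add_degree {X : Type} (t : BinTree AlmostPoissonOp X) :
    t.weight codegree + t.weight degree = t.weight (fun _ => 1) := by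
  induction t with
  | leaf x => rfl
  | node g l r hl hr => cases g <;> simp only [BinTree.weight, codegree, degree] <;> omega

variable {k : Type u} [Field k]

/-- The rescaling factor sees only the numbers of products and brackets; in a given arity these
determine each other. -/
theorem scalar_eq (c : AlmostPoissonOp → k) {X : Type} (t : BinTree AlmostPoissonOp X) :
    t.scalar c = c AlmostPoissonOp.mul ^ t.weight codegree *
      c AlmostPoissonOp.bracket ^ t.weight degree := by
  induction t with
  | leaf x => simp [BinTree.scalar, BinTree.weight]
  | node g l r hl hr =>
    cases g <;> simp only [BinTree.weight, BinTree.scalar, hl, hr, codegree, degree] <;> ring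

section Algebra

variable {A : Type*} [AddCommGroup A] [Module k A] (op : AlmostPoissonOp → A →ₗ[k] A →ₗ[k] A)

/-- An algebra satisfying the axioms of almost Poisson algebras satisfies all identities that hold
in the almost Poisson operad. -/
theorem relations_le_identities
    (mul_comm : ∀ a b, op AlmostPoissonOp.mul a b = op AlmostPoissonOp.mul b a)
    (br_anticomm : ∀ a b, op AlmostPoissonOp.bracket a b = -op AlmostPoissonOp.bracket b a)
    (mul_assoc : ∀ a b c, op AlmostPoissonOp.mul (op AlmostPoissonOp.mul a b) c =
      op AlmostPoissonOp.mul a (op AlmostPoissonOp.mul b c))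
    (leibniz : ∀ a b c, op AlmostPoissonOp.bracket (op AlmostPoissonOp.mul a b) c =
      op AlmostPoissonOp.mul a (op AlmostPoissonOp.bracket b c) +
        op AlmostPoissonOp.mul (op AlmostPoissonOp.bracket a c) b)
    (X : Type) [Finite X] : (relations k).carrier X ≤ (identities op).carrier X := by
  refine idealSpan_le ?_ X
  rintro _ ⟨⟩
  · refine (mem_identities op).2 fun v => ?_
    rw [map_sub, freeEval_freeTree, freeEval_freeTree, sub_eq_zero]
    exact mul_comm _ _
  · refine (mem_identities op).2 fun v => ?_
    rw [map_add, freeEval_freeTree, freeEval_freeTree, add_eq_zero_iff_eq_neg]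
    exact br_anticomm _ _
  · refine (mem_identities op).2 fun v => ?_
    rw [map_sub, freeEval_freeTree, freeEval_freeTree, sub_eq_zero]
    exact mul_assoc _ _ _
  · refine (mem_identities op).2 fun v => ?_
    rw [map_sub, map_sub, freeEval_freeTree, freeEval_freeTree, freeEval_freeTree, sub_sub,
      sub_eq_zero]
    exact leibniz _ _ _

end Algebra

open MvPolynomial in
variable (k) in
/-- The polynomial algebra in two variables with its standard Poisson bracket. -/
noncomputable def poissonPlane : AlmostPoissonOp → MvPolynomial (Fin 2) k →ₗ[k]
    MvPolynomial (Fin 2) k →ₗ[k] MvPolynomial (Fin 2) k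
  | AlmostPoissonOp.mul => LinearMap.mul k _
  | AlmostPoissonOp.bracket =>
    (LinearMap.mul k _).compl₁₂ (pderiv 0).toLinearMap (pderiv 1).toLinearMap -
      (LinearMap.mul k _).compl₁₂ (pderiv 1).toLinearMap (pderiv 0).toLinearMap

theorem poissonPlane_mul (a b : MvPolynomial (Fin 2) k) :
    poissonPlane k AlmostPoissonOp.mul a b = a * b := rfl

open MvPolynomial in
theorem poissonPlane_bracket (a b : MvPolynomial (Fin 2) k) :
    poissonPlane k AlmostPoissonOp.bracket a b =
      pderiv 0 a * pderiv 1 b - pderiv 1 a * pderiv 0 b := rfl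

theorem freeEval_poissonPlane {X : Type} [Finite X] {a : (freePre k AlmostPoissonOp).obj X}
    (ha : a ∈ (relations k).carrier X) (v : X → MvPolynomial (Fin 2) k) :
    freeEval (poissonPlane k) v a = 0 := by
  refine (mem_identities _).1 (relations_le_identities (poissonPlane k) ?_ ?_ ?_ ?_ X ha) v
  · intro a b
    rw [poissonPlane_mul, poissonPlane_mul, mul_comm]
  · intro a b
    rw [poissonPlane_bracket, poissonPlane_bracket]
    ring
  · intro a b c
    simp only [poissonPlane_mul, mul_assoc]
  · intro a b c
    simp only [poissonPlane_mul, poissonPlane_bracket, Derivation.leibniz, smul_eq_mul]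
    ring

/-- A tree with two leaves. -/
noncomputable abbrev generator (k : Type u) [Field k] (g : AlmostPoissonOp) :
    (freePre k AlmostPoissonOp).obj (Fin 2) :=
  freeTree k _ (BinTree.isMultilinear_node g)

/-- In the Poisson plane 1 · 1 = 1 and {x, y} = 1, so neither generator is an identity. -/
theorem generator_notMem_relations (g : AlmostPoissonOp) :
    generator k g ∉ (relations k).carrier (Fin 2) := by
  intro h
  cases g with
  | mul =>
    have := freeEval_poissonPlane h (fun _ => 1)
    rw [freeEval_freeTree] at this
    simp [BinTree.eval, poissonPlane_mul] at this
  | bracket =>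
    have := freeEval_poissonPlane h MvPolynomial.X
    rw [freeEval_freeTree] at this
    simp [BinTree.eval, poissonPlane_bracket] at this

theorem relabel_swap_generator (g : AlmostPoissonOp) :
    (freePre k AlmostPoissonOp).relabel (Equiv.swap 0 1) (generator k g) =
      freeTree k (BinTree.node g (BinTree.leaf 1) (BinTree.leaf 0))
        (isMultilinear_two _ _ _ (by decide)) := by
  rw [freePre_relabel]
  exact freeTree_congr k _ _ (by simp [BinTree.map])

theorem mul_comm_mem : generator k AlmostPoissonOp.mul -
    (freePre k AlmostPoissonOp).relabel (Equiv.swap 0 1) (generator k AlmostPoissonOp.mul) ∈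
      (relations k).carrier (Fin 2) := by
  rw [relabel_swap_generator]
  exact subset_idealSpan Relation.mul_comm

theorem br_anticomm_mem : generator k AlmostPoissonOp.bracket +
    (freePre k AlmostPoissonOp).relabel (Equiv.swap 0 1) (generator k AlmostPoissonOp.bracket) ∈
      (relations k).carrier (Fin 2) := by
  rw [relabel_swap_generator]
  exact subset_idealSpan Relation.br_anticomm

/-- The elements of the free operad spanned by trees with `n` brackets. -/
noncomputable def homogeneous (k : Type u) [Field k] (n : ℕ) (X : Type) [Finite X] :
    Submodule k ((freePre k AlmostPoissonOp).obj X) :=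
  Submodule.span k {a | ∃ (t : BinTree AlmostPoissonOp X) (ht : t.IsMultilinear),
    t.weight degree = n ∧ a = freeTree k t ht}

theorem freeTree_mem_homogeneous {n : ℕ} {X : Type} [Finite X] (t : BinTree AlmostPoissonOp X)
    (ht : t.IsMultilinear) (h : t.weight degree = n) : freeTree k t ht ∈ homogeneous k n X :=
  Submodule.subset_span ⟨t, ht, h, rfl⟩

/-- The elements of the free operad spanned by trees with at least `n` brackets. -/
noncomputable def freeSpan (k : Type u) [Field k] (n : ℕ) (X : Type) [Finite X] :
    Submodule k ((freePre k AlmostPoissonOp).obj X) :=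
  Submodule.span k {a | ∃ (t : BinTree AlmostPoissonOp X) (ht : t.IsMultilinear),
    n ≤ t.weight degree ∧ a = freeTree k t ht}

theorem freeSpan_le_sup (n : ℕ) (X : Type) [Finite X] :
    freeSpan k n X ≤ homogeneous k n X ⊔ freeSpan k (n + 1) X := by
  conv_lhs => rw [freeSpan]
  rw [Submodule.span_le]
  rintro _ ⟨t, ht, hn, rfl⟩
  obtain h | h := hn.eq_or_lt
  · exact Submodule.mem_sup_left (freeTree_mem_homogeneous t ht h.symm)
  · exact Submodule.mem_sup_right (Submodule.subset_span ⟨t, ht, h, rfl⟩)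

/-- Arity two of the free operad is spanned by four trees: the two generators and their transposes.
-/
theorem eq_top_of_generator_mem (S : Submodule k ((freePre k AlmostPoissonOp).obj (Fin 2)))
    (h1 : ∀ g, generator k g ∈ S)
    (h2 : ∀ g, (freePre k AlmostPoissonOp).relabel (Equiv.swap 0 1) (generator k g) ∈ S) :
    S = ⊤ := by
  rw [eq_top_iff, ← span_freeTree, Submodule.span_le]
  rintro _ ⟨t, ht, rfl⟩
  obtain ⟨g, i, j, rfl⟩ := BinTree.exists_eq_node (t := t)
    (by have := ht.weight_one; simp at this; exact this)
  have h0 := ht 0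
  have h1' := ht 1
  simp only [BinTree.occ] at h0 h1'
  have h2 := h2 g
  rw [relabel_swap_generator] at h2
  fin_cases i <;> fin_cases j
  · simp at h0
  · exact h1 g
  · exact h2
  · simp at h0

theorem weight_degree_lt {X : Type} [Fintype X] {t : BinTree AlmostPoissonOp X}
    (ht : t.IsMultilinear) : t.weight degree < Fintype.card X := by
  have h1 := codegree_add_degree t
  have h2 := ht.weight_one
  omega

end AlmostPoisson

/-! ### The filtration by powers of the commutator ideal -/

namespace Operad

open AlmostPoisson

variable {k : Type u} [Field k] (O : Operad.{u, v} k) (μ : O.obj (Fin 2))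

/-- The symmetrized product and the commutator bracket. -/
def commutatorGen : AlmostPoissonOp → O.obj (Fin 2)
  | AlmostPoissonOp.mul => μ + O.opp μ
  | AlmostPoissonOp.bracket => μ - O.opp μ

theorem relabel_swap_opp : O.relabel (Equiv.swap 0 1) (O.opp μ) = μ := by
  rw [opp, ← O.relabel_trans, Equiv.swap_swap, O.relabel_refl]

theorem relabel_swap_mul : O.relabel (Equiv.swap 0 1) (O.commutatorGen μ AlmostPoissonOp.mul) =
    O.commutatorGen μ AlmostPoissonOp.mul := by
  simp only [commutatorGen, map_add, relabel_swap_opp]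
  rw [add_comm]; rfl

theorem relabel_swap_bracket :
    O.relabel (Equiv.swap 0 1) (O.commutatorGen μ AlmostPoissonOp.bracket) =
      -O.commutatorGen μ AlmostPoissonOp.bracket := by
  simp only [commutatorGen, map_sub, relabel_swap_opp]
  rw [neg_sub]; rfl

/-- The filtration by powers of the commutator ideal. -/
abbrev commutatorFiltration : O.Filtration := idealFiltration (O.commutatorIdeal μ)

theorem commutatorGen_mem (g : AlmostPoissonOp) :
    O.commutatorGen μ g ∈ (O.commutatorFiltration μ).F (degree g) (Fin 2) := by
  cases g with
  | mul => rw [degree, Filtration.F_zero]; trivial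
  | bracket => exact mem_idealFiltration_one _ (subset_idealSpan (Set.mem_singleton _))

/-- The morphism from the free operad given by the symmetrized product and the commutator. -/
noncomputable abbrev commutatorHom : Hom (freeOperad k AlmostPoissonOp) O :=
  freeLift O (O.commutatorGen μ)

/-- Half the sum of the symmetrized product and the commutator is `μ`, so these two generate
whatever `μ` generates. -/
theorem treeSpan_commutatorGen_zero [CharZero k] (hgen : O.IsGeneratedBy {⟨2, μ⟩}) (X : Type)
    [Finite X] : treeSpan O (O.commutatorGen μ) degree 0 X = ⊤ := by
  refine hgen (treeSuboperad O (O.commutatorGen μ) degree) ?_ X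
  rintro _ rfl
  have h1 := generator_mem_treeSpan O (O.commutatorGen μ) degree AlmostPoissonOp.mul
  have h2 := generator_mem_treeSpan O (O.commutatorGen μ) degree AlmostPoissonOp.bracket
  have h3 := Submodule.smul_mem _ (2⁻¹ : k)
    (Submodule.add_mem _ h1 (treeSpan_mono _ _ _ (Nat.zero_le _) _ h2))
  have e : (2⁻¹ : k) • (O.commutatorGen μ AlmostPoissonOp.mul +
      O.commutatorGen μ AlmostPoissonOp.bracket) = μ := by
    simp only [commutatorGen]
    module
  rw [e] at h3
  exact h3

/-- The trees with a bracket span an ideal, which contains the commutator and hence the commutator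
ideal; a composite with n vertices in that ideal is then a combination of trees with at least n
brackets. Conversely each bracket of a tree is a vertex in the ideal. The filtration thus becomes a
count of brackets. -/
theorem commutatorFiltration_eq [CharZero k] (hgen : O.IsGeneratedBy {⟨2, μ⟩}) (n : ℕ) (X : Type)
    [Finite X] : (O.commutatorFiltration μ).F n X =
      treeSpan O (O.commutatorGen μ) degree n X := by
  have h0 : ∀ (X : Type) [Finite X], treeSpan O (O.commutatorGen μ) degree 0 X = ⊤ :=
    fun X _ => O.treeSpan_commutatorGen_zero μ hgen X
  apply le_antisymm
  · refine Submodule.span_le.2 ?_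
    rintro a ⟨m, hm, ha⟩
    refine treeSpan_mono _ _ _ hm _ (treeComp_mem_treeSpan _ _ _ h0 (fun X _ => ?_) ha)
    refine idealSpan_le (I := treeIdeal O (O.commutatorGen μ) degree h0) ?_ X
    rintro _ rfl
    exact generator_mem_treeSpan O (O.commutatorGen μ) degree AlmostPoissonOp.bracket
  · rw [treeSpan, Submodule.span_le]
    rintro _ ⟨t, ht, hn, rfl⟩
    exact Filtration.antitone _ hn X (Filtration.toOperation_mem _ _ _ (O.commutatorGen_mem μ) ht)

theorem commutatorFiltration_eq_map [CharZero k] (hgen : O.IsGeneratedBy {⟨2, μ⟩}) (n : ℕ)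
    (X : Type) [Finite X] : (O.commutatorFiltration μ).F n X =
      (freeSpan k n X).map ((O.commutatorHom μ).app X) := by
  rw [O.commutatorFiltration_eq μ hgen, treeSpan, freeSpan]
  refine Eq.trans ?_ (Submodule.map_span _ _).symm
  congr 1
  ext a
  constructor
  · rintro ⟨t, ht, hn, rfl⟩
    exact ⟨_, ⟨t, ht, hn, rfl⟩, freeLift_freeTree _ _ t ht⟩
  · rintro ⟨_, ⟨t, ht, hn, rfl⟩, rfl⟩
    exact ⟨t, ht, hn, freeLift_freeTree _ _ t ht⟩

theorem commutatorHom_surjective [CharZero k] (hgen : O.IsGeneratedBy {⟨2, μ⟩})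
    (X : Type) [Finite X] :
    Surjective ((O.commutatorHom μ).app X) := by
  rw [← LinearMap.range_eq_top, eq_top_iff, ← (O.commutatorFiltration μ).F_zero X,
    O.commutatorFiltration_eq_map μ hgen]
  exact LinearMap.map_le_range

/-- A tree has fewer brackets than leaves. In particular F³ vanishes in arity three, where the
defects of associativity and of the Leibniz rule live. -/
theorem commutatorFiltration_eq_bot [CharZero k] (hgen : O.IsGeneratedBy {⟨2, μ⟩})
    {n : ℕ} {X : Type}
    [Fintype X] (hn : Fintype.card X ≤ n) : (O.commutatorFiltration μ).F n X = ⊥ := by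
  rw [O.commutatorFiltration_eq μ hgen, treeSpan, Submodule.span_eq_bot]
  rintro _ ⟨t, ht, h, rfl⟩
  have := weight_degree_lt ht
  omega

/-- The morphism from the free operad to the associated graded operad given by the classes of the
symmetrized product and of the commutator. -/
noncomputable abbrev symbolHom :
    Hom (freeOperad k AlmostPoissonOp) (O.commutatorFiltration μ).gr :=
  freeLift _ ((O.commutatorFiltration μ).symbolGen (O.commutatorGen μ) degree
    (O.commutatorGen_mem μ))

theorem symbolHom_generator (g : AlmostPoissonOp) :
    (O.symbolHom μ).app (Fin 2) (generator k g) =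
      (O.commutatorFiltration μ).symbol (degree g) (O.commutatorGen μ g)
        (O.commutatorGen_mem μ g) :=
  freeLift_node _ _ g

/-- On elements homogeneous in the bracket the map to the associated graded operad is the leading
term of the map to `O`. Homogeneity makes all the classes fall in the single degree `n`. -/
theorem exists_symbolHom_eq {n : ℕ} {X : Type} [Finite X]
    {a : (freePre k AlmostPoissonOp).obj X} (ha : a ∈ homogeneous k n X) :
    ∃ h : (O.commutatorHom μ).app X a ∈ (O.commutatorFiltration μ).F n X,
      (O.symbolHom μ).app X a = (O.commutatorFiltration μ).symbol n _ h := by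
  induction ha using Submodule.span_induction with
  | mem a ha =>
    obtain ⟨t, ht, rfl, rfl⟩ := ha
    have e : (O.commutatorHom μ).app X (freeTree k t ht) =
        ht.toOperation O (O.commutatorGen μ) := freeLift_freeTree _ _ t ht
    refine ⟨?_, ?_⟩
    · rw [e]
      exact Filtration.toOperation_mem _ _ _ (O.commutatorGen_mem μ) ht
    · refine (freeLift_freeTree _ _ t ht).trans ((Filtration.toOperation_symbolGen _ _ _ _ ht).trans
        (Filtration.symbol_congr _ _ _ rfl e.symm))
  | zero =>
    refine ⟨by rw [map_zero]; exact Submodule.zero_mem _, (map_zero _).trans ?_⟩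
    refine (((O.commutatorFiltration μ).symbolLin n X).map_zero).symm.trans ?_
    exact Filtration.symbol_congr _ _ _ rfl (map_zero _).symm
  | add a b _ _ iha ihb =>
    obtain ⟨ha, ha'⟩ := iha
    obtain ⟨hb, hb'⟩ := ihb
    refine ⟨by rw [map_add]; exact Submodule.add_mem _ ha hb, (map_add _ a b).trans ?_⟩
    rw [ha', hb']
    refine (((O.commutatorFiltration μ).symbolLin n X).map_add ⟨_, ha⟩ ⟨_, hb⟩).symm.trans ?_
    exact Filtration.symbol_congr _ _ _ rfl (map_add _ a b).symm
  | smul c a _ iha =>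
    obtain ⟨ha, ha'⟩ := iha
    refine ⟨by rw [map_smul]; exact Submodule.smul_mem _ c ha, (map_smul _ c a).trans ?_⟩
    rw [ha']
    refine (((O.commutatorFiltration μ).symbolLin n X).map_smul c ⟨_, ha⟩).symm.trans ?_
    exact Filtration.symbol_congr _ _ _ rfl (map_smul _ c a).symm

/-! ### Comparison of the associated graded operad with the almost Poisson operad -/

variable (k) in
/-- The projection from the free operad to the almost Poisson operad. -/
noncomputable abbrev almostPoissonHom : Hom (freeOperad k AlmostPoissonOp) (almostPoisson k) :=
  Hom.toQuotient (relations k)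

theorem almostPoissonHom_eq_zero_iff {X : Type} [Finite X]
    {a : (freePre k AlmostPoissonOp).obj X} :
    (almostPoissonHom k).app X a = 0 ↔ a ∈ (relations k).carrier X :=
  Submodule.Quotient.mk_eq_zero ((relations k).carrier X)

/-- The sign by which the transposition acts on an operation of almost Poisson algebras. -/
def sign (k : Type u) [Field k] : AlmostPoissonOp → k
  | AlmostPoissonOp.mul => 1
  | AlmostPoissonOp.bracket => -1

theorem sign_mul_sign (g : AlmostPoissonOp) : sign k g * sign k g = 1 := by
  cases g <;> simp [sign]

/-- Product and bracket have opposite signs, so symmetrizing with the sign of one of them kills the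
other. -/
theorem sign_mul_sign_of_ne {g h : AlmostPoissonOp} (hgh : g ≠ h) :
    1 + sign k g * sign k h = 0 := by
  cases g <;> cases h <;> simp [sign] at hgh ⊢

theorem add_smul_self {M : Type*} [AddCommGroup M] [Module k M] (c : k) (x : M) :
    x + c • x = (1 + c) • x := by rw [add_smul, one_smul]

theorem almostPoisson_relabel_swap (g : AlmostPoissonOp) :
    (almostPoisson k).relabel (Equiv.swap 0 1) ((almostPoissonHom k).app _ (generator k g)) =
      sign k g • (almostPoissonHom k).app _ (generator k g) := by
  rw [← Hom.app_relabel]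
  cases g with
  | mul =>
    have := almostPoissonHom_eq_zero_iff.2 (mul_comm_mem (k := k))
    rw [map_sub, sub_eq_zero] at this
    rw [sign, one_smul]
    exact this.symm
  | bracket =>
    have := almostPoissonHom_eq_zero_iff.2 (br_anticomm_mem (k := k))
    rw [map_add, add_comm, add_eq_zero_iff_eq_neg] at this
    rw [sign, neg_one_smul]
    exact this

theorem commutator_relabel_swap (g : AlmostPoissonOp) :
    O.relabel (Equiv.swap 0 1) (O.commutatorGen μ g) = sign k g • O.commutatorGen μ g := by
  cases g with
  | mul => rw [relabel_swap_mul, sign, one_smul]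
  | bracket => rw [relabel_swap_bracket, sign, neg_one_smul]

variable (ψ : Operad.Iso (O.commutatorFiltration μ).gr (almostPoisson k))

theorem symbolHom_relabel_swap (g : AlmostPoissonOp) :
    (almostPoisson k).relabel (Equiv.swap 0 1)
      ((ψ.compHom (O.symbolHom μ)).app _ (generator k g)) =
      sign k g • (ψ.compHom (O.symbolHom μ)).app _ (generator k g) := by
  have h : (O.commutatorFiltration μ).gr.relabel (Equiv.swap 0 1)
      ((O.symbolHom μ).app _ (generator k g)) =
      sign k g • (O.symbolHom μ).app _ (generator k g) := by
    rw [symbolHom_generator]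
    refine (Filtration.grPre_relabel_symbol _ _ _ _ _).trans (Eq.trans ?_
      (((O.commutatorFiltration μ).symbolLin _ _).map_smul (sign k g)
        ⟨_, O.commutatorGen_mem μ g⟩))
    exact Filtration.symbol_congr _ _ _ rfl (O.commutator_relabel_swap μ g)
  change (almostPoisson k).relabel _ (ψ.equiv _ ((O.symbolHom μ).app _ (generator k g))) =
    sign k g • ψ.equiv _ ((O.symbolHom μ).app _ (generator k g))
  rw [← ψ.map_relabel, h, map_smul]

/-- Nothing is assumed about `ψ` and degrees; the symmetric group replaces the grading. The class of
`g` is an eigenvector of the transposition with eigenvalue the sign of `g`, and in arity two of the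
almost Poisson operad that eigenspace is spanned by `g`. -/
theorem exists_scalar (hk : (2 : k) ≠ 0) (g : AlmostPoissonOp) : ∃ c : k,
    (ψ.compHom (O.symbolHom μ)).app _ (generator k g) =
      c • (almostPoissonHom k).app _ (generator k g) := by
  obtain ⟨f, hf⟩ := toQuotient_surjective _ (relations k) _
    ((ψ.compHom (O.symbolHom μ)).app _ (generator k g))
  -- Twice the projector onto the eigenspace of the transposition belonging to `g`: it maps
  -- everything into the line of `g` and doubles the image of the class of `g`, whence the factor
  -- 1/2 in the scalar.
  let L : (almostPoisson k).obj (Fin 2) →ₗ[k] (almostPoisson k).obj (Fin 2) :=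
    LinearMap.id + sign k g • (almostPoisson k).relabel (Equiv.swap 0 1)
  have hL : ∀ a, L a = a + sign k g • (almostPoisson k).relabel (Equiv.swap 0 1) a :=
    fun _ => rfl
  let S := (k ∙ ((almostPoissonHom k).app _ (generator k g))).comap
    (L ∘ₗ (almostPoissonHom k).app _)
  have h1 : ∀ g', L ((almostPoissonHom k).app _ (generator k g')) ∈
      (k ∙ ((almostPoissonHom k).app _ (generator k g))) := by
    intro g'
    rw [hL, almostPoisson_relabel_swap]
    by_cases h : g = g'
    · subst h
      rw [smul_smul, sign_mul_sign, one_smul]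
      exact Submodule.add_mem _ (Submodule.mem_span_singleton_self _)
        (Submodule.mem_span_singleton_self _)
    · have := sign_mul_sign_of_ne (k := k) h
      rw [smul_smul, add_smul_self, this, zero_smul]
      exact Submodule.zero_mem _
  have hS : S = ⊤ := by
    refine eq_top_of_generator_mem S h1 fun g' => ?_
    change L ((almostPoissonHom k).app _ ((freePre k AlmostPoissonOp).relabel _ (generator k g'))) ∈
      (k ∙ ((almostPoissonHom k).app _ (generator k g)))
    rw [Hom.app_relabel, almostPoisson_relabel_swap, map_smul]
    exact Submodule.smul_mem _ _ (h1 g')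
  have h2 : f ∈ S := by rw [hS]; trivial
  have h3 : L ((almostPoissonHom k).app _ f) ∈ (k ∙ ((almostPoissonHom k).app _ (generator k g))) :=
    h2
  have h4 : (almostPoissonHom k).app _ f =
    (ψ.compHom (O.symbolHom μ)).app _ (generator k g) := hf
  rw [h4, hL, symbolHom_relabel_swap, smul_smul, sign_mul_sign, one_smul] at h3
  obtain ⟨c, hc⟩ := Submodule.mem_span_singleton.1 h3
  refine ⟨2⁻¹ * c, ?_⟩
  rw [mul_smul, hc, ← two_smul k, smul_smul, inv_mul_cancel₀ hk, one_smul]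

theorem symbolHom_surjective [CharZero k] (hgen : O.IsGeneratedBy {⟨2, μ⟩}) (X : Type)
    [Finite X] : Surjective ((ψ.compHom (O.symbolHom μ)).app X) :=
  (ψ.equiv X).surjective.comp (Filtration.freeLift_symbolGen_surjective _ _ _ _
    (fun n X _ => O.commutatorFiltration_eq μ hgen n X) X)

/-- If the class of `g` were sent to zero, the image of arity two would have no part of the sign of
`g`. The image is everything by surjectivity, and the generator `g` of the almost Poisson operad has
that sign and is nonzero. -/
theorem scalar_ne_zero [CharZero k] (hgen : O.IsGeneratedBy {⟨2, μ⟩})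
    (ψ : Operad.Iso (O.commutatorFiltration μ).gr (almostPoisson k)) (g : AlmostPoissonOp)
    (h0 : (ψ.compHom (O.symbolHom μ)).app _ (generator k g) = 0) : False := by
  obtain ⟨f, hf⟩ := O.symbolHom_surjective μ ψ hgen _
    ((almostPoissonHom k).app _ (generator k g))
  let L : (almostPoisson k).obj (Fin 2) →ₗ[k] (almostPoisson k).obj (Fin 2) :=
    LinearMap.id + sign k g • (almostPoisson k).relabel (Equiv.swap 0 1)
  have hL : ∀ a, L a = a + sign k g • (almostPoisson k).relabel (Equiv.swap 0 1) a :=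
    fun _ => rfl
  let S := LinearMap.ker (L ∘ₗ (ψ.compHom (O.symbolHom μ)).app _)
  have h1 : ∀ g', L ((ψ.compHom (O.symbolHom μ)).app _ (generator k g')) = 0 := by
    intro g'
    rw [hL, symbolHom_relabel_swap]
    by_cases h : g = g'
    · subst h
      rw [h0, smul_zero, smul_zero, add_zero]
    · have := sign_mul_sign_of_ne (k := k) h
      rw [smul_smul, add_smul_self, this, zero_smul]
  have hS : S = ⊤ := by
    refine eq_top_of_generator_mem S h1 fun g' => ?_
    change L ((ψ.compHom (O.symbolHom μ)).app _
      ((freePre k AlmostPoissonOp).relabel _ (generator k g'))) = 0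
    rw [Hom.app_relabel, symbolHom_relabel_swap, map_smul, h1, smul_zero]
  have h2 : f ∈ S := by rw [hS]; trivial
  have h3 : L ((ψ.compHom (O.symbolHom μ)).app _ f) = 0 := h2
  rw [hf, hL, almostPoisson_relabel_swap, smul_smul, sign_mul_sign, one_smul, ← two_smul k,
    smul_eq_zero] at h3
  exact generator_notMem_relations g (almostPoissonHom_eq_zero_iff.1 (h3.resolve_left two_ne_zero))

/-- A homogeneous element of degree `n` is a relation of almost Poisson algebras if and only if its
value in `O` lies in the step `n + 1` of the filtration. -/
theorem mem_relations_iff [CharZero k] (hgen : O.IsGeneratedBy {⟨2, μ⟩})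
    (ψ : Operad.Iso (O.commutatorFiltration μ).gr (almostPoisson k)) {n : ℕ} {X : Type}
    [Finite X] {a : (freePre k AlmostPoissonOp).obj X} (ha : a ∈ homogeneous k n X) :
    a ∈ (relations k).carrier X ↔
      (O.commutatorHom μ).app X a ∈ (O.commutatorFiltration μ).F (n + 1) X := by
  choose c hc using O.exists_scalar μ ψ two_ne_zero
  have hc0 : ∀ g, c g ≠ 0 := fun g h =>
    O.scalar_ne_zero μ hgen ψ g (by rw [hc, h, zero_smul])
  cases nonempty_fintype X
  -- In arity r a tree with n brackets has r - 1 - n products, so all trees occurring in `a` are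
  -- rescaled by the same factor, and this factor is nonzero.
  have key : (ψ.compHom (O.symbolHom μ)).app X a =
      (c AlmostPoissonOp.mul ^ (Fintype.card X - 1 - n) * c AlmostPoissonOp.bracket ^ n) •
        (almostPoissonHom k).app X a := by
    have : homogeneous k n X ≤ LinearMap.eqLocus ((ψ.compHom (O.symbolHom μ)).app X)
        ((c AlmostPoissonOp.mul ^ (Fintype.card X - 1 - n) * c AlmostPoissonOp.bracket ^ n) •
        (almostPoissonHom k).app X) := by
      rw [homogeneous, Submodule.span_le]
      rintro _ ⟨t, ht, rfl, rfl⟩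
      refine (Hom.freeTree_eq_smul (almostPoissonHom k) (ψ.compHom (O.symbolHom μ)) c hc t
        ht).trans ?_
      have h1 := codegree_add_degree t
      have h2 := ht.weight_one
      rw [scalar_eq, show Fintype.card X - 1 - t.weight degree = t.weight codegree by omega]
      rfl
    exact this ha
  obtain ⟨h, h'⟩ := O.exists_symbolHom_eq μ ha
  rw [← (O.commutatorFiltration μ).symbol_eq_zero_iff n h, ← almostPoissonHom_eq_zero_iff]
  have h1 : (ψ.compHom (O.symbolHom μ)).app X a = 0 ↔ (O.symbolHom μ).app X a = 0 :=
    (ψ.equiv X).map_eq_zero_iff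
  rw [h'] at h1
  refine Iff.trans ?_ h1
  rw [key, smul_eq_zero, or_iff_right]
  exact mul_ne_zero (pow_ne_zero _ (hc0 _)) (pow_ne_zero _ (hc0 _))

end Operad

/-! ### Deformations of the axioms of almost Poisson algebras -/

section Deformation

variable {k : Type u} [Field k] {A : Type*} [AddCommGroup A] [Module k A]
  (m l : A →ₗ[k] A →ₗ[k] A)

/-- The identity A(ab,c,d) - A(a,bc,d) + A(a,b,cd) = a A(b,c,d) + A(a,b,c) d holds for the
associator A of any bilinear product. Inserting the first-order form of A gives a condition on `α`.
The hypotheses `h1` and `h2` express that everything quadratic in the bracket is discarded. -/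
theorem pentagon_of_quadratic_eq_zero (hm : ∀ x y, m x y = m y x) (hl : ∀ x y, l x y = -l y x)
    (h1 : ∀ x y z, l x (l y z) = 0) (h2 : ∀ x y z w, m (l x y) (l z w) = 0)
    (leibniz : ∀ x y z, l (m x y) z = m x (l y z) + m y (l x z)) (α : k)
    (assoc : ∀ x y z, m (m x y) z = m x (m y z) +
      α • (m x (l y z) - (2 : k) • m y (l z x) + m z (l x y))) (a b c d : A) :
    α • (-m (m a b) (l c d) + (2 : k) • m (m b c) (l a d) - m (m c d) (l a b)) = 0 := by
  have h1' : ∀ x y z, l (l y z) x = 0 := fun x y z => by rw [hl, h1, neg_zero]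
  have leibniz' : ∀ x y z, l z (m x y) = m x (l z y) + m y (l z x) := fun x y z => by
    rw [hl, leibniz, hl y z, hl x z]
    simp only [map_neg]
    abel
  have e1 := assoc (m a b) c d
  have e2 := assoc a (m b c) d
  have e3 := assoc a b (m c d)
  have e4 := congrArg (m a) (assoc b c d)
  have e5 := congrArg (fun x => m x d) (assoc a b c)
  -- Next to a bracket the product is associative, since the correction would contain two brackets.
  have ha : ∀ x y z w, m x (m y (l z w)) = m (m x y) (l z w) := fun x y z w => by
    rw [assoc x y (l z w), h1, h1', h2]
    simp
  simp only [leibniz, leibniz', map_add, map_sub, map_smul, LinearMap.add_apply,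
    LinearMap.sub_apply, LinearMap.smul_apply] at e1 e2 e3 e4 e5
  rw [hm (m a (l b c)) d, hm (m b (l c a)) d, hm (m c (l a b)) d] at e5
  -- The five faces of the pentagon, combined so that all the bracket-free terms cancel.
  have key := ((congrArg₂ (· - ·) (congrArg₂ (· + ·) (congrArg₂ (· - ·) e1 e2) e3)
    (congrArg₂ (· + ·) e4 e5)))
  simp only [ha] at key
  simp only [hm c a, hm d a, hm c b, hm d b, hm d c, hl c a, hl d a, hl d b, map_neg] at key
  linear_combination (norm := module) -key

/-- The two sides of the associativity formula are bracketed with `d` and expanded by the deformed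
Leibniz rule. The `β` terms then carry three brackets and drop out; what survives are `γ`-multiples
of products of two brackets. -/
theorem jacobi_of_cubic_eq_zero (hm : ∀ x y, m x y = m y x) (hl : ∀ x y, l x y = -l y x)
    (h1 : ∀ x y z w, l x (l y (l z w)) = 0) (h2 : ∀ x y z w, l (l x y) (l z w) = 0) (γ β : k)
    (leibniz : ∀ x y z, l (m x y) z = m x (l y z) + m y (l x z) +
      γ • (l x (l y z) - l y (l z x)))
    (assoc : ∀ x y z, m (m x y) z = m x (m y z) +
      β • (l x (l y z) - (2 : k) • l y (l z x) + l z (l x y))) (a b c d : A) :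
    γ • ((2 : k) • m (l a c) (l b d) + m (l b c) (l a d) + m (l a b) (l c d)) = 0 := by
  have h3 : ∀ x y z w, l x (l (l z w) y) = 0 := fun x y z w => by rw [hl _ y]; simp [h1]
  have h4 : ∀ x y z w, l (l y (l z w)) x = 0 := fun x y z w => by rw [hl _ x]; simp [h1]
  have leibniz' : ∀ x y z, l z (m x y) = m x (l z y) + m y (l z x) -
      γ • (l x (l y z) - l y (l z x)) := fun x y z => by
    rw [hl, leibniz, hl y z, hl x z]
    simp only [map_neg]
    module
  have ha : ∀ x y z w, m x (m y (l z w)) = m (m x y) (l z w) := fun x y z w => by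
    rw [assoc x y (l z w), h1, h2, h3]
    simp
  have key := congrArg (fun x => l x d) (assoc a b c)
  simp only [leibniz, leibniz', map_add, map_sub, map_smul, LinearMap.add_apply,
    LinearMap.sub_apply, LinearMap.smul_apply, h1, h2, h3, h4, ha] at key
  simp only [hm c a, hm c b, hl c a, hl d a, hl c b, hl d b, map_neg, LinearMap.neg_apply,
    hm (l b d) (l a c), hm (l a d) (l b c), hm (l c d) (l a b)] at key
  linear_combination (norm := module) -key

/-- By the exact Leibniz rule {-, d} is a derivation of the product, hence of the associator A:
{A(a,b,c), d} is A({a,d},b,c) + A(a,{b,d},c) + A(a,b,{c,d}). As A is `β` times a combination of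
double brackets, `β` multiplies the failure of {-, d} to be a derivation of that combination. -/
theorem derivation_of_associator (hm : ∀ x y, m x y = m y x)
    (leibniz : ∀ x y z, l (m x y) z = m x (l y z) + m y (l x z)) (β : k)
    (assoc : ∀ x y z, m (m x y) z = m x (m y z) +
      β • (l x (l y z) - (2 : k) • l y (l z x) + l z (l x y))) (a b c d : A) :
    β • ((l (l a (l b c)) d - (2 : k) • l (l b (l c a)) d + l (l c (l a b)) d) -
      (l (l a d) (l b c) - (2 : k) • l b (l c (l a d)) + l c (l (l a d) b)) -
      (l a (l (l b d) c) - (2 : k) • l (l b d) (l c a) + l c (l a (l b d))) -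
      (l a (l b (l c d)) - (2 : k) • l b (l (l c d) a) + l (l c d) (l a b))) = 0 := by
  have key := congrArg (fun x => l x d) (assoc a b c)
  have e1 := assoc a b (l c d)
  have e2 := assoc a (l b d) c
  have e3 := assoc (l a d) b c
  simp only [leibniz, map_add, map_sub, map_smul, LinearMap.add_apply,
    LinearMap.sub_apply, LinearMap.smul_apply] at key
  rw [hm (m b c) (l a d)] at key
  rw [hm (m a (l b d)) c, hm (l b d) c] at e2
  rw [hm (l a d) b, hm (m b (l a d)) c] at e3
  linear_combination (norm := module) e1 + e2 + e3 - key

end Deformation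

/-! ### Normal forms of the associator and of the Leibniz defect -/

section Triple

variable {k : Type u} [Field k] {A : Type*} [AddCommGroup A] [Module k A]
  (h m l : A →ₗ[k] A →ₗ[k] A)

/-- The span of the operations `h x (l y z)` for the cyclic permutations `x, y, z` of the
variables. -/
def tripleSpan : Submodule k ((Fin 3 → A) → A) :=
  Submodule.span k {fun v => h (v 0) (l (v 1) (v 2)), fun v => h (v 1) (l (v 2) (v 0)),
    fun v => h (v 2) (l (v 0) (v 1))}

variable {h m l}

/-- Anticommutativity identifies, up to sign, the two orders of the inner arguments, leaving three
of the six permutations. -/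
theorem mem_tripleSpan (hl : ∀ x y, l x y = -l y x) {i j r : Fin 3} (hij : i ≠ j) (hir : i ≠ r)
    (hjr : j ≠ r) : (fun v : Fin 3 → A => h (v i) (l (v j) (v r))) ∈ tripleSpan h l := by
  have neg : ∀ i j r, (fun v : Fin 3 → A => h (v i) (l (v r) (v j))) ∈ tripleSpan h l →
      (fun v : Fin 3 → A => h (v i) (l (v j) (v r))) ∈ tripleSpan h l := fun i j r hv => by
    have e : (fun v : Fin 3 → A => h (v i) (l (v j) (v r))) =
        -fun v => h (v i) (l (v r) (v j)) := by
      funext v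
      simp only [Pi.neg_apply]
      rw [hl, map_neg]
    rw [e]
    exact Submodule.neg_mem _ hv
  have h0 : (fun v : Fin 3 → A => h (v 0) (l (v 1) (v 2))) ∈ tripleSpan h l :=
    Submodule.subset_span (by simp)
  have h1 : (fun v : Fin 3 → A => h (v 1) (l (v 2) (v 0))) ∈ tripleSpan h l :=
    Submodule.subset_span (by simp)
  have h2 : (fun v : Fin 3 → A => h (v 2) (l (v 0) (v 1))) ∈ tripleSpan h l :=
    Submodule.subset_span (by simp)
  fin_cases i <;> fin_cases j <;> fin_cases r <;>
    first
    | exact (hij rfl).elim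
    | exact (hir rfl).elim
    | exact (hjr rfl).elim
    | exact h0
    | exact h1
    | exact h2
    | exact neg 0 2 1 h0
    | exact neg 1 0 2 h1
    | exact neg 2 1 0 h2

/-- For a commutative product the associator changes sign when its outer arguments are exchanged,
and its cyclic sum is zero. Among the coefficient vectors of the three operations in the span, these
symmetries leave only the multiples of (1, -2, 1). -/
theorem exists_associator_eq [CharZero k] (hm : ∀ x y, m x y = m y x)
    (hl : ∀ x y, l x y = -l y x)
    (hA : (fun v : Fin 3 → A => m (m (v 0) (v 1)) (v 2) - m (v 0) (m (v 1) (v 2))) ∈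
      tripleSpan h l) :
    ∃ α : k, ∀ x y z, m (m x y) z = m x (m y z) +
      α • (h x (l y z) - (2 : k) • h y (l z x) + h z (l x y)) := by
  obtain ⟨p, q, r, hpqr⟩ := Submodule.mem_span_triple.1 hA
  have H : ∀ x y z, p • h x (l y z) + q • h y (l z x) + r • h z (l x y) =
      m (m x y) z - m x (m y z) := fun x y z => congrFun hpqr ![x, y, z]
  -- The coefficient of the projection of (p, q, r) to (1, -2, 1), namely (p - 2q + r)/6. The three
  -- operations may be linearly dependent, so the given expression is averaged over permutations of
  -- the variables; coefficients are not compared.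
  refine ⟨3⁻¹ * (2⁻¹ * (p + r) - q), fun x y z => ?_⟩
  have H1 := H x y z
  have H2 := H y z x
  have H3 := H z x y
  have H4 := H z y x
  have H5 := H y x z
  have H6 := H x z y
  rw [hm (m x y) z] at H1 ⊢
  rw [hm (m y z) x, hm z x] at H2
  rw [hm (m z x) y, hm z x] at H3
  rw [hm (m z y) x, hm z y, hm y x, hl z y, hl y x, hl x z] at H4
  rw [hm (m y x) z, hm y x, hl z y, hl y x, hl x z] at H5
  rw [hm (m x z) y, hm z y, hl z y, hl y x, hl x z] at H6
  simp only [map_neg] at H4 H5 H6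
  linear_combination (norm := module) (6⁻¹ : k) • ((2 : k) • H4 + H2 + H3 - (2 : k) • H1 - H5 - H6)

/-- The Leibniz defect is symmetric in its first two arguments, whose exchange sends the
coefficients (p, q, r) to (-q, -p, -r). -/
theorem exists_leibniz_eq [CharZero k] (hm : ∀ x y, m x y = m y x)
    (hl : ∀ x y, l x y = -l y x)
    (hL : (fun v : Fin 3 → A => l (m (v 0) (v 1)) (v 2) - m (v 0) (l (v 1) (v 2)) -
      m (l (v 0) (v 2)) (v 1)) ∈ tripleSpan h l) :
    ∃ γ : k, ∀ x y z, l (m x y) z = m x (l y z) + m y (l x z) +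
      γ • (h x (l y z) - h y (l z x)) := by
  obtain ⟨p, q, r, hpqr⟩ := Submodule.mem_span_triple.1 hL
  have H : ∀ x y z, p • h x (l y z) + q • h y (l z x) + r • h z (l x y) =
      l (m x y) z - m x (l y z) - m (l x z) y := fun x y z => congrFun hpqr ![x, y, z]
  -- Averaging over the exchange replaces (p, q, r) by (p - q)/2 times (1, -1, 0).
  refine ⟨2⁻¹ * (p - q), fun x y z => ?_⟩
  have H1 := H x y z
  have H2 := H y x z
  rw [hm (l x z) y] at H1
  rw [hm y x, hm (l y z) x, hl z y, hl y x, hl x z] at H2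
  rw [hl x z] at H1 ⊢
  simp only [map_neg] at H1 H2 ⊢
  linear_combination (norm := module) (-2⁻¹ : k) • (H1 + H2)

end Triple

/-! ### Trees with three leaves -/

namespace BinTree

variable {G : Type} {n : ℕ}

/-- The list of the labels of the leaves of a tree. -/
def labels : BinTree G (Fin n) → List (Fin n)
  | leaf x => [x]
  | node _ l r => l.labels ++ r.labels

theorem occ_eq_count (t : BinTree G (Fin n)) (x : Fin n) : t.occ x = t.labels.count x := by
  induction t with
  | leaf y => by_cases h : y = x <;> simp [occ, labels, h]
  | node g l r hl hr => simp [occ, labels, hl, hr]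

/-- `occ` rests on classical decidability; counting in the list of labels makes multilinearity of a
concrete tree accessible to `decide`. -/
theorem isMultilinear_of_count {t : BinTree G (Fin n)} (h : ∀ x, t.labels.count x = 1) :
    t.IsMultilinear := fun x => (t.occ_eq_count x).trans (h x)

theorem IsMultilinear.ne_of_right {g g' : G} {i j r : Fin 3}
    (h : (node g (leaf i) (node g' (leaf j) (leaf r))).IsMultilinear) :
    i ≠ j ∧ i ≠ r ∧ j ≠ r := by
  have h1 : ∀ x, [i, j, r].count x = 1 := fun x => (occ_eq_count _ x).symm.trans (h x)
  clear h
  revert i j r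
  decide

theorem IsMultilinear.ne_of_left {g g' : G} {i j r : Fin 3}
    (h : (node g (node g' (leaf i) (leaf j)) (leaf r)).IsMultilinear) :
    i ≠ j ∧ i ≠ r ∧ j ≠ r := by
  have h1 : ∀ x, [i, j, r].count x = 1 := fun x => (occ_eq_count _ x).symm.trans (h x)
  clear h
  revert i j r
  decide

end BinTree

namespace AlmostPoisson

variable {k : Type u} [Field k] {A : Type*} [AddCommGroup A] [Module k A]
  (op : AlmostPoissonOp → A →ₗ[k] A →ₗ[k] A)

/-- An induction principle for the values of trees with three leaves, up to the symmetries of the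
operations. -/
theorem eval_mem_of_right (hm : ∀ x y, op AlmostPoissonOp.mul x y = op AlmostPoissonOp.mul y x)
    (hl : ∀ x y, op AlmostPoissonOp.bracket x y = -op AlmostPoissonOp.bracket y x)
    (W : Submodule k ((Fin 3 → A) → A)) {n : ℕ}
    (hW : ∀ g g' (i j r : Fin 3), i ≠ j → i ≠ r → j ≠ r → n ≤ degree g + degree g' →
      (fun v : Fin 3 → A => op g (v i) (op g' (v j) (v r))) ∈ W)
    (t : BinTree AlmostPoissonOp (Fin 3)) (ht : t.IsMultilinear) (hn : n ≤ t.weight degree) :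
    (fun v => t.eval op v) ∈ W := by
  obtain ⟨g, g', i, j, r, rfl | rfl⟩ := BinTree.exists_eq_node_node (t := t)
    (by have := ht.weight_one; rw [Fintype.card_fin] at this; omega)
  · obtain ⟨h1, h2, h3⟩ := ht.ne_of_right
    exact hW g g' i j r h1 h2 h3 (by simpa [BinTree.weight] using hn)
  · obtain ⟨h1, h2, h3⟩ := ht.ne_of_left
    have := hW g g' r i j h2.symm h3.symm h1 (by simpa [BinTree.weight] using hn)
    cases g with
    | mul =>
      simp only [BinTree.eval]
      simp only [hm (op g' _ _)]
      exact this
    | bracket =>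
      have e : (fun v : Fin 3 → A => (BinTree.node AlmostPoissonOp.bracket
          (BinTree.node g' (BinTree.leaf i) (BinTree.leaf j)) (BinTree.leaf r)).eval op v) =
          -fun v => op AlmostPoissonOp.bracket (v r) (op g' (v i) (v j)) := by
        funext v
        simp only [Pi.neg_apply, BinTree.eval]
        exact hl _ _
      rw [e]
      exact Submodule.neg_mem _ this

/-- The hypotheses `h1` and `leibniz` are those valid modulo F²: a bracket inside a bracket
vanishes, and a product inside a bracket is expanded, so only products x{y, z} remain. -/
theorem eval_mem_of_one_le (hm : ∀ x y, op AlmostPoissonOp.mul x y = op AlmostPoissonOp.mul y x)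
    (hl : ∀ x y, op AlmostPoissonOp.bracket x y = -op AlmostPoissonOp.bracket y x)
    (h1 : ∀ x y z, op AlmostPoissonOp.bracket x (op AlmostPoissonOp.bracket y z) = 0)
    (leibniz : ∀ x y z, op AlmostPoissonOp.bracket (op AlmostPoissonOp.mul x y) z =
      op AlmostPoissonOp.mul x (op AlmostPoissonOp.bracket y z) +
        op AlmostPoissonOp.mul y (op AlmostPoissonOp.bracket x z))
    (t : BinTree AlmostPoissonOp (Fin 3)) (ht : t.IsMultilinear) (hn : 1 ≤ t.weight degree) :
    (fun v => t.eval op v) ∈ tripleSpan (op AlmostPoissonOp.mul) (op AlmostPoissonOp.bracket) := by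
  refine eval_mem_of_right op hm hl _ (fun g g' i j r hij hir hjr hg => ?_) t ht hn
  cases g <;> cases g'
  · simp [degree] at hg
  · exact mem_tripleSpan hl hij hir hjr
  · have e : (fun v : Fin 3 → A => op AlmostPoissonOp.bracket (v i)
        (op AlmostPoissonOp.mul (v j) (v r))) = -((fun v : Fin 3 → A =>
          op AlmostPoissonOp.mul (v j) (op AlmostPoissonOp.bracket (v r) (v i))) +
          fun v => op AlmostPoissonOp.mul (v r) (op AlmostPoissonOp.bracket (v j) (v i))) := by
      funext v
      simp only [Pi.neg_apply, Pi.add_apply]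
      rw [hl, leibniz]
    rw [e]
    exact Submodule.neg_mem _ (Submodule.add_mem _ (mem_tripleSpan hl hjr hij.symm hir.symm)
      (mem_tripleSpan hl hjr.symm hir.symm hij.symm))
  · simp only [h1]
    exact Submodule.zero_mem _

/-- A tree with three leaves has two vertices, so two brackets leave no room for a product. -/
theorem eval_mem_of_two_le (hm : ∀ x y, op AlmostPoissonOp.mul x y = op AlmostPoissonOp.mul y x)
    (hl : ∀ x y, op AlmostPoissonOp.bracket x y = -op AlmostPoissonOp.bracket y x)
    (t : BinTree AlmostPoissonOp (Fin 3)) (ht : t.IsMultilinear) (hn : 2 ≤ t.weight degree) :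
    (fun v => t.eval op v) ∈
      tripleSpan (op AlmostPoissonOp.bracket) (op AlmostPoissonOp.bracket) := by
  refine eval_mem_of_right op hm hl _ (fun g g' i j r hij hir hjr hg => ?_) t ht hn
  cases g <;> cases g' <;> simp [degree] at hg
  exact mem_tripleSpan hl hij hir hjr

/-! ### A test algebra without the Jacobi identity, and the two defects -/

/-- A three-dimensional anticommutative algebra, with zero product, whose bracket does not satisfy
the Jacobi identity. -/
def skewAlgebra (k : Type u) [Field k] :
    AlmostPoissonOp → (Fin 3 → k) →ₗ[k] (Fin 3 → k) →ₗ[k] (Fin 3 → k)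
  | AlmostPoissonOp.mul => 0
  | AlmostPoissonOp.bracket =>
    crossProduct.compr₂ (Matrix.mulVecLin !![1, 0, 0; 0, 0, 1; 0, 0, 0])

/-- On the standard basis {e₀, e₁} = e₁, {e₁, e₂} = e₀ and {e₀, e₂} = 0, so the Jacobi sum of e₀,
e₁, e₂ is -e₀. -/
theorem skewAlgebra_bracket (a b : Fin 3 → k) : skewAlgebra k AlmostPoissonOp.bracket a b =
    ![a 1 * b 2 - a 2 * b 1, a 0 * b 1 - a 1 * b 0, 0] := by
  ext i
  fin_cases i <;> simp [skewAlgebra, cross_apply, Matrix.vecHead, Matrix.vecTail]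

theorem freeEval_skewAlgebra {X : Type} [Finite X] {a : (freePre k AlmostPoissonOp).obj X}
    (ha : a ∈ (relations k).carrier X) (v : X → Fin 3 → k) :
    freeEval (skewAlgebra k) v a = 0 := by
  refine (mem_identities _).1 (relations_le_identities (skewAlgebra k) ?_ ?_ ?_ ?_ X ha) v
  · intro a b
    simp [skewAlgebra]
  · intro a b
    rw [skewAlgebra_bracket, skewAlgebra_bracket]
    ext i
    fin_cases i <;> simp <;> ring
  · intro a b c
    simp [skewAlgebra]
  · intro a b c
    simp [skewAlgebra]

/-- The associator of the product. -/
noncomputable def associator (k : Type u) [Field k] : (freePre k AlmostPoissonOp).obj (Fin 3) :=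
  freeTree k (mul (mul (x 0) (x 1)) (x 2))
    (isMultilinear_left _ _ _ _ _ (by decide) (by decide) (by decide)) -
  freeTree k (mul (x 0) (mul (x 1) (x 2)))
    (isMultilinear_right _ _ _ _ _ (by decide) (by decide) (by decide))

/-- The defect of the Leibniz rule. -/
noncomputable def leibnizator (k : Type u) [Field k] : (freePre k AlmostPoissonOp).obj (Fin 3) :=
  freeTree k (br (mul (x 0) (x 1)) (x 2))
    (isMultilinear_left _ _ _ _ _ (by decide) (by decide) (by decide)) -
  freeTree k (mul (x 0) (br (x 1) (x 2)))
    (isMultilinear_right _ _ _ _ _ (by decide) (by decide) (by decide)) -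
  freeTree k (mul (br (x 0) (x 2)) (x 1))
    (isMultilinear_left _ _ _ _ _ (by decide) (by decide) (by decide))

theorem associator_mem_relations : associator k ∈ (relations k).carrier (Fin 3) :=
  subset_idealSpan Relation.mul_assoc

theorem leibnizator_mem_relations : leibnizator k ∈ (relations k).carrier (Fin 3) :=
  subset_idealSpan Relation.leibniz

theorem associator_mem_homogeneous : associator k ∈ homogeneous k 0 (Fin 3) :=
  Submodule.sub_mem _ (freeTree_mem_homogeneous _ _ rfl) (freeTree_mem_homogeneous _ _ rfl)

theorem leibnizator_mem_homogeneous : leibnizator k ∈ homogeneous k 1 (Fin 3) :=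
  Submodule.sub_mem _ (Submodule.sub_mem _ (freeTree_mem_homogeneous _ _ rfl)
    (freeTree_mem_homogeneous _ _ rfl)) (freeTree_mem_homogeneous _ _ rfl)

theorem freeEval_associator (v : Fin 3 → A) : freeEval op v (associator k) =
    op AlmostPoissonOp.mul (op AlmostPoissonOp.mul (v 0) (v 1)) (v 2) -
      op AlmostPoissonOp.mul (v 0) (op AlmostPoissonOp.mul (v 1) (v 2)) := by
  rw [associator, map_sub, freeEval_freeTree, freeEval_freeTree]
  rfl

theorem freeEval_leibnizator (v : Fin 3 → A) : freeEval op v (leibnizator k) =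
    op AlmostPoissonOp.bracket (op AlmostPoissonOp.mul (v 0) (v 1)) (v 2) -
      op AlmostPoissonOp.mul (v 0) (op AlmostPoissonOp.bracket (v 1) (v 2)) -
      op AlmostPoissonOp.mul (op AlmostPoissonOp.bracket (v 0) (v 2)) (v 1) := by
  rw [leibnizator, map_sub, map_sub, freeEval_freeTree, freeEval_freeTree, freeEval_freeTree]
  rfl

end AlmostPoisson

/-! ### The relatively free algebras of the steps of the filtration -/

namespace Operad

open AlmostPoisson

variable {k : Type u} [Field k]

/-- The steps of a filtration are ideals. -/
def Filtration.ideal {P : Operad.{u, v} k} (F : P.Filtration) (n : ℕ) : P.OperadIdeal where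
  carrier X _ := F.F n X
  relabel_mem e _ ha := F.relabel_mem e ha
  comp_mem_left {Y _ X _ a} b ha := by
    have := F.comp_mem (m := fun _ => 0) (b := b) ha (fun y => by rw [F.F_zero]; trivial)
    simpa using this
  comp_mem_right {Y _ X _} a b y hb := by
    classical
    have := F.comp_mem (n := 0) (m := fun z => if z = y then n else 0) (a := a) (b := b)
      (by rw [F.F_zero]; trivial) (fun z => by
        by_cases hz : z = y
        · subst hz; simpa using hb
        · rw [if_neg hz, F.F_zero]; trivial)
    cases nonempty_fintype Y
    simpa [finsum_eq_sum_of_fintype] using this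

variable (O : Operad.{u, v} k) (μ : O.obj (Fin 2))

/-- The inverse images in the free operad of the steps of the filtration by powers of the
commutator ideal. -/
noncomputable def stepIdeal (n : ℕ) : (freeOperad k AlmostPoissonOp).OperadIdeal :=
  ((O.commutatorFiltration μ).ideal n).comap (O.commutatorHom μ)

theorem mem_stepIdeal {n : ℕ} {X : Type} [Finite X] {a : (freePre k AlmostPoissonOp).obj X} :
    a ∈ (O.stepIdeal μ n).carrier X ↔
      (O.commutatorHom μ).app X a ∈ (O.commutatorFiltration μ).F n X := Iff.rfl

/-- The operations of the relatively free algebra in four variables of a step of the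
filtration. -/
noncomputable abbrev stepOp (n : ℕ) : AlmostPoissonOp → RelFree (Fin 4) (O.stepIdeal μ n) →ₗ[k]
    RelFree (Fin 4) (O.stepIdeal μ n) →ₗ[k] RelFree (Fin 4) (O.stepIdeal μ n) :=
  relOp (O.stepIdeal μ n)

theorem app_generator (g : AlmostPoissonOp) :
    (O.commutatorHom μ).app (Fin 2) (generator k g) = O.commutatorGen μ g :=
  freeLift_node _ _ g

theorem app_eq_zero_of_sign (g : AlmostPoissonOp) :
    (O.commutatorHom μ).app (Fin 2) (generator k g - sign k g •
      (freePre k AlmostPoissonOp).relabel (Equiv.swap 0 1) (generator k g)) = 0 := by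
  rw [map_sub, map_smul, Hom.app_relabel, app_generator, commutator_relabel_swap, smul_smul,
    sign_mul_sign, one_smul, sub_self]

theorem mem_stepIdeal_of_app_eq_zero {n : ℕ} {X : Type} [Finite X]
    {a : (freePre k AlmostPoissonOp).obj X} (ha : (O.commutatorHom μ).app X a = 0) :
    a ∈ (O.stepIdeal μ n).carrier X := by
  rw [mem_stepIdeal, ha]
  exact Submodule.zero_mem _

theorem stepOp_swap (n : ℕ) (g : AlmostPoissonOp) (a b : RelFree (Fin 4) (O.stepIdeal μ n)) :
    O.stepOp μ n g a b = sign k g • O.stepOp μ n g b a := by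
  have h := freeEval_relOp_eq_zero (O.stepIdeal μ n)
    (O.mem_stepIdeal_of_app_eq_zero μ (O.app_eq_zero_of_sign μ g)) ![a, b]
  rw [map_sub, map_smul, relabel_swap_generator, freeEval_freeTree, freeEval_freeTree,
    sub_eq_zero] at h
  exact h

theorem stepOp_mul_comm (n : ℕ) (a b : RelFree (Fin 4) (O.stepIdeal μ n)) :
    O.stepOp μ n AlmostPoissonOp.mul a b = O.stepOp μ n AlmostPoissonOp.mul b a :=
  (O.stepOp_swap μ n _ a b).trans (one_smul k _)

theorem stepOp_bracket_anticomm (n : ℕ) (a b : RelFree (Fin 4) (O.stepIdeal μ n)) :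
    O.stepOp μ n AlmostPoissonOp.bracket a b = -O.stepOp μ n AlmostPoissonOp.bracket b a :=
  (O.stepOp_swap μ n _ a b).trans (neg_one_smul k _)

theorem eval_stepOp_eq_zero {n : ℕ} {X : Type} [Finite X] {t : BinTree AlmostPoissonOp X}
    (ht : t.IsMultilinear) (hn : n ≤ t.weight degree)
    (v : X → RelFree (Fin 4) (O.stepIdeal μ n)) : t.eval (O.stepOp μ n) v = 0 := by
  rw [← freeEval_freeTree _ v t ht]
  refine freeEval_relOp_eq_zero _ ?_ v
  have e : (O.commutatorHom μ).app X (freeTree k t ht) =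
      ht.toOperation O (O.commutatorGen μ) := freeLift_freeTree _ _ t ht
  rw [mem_stepIdeal, e]
  exact Filtration.antitone _ hn X (Filtration.toOperation_mem _ _ _ (O.commutatorGen_mem μ) ht)

/-- An operation whose value in `O` lies in Fʲ acts on these algebras as a combination of trees with
at least `j` brackets. This turns a position in the filtration into a normal form: any space `W` of
functions containing those trees contains the operation. -/
theorem freeEval_stepOp_mem [CharZero k] (hgen : O.IsGeneratedBy {⟨2, μ⟩}) {n j : ℕ} {X : Type}
    [Finite X] (W : Submodule k ((X → RelFree (Fin 4) (O.stepIdeal μ n)) →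
      RelFree (Fin 4) (O.stepIdeal μ n)))
    (hW : ∀ t : BinTree AlmostPoissonOp X, t.IsMultilinear → j ≤ t.weight degree →
      (fun v => t.eval (O.stepOp μ n) v) ∈ W)
    {a : (freePre k AlmostPoissonOp).obj X} (ha : a ∈ (O.stepIdeal μ j).carrier X) :
    (fun v => freeEval (O.stepOp μ n) v a) ∈ W := by
  rw [mem_stepIdeal, O.commutatorFiltration_eq_map μ hgen] at ha
  obtain ⟨b, hb, hab⟩ := ha
  -- `a` and its representative `b` have the same value in `O`, so their difference lies in every
  -- step ideal and vanishes identically on the algebra.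
  have e : (fun v => freeEval (O.stepOp μ n) v a) = LinearMap.pi (freeEval (O.stepOp μ n)) b := by
    funext v
    have h := freeEval_relOp_eq_zero (O.stepIdeal μ n) (O.mem_stepIdeal_of_app_eq_zero μ
      (show (O.commutatorHom μ).app X (a - b) = 0 by rw [map_sub, hab, sub_self])) v
    rwa [map_sub, sub_eq_zero] at h
  rw [e]
  have hle : freeSpan k j X ≤ W.comap (LinearMap.pi (freeEval (O.stepOp μ n))) := by
    rw [freeSpan, Submodule.span_le]
    rintro _ ⟨t, ht, hn, rfl⟩
    have e : LinearMap.pi (freeEval (O.stepOp μ n)) (freeTree k t ht) =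
        fun v => t.eval (O.stepOp μ n) v := funext fun v => freeEval_freeTree _ v t ht
    have h := hW t ht hn
    rw [← e] at h
    exact h
  exact hle hb

/-- A non-relation of degree `n` does not lie in Fⁿ⁺¹, so its value at the variables of the
corresponding relatively free algebra is nonzero. All three deformation parameters are eliminated in
this way. -/
theorem eq_zero_of_smul_freeEval_eq_zero [CharZero k] (hgen : O.IsGeneratedBy {⟨2, μ⟩})
    (ψ : Operad.Iso (O.commutatorFiltration μ).gr (almostPoisson k)) {n : ℕ}
    {a : (freePre k AlmostPoissonOp).obj (Fin 4)} (ha : a ∈ homogeneous k n (Fin 4))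
    (ha' : a ∉ (relations k).carrier (Fin 4)) {c : k}
    (hc : c • freeEval (O.stepOp μ (n + 1)) (relVar _) a = 0) : c = 0 := by
  by_contra h
  exact ha' ((O.mem_relations_iff μ hgen ψ ha).2
    (mem_of_freeEval_relVar_eq_zero _ ((smul_eq_zero.1 hc).resolve_left h)))

end Operad

/-! ### Three non-relations of arity four -/

namespace AlmostPoisson

variable (k : Type u) [Field k]

/-- An element of degree one detecting the failure of associativity in degree one. -/
noncomputable def pentagonDefect : (freePre k AlmostPoissonOp).obj (Fin 4) :=
  -freeTree k (mul (mul (x 0) (x 1)) (br (x 2) (x 3)))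
      (BinTree.isMultilinear_of_count (by decide)) +
    (2 : k) • freeTree k (mul (mul (x 1) (x 2)) (br (x 0) (x 3)))
      (BinTree.isMultilinear_of_count (by decide)) -
    freeTree k (mul (mul (x 2) (x 3)) (br (x 0) (x 1)))
      (BinTree.isMultilinear_of_count (by decide))

/-- An element of degree two detecting the failure of the Leibniz rule in degree two. -/
noncomputable def jacobiDefect : (freePre k AlmostPoissonOp).obj (Fin 4) :=
  (2 : k) • freeTree k (mul (br (x 0) (x 2)) (br (x 1) (x 3)))
      (BinTree.isMultilinear_of_count (by decide)) +
    freeTree k (mul (br (x 1) (x 2)) (br (x 0) (x 3)))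
      (BinTree.isMultilinear_of_count (by decide)) +
    freeTree k (mul (br (x 0) (x 1)) (br (x 2) (x 3)))
      (BinTree.isMultilinear_of_count (by decide))

/-- An element of degree three detecting the failure of associativity in degree two. -/
noncomputable def derivationDefect : (freePre k AlmostPoissonOp).obj (Fin 4) :=
  (freeTree k (br (br (x 0) (br (x 1) (x 2))) (x 3))
      (BinTree.isMultilinear_of_count (by decide)) -
    (2 : k) • freeTree k (br (br (x 1) (br (x 2) (x 0))) (x 3))
      (BinTree.isMultilinear_of_count (by decide)) +
    freeTree k (br (br (x 2) (br (x 0) (x 1))) (x 3))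
      (BinTree.isMultilinear_of_count (by decide))) -
  (freeTree k (br (br (x 0) (x 3)) (br (x 1) (x 2)))
      (BinTree.isMultilinear_of_count (by decide)) -
    (2 : k) • freeTree k (br (x 1) (br (x 2) (br (x 0) (x 3))))
      (BinTree.isMultilinear_of_count (by decide)) +
    freeTree k (br (x 2) (br (br (x 0) (x 3)) (x 1)))
      (BinTree.isMultilinear_of_count (by decide))) -
  (freeTree k (br (x 0) (br (br (x 1) (x 3)) (x 2)))
      (BinTree.isMultilinear_of_count (by decide)) -
    (2 : k) • freeTree k (br (br (x 1) (x 3)) (br (x 2) (x 0)))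
      (BinTree.isMultilinear_of_count (by decide)) +
    freeTree k (br (x 2) (br (x 0) (br (x 1) (x 3))))
      (BinTree.isMultilinear_of_count (by decide))) -
  (freeTree k (br (x 0) (br (x 1) (br (x 2) (x 3))))
      (BinTree.isMultilinear_of_count (by decide)) -
    (2 : k) • freeTree k (br (x 1) (br (br (x 2) (x 3)) (x 0)))
      (BinTree.isMultilinear_of_count (by decide)) +
    freeTree k (br (br (x 2) (x 3)) (br (x 0) (x 1)))
      (BinTree.isMultilinear_of_count (by decide)))

variable {k}

section

variable {A : Type*} [AddCommGroup A] [Module k A] (op : AlmostPoissonOp → A →ₗ[k] A →ₗ[k] A)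
  (v : Fin 4 → A)

theorem freeEval_pentagonDefect : freeEval op v (pentagonDefect k) =
    -op AlmostPoissonOp.mul (op AlmostPoissonOp.mul (v 0) (v 1))
        (op AlmostPoissonOp.bracket (v 2) (v 3)) +
      (2 : k) • op AlmostPoissonOp.mul (op AlmostPoissonOp.mul (v 1) (v 2))
        (op AlmostPoissonOp.bracket (v 0) (v 3)) -
      op AlmostPoissonOp.mul (op AlmostPoissonOp.mul (v 2) (v 3))
        (op AlmostPoissonOp.bracket (v 0) (v 1)) := by
  simp only [pentagonDefect, map_add, map_sub, map_neg, map_smul, freeEval_freeTree]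
  rfl

theorem freeEval_jacobiDefect : freeEval op v (jacobiDefect k) =
    (2 : k) • op AlmostPoissonOp.mul (op AlmostPoissonOp.bracket (v 0) (v 2))
        (op AlmostPoissonOp.bracket (v 1) (v 3)) +
      op AlmostPoissonOp.mul (op AlmostPoissonOp.bracket (v 1) (v 2))
        (op AlmostPoissonOp.bracket (v 0) (v 3)) +
      op AlmostPoissonOp.mul (op AlmostPoissonOp.bracket (v 0) (v 1))
        (op AlmostPoissonOp.bracket (v 2) (v 3)) := by
  simp only [jacobiDefect, map_add, map_smul, freeEval_freeTree]
  rfl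

theorem freeEval_derivationDefect (l : A →ₗ[k] A →ₗ[k] A)
    (h : op AlmostPoissonOp.bracket = l) {a b c d : A} (ha : v 0 = a) (hb : v 1 = b) (hc : v 2 = c)
    (hd : v 3 = d) :
    freeEval op v (derivationDefect k) =
      (l (l a (l b c)) d - (2 : k) • l (l b (l c a)) d + l (l c (l a b)) d) -
      (l (l a d) (l b c) - (2 : k) • l b (l c (l a d)) + l c (l (l a d) b)) -
      (l a (l (l b d) c) - (2 : k) • l (l b d) (l c a) + l c (l a (l b d))) -
      (l a (l b (l c d)) - (2 : k) • l b (l (l c d) a) + l (l c d) (l a b)) := by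
  subst h ha hb hc hd
  simp only [derivationDefect, map_add, map_sub, map_smul, freeEval_freeTree]
  rfl

end

theorem pentagonDefect_mem_homogeneous : pentagonDefect k ∈ homogeneous k 1 (Fin 4) := by
  refine Submodule.sub_mem _ (Submodule.add_mem _ (Submodule.neg_mem _ ?_)
    (Submodule.smul_mem _ _ ?_)) ?_ <;> exact freeTree_mem_homogeneous _ _ rfl

theorem jacobiDefect_mem_homogeneous : jacobiDefect k ∈ homogeneous k 2 (Fin 4) := by
  refine Submodule.add_mem _ (Submodule.add_mem _ (Submodule.smul_mem _ _ ?_) ?_) ?_ <;>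
    exact freeTree_mem_homogeneous _ _ rfl

theorem derivationDefect_mem_homogeneous : derivationDefect k ∈ homogeneous k 3 (Fin 4) := by
  refine Submodule.sub_mem _ (Submodule.sub_mem _ (Submodule.sub_mem _ ?_ ?_) ?_) ?_ <;>
    refine Submodule.add_mem _ (Submodule.sub_mem _ ?_ (Submodule.smul_mem _ _ ?_)) ?_ <;>
    exact freeTree_mem_homogeneous _ _ rfl

theorem pentagonDefect_notMem_relations : pentagonDefect k ∉ (relations k).carrier (Fin 4) := by
  intro h
  -- At (1, 1, x, y) the brackets with 1 vanish and the value is -{x, y} = -1.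
  have := freeEval_poissonPlane h ![1, 1, MvPolynomial.X 0, MvPolynomial.X 1]
  rw [freeEval_pentagonDefect] at this
  simp [poissonPlane_mul, poissonPlane_bracket] at this

theorem jacobiDefect_notMem_relations [CharZero k] :
    jacobiDefect k ∉ (relations k).carrier (Fin 4) := by
  intro h
  -- At (x, x, y, y) the value is 2 + 1 + 0 = 3, nonzero in characteristic zero.
  have := freeEval_poissonPlane h
    ![MvPolynomial.X 0, MvPolynomial.X 0, MvPolynomial.X 1, MvPolynomial.X 1]
  rw [freeEval_jacobiDefect] at this
  have h3 : (3 : k) • (1 : MvPolynomial (Fin 2) k) = 0 := by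
    refine Eq.trans ?_ this
    simp [poissonPlane_mul, poissonPlane_bracket]
    module
  rw [smul_eq_zero] at h3
  exact h3.elim three_ne_zero one_ne_zero

theorem derivationDefect_notMem_relations :
    derivationDefect k ∉ (relations k).carrier (Fin 4) := by
  intro h
  -- With (a, b, c, d) = (e₀, e₁, e₂, e₀) only the group of terms containing {b, d} = -e₁ survives,
  -- and the value is -e₀.
  have := freeEval_skewAlgebra h ![![1, 0, 0], ![0, 1, 0], ![0, 0, 1], ![1, 0, 0]]
  rw [freeEval_derivationDefect _ _ _ rfl rfl rfl rfl rfl] at this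
  have := congrFun this 0
  simp [skewAlgebra_bracket] at this

end AlmostPoisson

/-! ### Vanishing of the deformation parameters, and the isomorphism -/

namespace Operad

section

variable {k : Type u} [Field k] {G X Y : Type}

theorem lmapDomain_treeOp (f : X → Y) (g : G) (p q : TreeAlgebra k G X) :
    Finsupp.lmapDomain k k (BinTree.map f) (treeOp g p q) =
      treeOp g (Finsupp.lmapDomain k k (BinTree.map f) p)
        (Finsupp.lmapDomain k k (BinTree.map f) q) := by
  let φ : TreeAlgebra k G X →ₗ[k] TreeAlgebra k G Y := Finsupp.lmapDomain k k (BinTree.map f)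
  have : (treeOp g).compr₂ φ = (treeOp g).compl₁₂ φ φ := by
    refine Finsupp.lhom_ext' fun s => LinearMap.ext_ring (Finsupp.lhom_ext' fun t =>
      LinearMap.ext_ring ?_)
    change φ (treeOp g (Finsupp.single s 1) (Finsupp.single t 1)) =
      treeOp g (φ (Finsupp.single s 1)) (φ (Finsupp.single t 1))
    simp only [treeOp_single, φ, Finsupp.lmapDomain_apply, Finsupp.mapDomain_single, BinTree.map]
  exact congrArg (fun F => F p q) this

variable (K : (freeOperad k G).OperadIdeal)

theorem lmapDomain_mem_consequences (f : X → Y) {p : TreeAlgebra k G X}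
    (hp : p ∈ consequences X K) :
    Finsupp.lmapDomain k k (BinTree.map f) p ∈ consequences Y K := by
  have : consequences X K ≤ (consequences Y K).comap (Finsupp.lmapDomain k k (BinTree.map f)) := by
    conv_lhs => rw [consequences]
    rw [Submodule.span_le]
    rintro _ ⟨Z, _, a, v, ha, rfl⟩
    have e := freeEval_map treeOp treeOp (Finsupp.lmapDomain k k (BinTree.map f))
      (lmapDomain_treeOp f) v a
    exact Submodule.subset_span ⟨Z, inferInstance, a, _, ha, e.symm⟩
  exact this hp

/-- A retraction of variables maps consequences to consequences, so adjoining variables creates no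
new identities. The same algebra in four variables can therefore also test elements of arity three.
-/
theorem mem_of_freeEval_relVar_comp_eq_zero [Finite X] {f : X → Y} {g : Y → X}
    (hg : LeftInverse g f) {a : (freePre k G).obj X}
    (ha : freeEval (relOp K) (fun x => relVar K (f x)) a = 0) : a ∈ K.carrier X := by
  have h := (freeEval_map treeOp (relOp K) (consequences Y K).mkQ (fun _ _ _ => rfl)
    (fun x : X => Finsupp.single (BinTree.leaf (f x)) 1) a).symm.trans ha
  rw [Submodule.mkQ_apply, Submodule.Quotient.mk_eq_zero] at h
  have h2 := lmapDomain_mem_consequences K g h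
  have e := freeEval_map treeOp treeOp (Finsupp.lmapDomain k k (BinTree.map g))
    (lmapDomain_treeOp g)
    (fun x : X => (Finsupp.single (BinTree.leaf (f x)) 1 : TreeAlgebra k G Y)) a
  rw [← e] at h2
  refine mem_of_freeEval_relVar_eq_zero K ((freeEval_map treeOp (relOp K) (consequences X K).mkQ
    (fun _ _ _ => rfl) (fun x : X => Finsupp.single (BinTree.leaf x) 1) a).trans ?_)
  rw [Submodule.mkQ_apply, Submodule.Quotient.mk_eq_zero]
  simpa only [Finsupp.lmapDomain_apply, Finsupp.mapDomain_single, BinTree.map, hg _] using h2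

end

open AlmostPoisson

variable {k : Type u} [Field k] (O : Operad.{u, v} k) (μ : O.obj (Fin 2))

theorem leftInverse_castSucc : LeftInverse (![0, 1, 2, 0] : Fin 4 → Fin 3) Fin.castSucc := by
  intro i
  fin_cases i <;> rfl

theorem mem_stepIdeal_of_freeEval_eq_zero {n : ℕ} {a : (freePre k AlmostPoissonOp).obj (Fin 3)}
    (h : ∀ v, freeEval (O.stepOp μ n) v a = 0) : a ∈ (O.stepIdeal μ n).carrier (Fin 3) :=
  mem_of_freeEval_relVar_comp_eq_zero _ leftInverse_castSucc (h _)

theorem stepOp_leibniz {n : ℕ} (h : leibnizator k ∈ (O.stepIdeal μ n).carrier (Fin 3))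
    (a b c : RelFree (Fin 4) (O.stepIdeal μ n)) :
    O.stepOp μ n AlmostPoissonOp.bracket (O.stepOp μ n AlmostPoissonOp.mul a b) c =
      O.stepOp μ n AlmostPoissonOp.mul a (O.stepOp μ n AlmostPoissonOp.bracket b c) +
      O.stepOp μ n AlmostPoissonOp.mul b (O.stepOp μ n AlmostPoissonOp.bracket a c) := by
  have h1 := freeEval_relOp_eq_zero (O.stepIdeal μ n) h ![a, b, c]
  rw [freeEval_leibnizator, sub_sub, sub_eq_zero] at h1
  rw [O.stepOp_mul_comm μ n b]
  exact h1

/-- Associativity holds up to the square of the commutator ideal. -/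
theorem associator_mem_two [CharZero k] (hgen : O.IsGeneratedBy {⟨2, μ⟩})
    (ψ : Operad.Iso (O.commutatorFiltration μ).gr (almostPoisson k)) :
    associator k ∈ (O.stepIdeal μ 2).carrier (Fin 3) := by
  have hm := O.stepOp_mul_comm μ 2
  have hl := O.stepOp_bracket_anticomm μ 2
  -- The Leibniz defect is a relation of degree one, so it lies in F²: the Leibniz rule is exact
  -- modulo F².
  have hL := O.stepOp_leibniz μ
    ((O.mem_relations_iff μ hgen ψ leibnizator_mem_homogeneous).1 leibnizator_mem_relations)
  have h1 : ∀ a b c, O.stepOp μ 2 AlmostPoissonOp.bracket a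
      (O.stepOp μ 2 AlmostPoissonOp.bracket b c) = 0 := fun a b c =>
    O.eval_stepOp_eq_zero μ (t := br (x 0) (br (x 1) (x 2)))
      (BinTree.isMultilinear_of_count (by decide)) (by decide) ![a, b, c]
  have h2 : ∀ a b c d, O.stepOp μ 2 AlmostPoissonOp.mul
      (O.stepOp μ 2 AlmostPoissonOp.bracket a b)
      (O.stepOp μ 2 AlmostPoissonOp.bracket c d) = 0 := fun a b c d =>
    O.eval_stepOp_eq_zero μ (t := mul (br (x 0) (x 1)) (br (x 2) (x 3)))
      (BinTree.isMultilinear_of_count (by decide)) (by decide) ![a, b, c, d]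
  -- The associator is a relation of degree zero, so it lies in F¹ and is a combination of trees
  -- with a bracket.
  have hA := O.freeEval_stepOp_mem μ hgen (n := 2)
    (tripleSpan (O.stepOp μ 2 AlmostPoissonOp.mul) (O.stepOp μ 2 AlmostPoissonOp.bracket))
    (eval_mem_of_one_le _ hm hl h1 hL)
    ((O.mem_relations_iff μ hgen ψ associator_mem_homogeneous).1 associator_mem_relations)
  simp only [freeEval_associator] at hA
  obtain ⟨α, hα⟩ := exists_associator_eq hm hl hA
  have h0 : α = 0 := by
    refine O.eq_zero_of_smul_freeEval_eq_zero μ hgen ψ pentagonDefect_mem_homogeneous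
      pentagonDefect_notMem_relations ?_
    rw [freeEval_pentagonDefect]
    exact pentagon_of_quadratic_eq_zero _ _ hm hl h1 h2 hL α hα _ _ _ _
  refine O.mem_stepIdeal_of_freeEval_eq_zero μ fun v => ?_
  rw [freeEval_associator, hα, h0, zero_smul, add_zero, sub_self]

/-- The associator lies in F², which in arity three consists of double brackets. The formula
therefore holds at every step `n`; it is used modulo F³ and modulo F⁴. -/
theorem exists_associator_mul [CharZero k] (hgen : O.IsGeneratedBy {⟨2, μ⟩})
    (ψ : Operad.Iso (O.commutatorFiltration μ).gr (almostPoisson k)) (n : ℕ) :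
    ∃ β : k, ∀ a b c, O.stepOp μ n AlmostPoissonOp.mul (O.stepOp μ n AlmostPoissonOp.mul a b) c =
      O.stepOp μ n AlmostPoissonOp.mul a (O.stepOp μ n AlmostPoissonOp.mul b c) +
      β • (O.stepOp μ n AlmostPoissonOp.bracket a (O.stepOp μ n AlmostPoissonOp.bracket b c) -
        (2 : k) • O.stepOp μ n AlmostPoissonOp.bracket b
          (O.stepOp μ n AlmostPoissonOp.bracket c a) +
        O.stepOp μ n AlmostPoissonOp.bracket c (O.stepOp μ n AlmostPoissonOp.bracket a b)) := by
  have hm := O.stepOp_mul_comm μ n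
  have hl := O.stepOp_bracket_anticomm μ n
  have hA := O.freeEval_stepOp_mem μ hgen _ (eval_mem_of_two_le _ hm hl)
    (O.associator_mem_two μ hgen ψ)
  simp only [freeEval_associator] at hA
  exact exists_associator_eq hm hl hA

/-- The Leibniz rule holds for the symmetrized product and the commutator. -/
theorem app_leibnizator [CharZero k] (hgen : O.IsGeneratedBy {⟨2, μ⟩})
    (ψ : Operad.Iso (O.commutatorFiltration μ).gr (almostPoisson k)) :
    (O.commutatorHom μ).app (Fin 3) (leibnizator k) = 0 := by
  have hm := O.stepOp_mul_comm μ 3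
  have hl := O.stepOp_bracket_anticomm μ 3
  have h1 : ∀ a b c d, O.stepOp μ 3 AlmostPoissonOp.bracket a
      (O.stepOp μ 3 AlmostPoissonOp.bracket b (O.stepOp μ 3 AlmostPoissonOp.bracket c d)) = 0 :=
    fun a b c d => O.eval_stepOp_eq_zero μ (t := br (x 0) (br (x 1) (br (x 2) (x 3))))
      (BinTree.isMultilinear_of_count (by decide)) (by decide) ![a, b, c, d]
  have h2 : ∀ a b c d, O.stepOp μ 3 AlmostPoissonOp.bracket
      (O.stepOp μ 3 AlmostPoissonOp.bracket a b)
      (O.stepOp μ 3 AlmostPoissonOp.bracket c d) = 0 := fun a b c d =>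
    O.eval_stepOp_eq_zero μ (t := br (br (x 0) (x 1)) (br (x 2) (x 3)))
      (BinTree.isMultilinear_of_count (by decide)) (by decide) ![a, b, c, d]
  have hL := O.freeEval_stepOp_mem μ hgen (n := 3) _ (eval_mem_of_two_le _ hm hl)
    ((O.mem_relations_iff μ hgen ψ leibnizator_mem_homogeneous).1 leibnizator_mem_relations)
  simp only [freeEval_leibnizator] at hL
  obtain ⟨γ, hγ⟩ := exists_leibniz_eq hm hl hL
  obtain ⟨β, hβ⟩ := O.exists_associator_mul μ hgen ψ 3
  have h0 : γ = 0 := by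
    -- The non-relation has degree two, which is why the computation takes place modulo F³.
    refine O.eq_zero_of_smul_freeEval_eq_zero μ hgen ψ jacobiDefect_mem_homogeneous
      jacobiDefect_notMem_relations ?_
    rw [freeEval_jacobiDefect]
    exact jacobi_of_cubic_eq_zero _ _ hm hl h1 h2 γ β hγ hβ _ _ _ _
  have h3 : leibnizator k ∈ (O.stepIdeal μ 3).carrier (Fin 3) := by
    refine O.mem_stepIdeal_of_freeEval_eq_zero μ fun v => ?_
    rw [freeEval_leibnizator, hγ, h0, zero_smul, add_zero, hm (v 1), add_sub_cancel_left, sub_self]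
  -- F³ is zero in arity three, so vanishing modulo F³ is vanishing in `O`.
  rw [mem_stepIdeal, O.commutatorFiltration_eq_bot μ hgen (by simp)] at h3
  exact (Submodule.mem_bot k).1 h3

/-- The symmetrized product is associative. -/
theorem app_associator [CharZero k] (hgen : O.IsGeneratedBy {⟨2, μ⟩})
    (ψ : Operad.Iso (O.commutatorFiltration μ).gr (almostPoisson k)) :
    (O.commutatorHom μ).app (Fin 3) (associator k) = 0 := by
  -- Step four is needed here, because the non-relation that eliminates `β` has degree three.
  obtain ⟨β, hβ⟩ := O.exists_associator_mul μ hgen ψ 4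
  have h0 : β = 0 := by
    refine O.eq_zero_of_smul_freeEval_eq_zero μ hgen ψ derivationDefect_mem_homogeneous
      derivationDefect_notMem_relations ?_
    rw [freeEval_derivationDefect _ _ _ rfl rfl rfl rfl rfl]
    exact derivation_of_associator _ _ (O.stepOp_mul_comm μ 4) (O.stepOp_leibniz μ
      (O.mem_stepIdeal_of_app_eq_zero μ (O.app_leibnizator μ hgen ψ))) β hβ _ _ _ _
  have h3 : associator k ∈ (O.stepIdeal μ 4).carrier (Fin 3) := by
    refine O.mem_stepIdeal_of_freeEval_eq_zero μ fun v => ?_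
    rw [freeEval_associator, hβ, h0, zero_smul, add_zero, sub_self]
  rw [mem_stepIdeal, O.commutatorFiltration_eq_bot μ hgen (by simp)] at h3
  exact (Submodule.mem_bot k).1 h3

theorem app_eq_zero_of_mem_relations [CharZero k] (hgen : O.IsGeneratedBy {⟨2, μ⟩})
    (ψ : Operad.Iso (O.commutatorFiltration μ).gr (almostPoisson k)) {X : Type} [Finite X]
    {a : (freePre k AlmostPoissonOp).obj X} (ha : a ∈ (relations k).carrier X) :
    (O.commutatorHom μ).app X a = 0 := by
  have : (relations k).carrier X ≤ ((zeroIdeal O).comap (O.commutatorHom μ)).carrier X := by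
    refine idealSpan_le ?_ X
    rintro _ ⟨⟩
    · have h := O.app_eq_zero_of_sign μ AlmostPoissonOp.mul
      rw [sign, one_smul, relabel_swap_generator] at h
      exact h
    · have h := O.app_eq_zero_of_sign μ AlmostPoissonOp.bracket
      rw [sign, neg_one_smul, sub_neg_eq_add, relabel_swap_generator] at h
      exact h
    · exact O.app_associator μ hgen ψ
    · exact O.app_leibnizator μ hgen ψ
  exact this ha

/-- In an element of the kernel, the part with the fewest brackets has the same value in `O` as
minus the remaining parts, hence lies one step deeper than its degree and is a relation. It can be
removed, and the process stops since the arity bounds the number of brackets. -/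
theorem mem_relations_of_app_eq_zero [CharZero k] (hgen : O.IsGeneratedBy {⟨2, μ⟩})
    (ψ : Operad.Iso (O.commutatorFiltration μ).gr (almostPoisson k)) {X : Type} [Finite X]
    {a : (freePre k AlmostPoissonOp).obj X} (ha : (O.commutatorHom μ).app X a = 0) :
    a ∈ (relations k).carrier X := by
  cases nonempty_fintype X
  -- Descending induction on the lowest degree `n`; `m` bounds the number of degrees still to be
  -- treated.
  have key : ∀ m n : ℕ, Fintype.card X ≤ n + m → ∀ a ∈ freeSpan k n X,
      (O.commutatorHom μ).app X a = 0 → a ∈ (relations k).carrier X := by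
    intro m
    induction m with
    | zero =>
      intro n hn a ha _
      have : freeSpan k n X = ⊥ := by
        rw [freeSpan, Submodule.span_eq_bot]
        rintro _ ⟨t, ht, h, rfl⟩
        have := weight_degree_lt ht
        omega
      rw [this, Submodule.mem_bot] at ha
      rw [ha]
      exact Submodule.zero_mem _
    | succ m ih =>
      intro n hn a ha ha0
      obtain ⟨b, hb, c, hc, rfl⟩ := Submodule.mem_sup.1 (freeSpan_le_sup n X ha)
      rw [map_add] at ha0
      have hb' : b ∈ (relations k).carrier X := by
        rw [O.mem_relations_iff μ hgen ψ hb, eq_neg_of_add_eq_zero_left ha0]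
        refine Submodule.neg_mem _ ?_
        rw [O.commutatorFiltration_eq_map μ hgen]
        exact ⟨c, hc, rfl⟩
      rw [O.app_eq_zero_of_mem_relations μ hgen ψ hb', zero_add] at ha0
      exact Submodule.add_mem _ hb' (ih (n + 1) (by omega) c hc ha0)
  refine key (Fintype.card X) 0 (by omega) a ?_ ha
  have : freeSpan k 0 X = ⊤ := by
    rw [eq_top_iff, ← span_freeTree]
    exact Submodule.span_mono fun _ ⟨t, ht, h⟩ => ⟨t, ht, Nat.zero_le _, h⟩
  rw [this]
  trivial

/-- The isomorphism induced by a surjective morphism from the quotient by its kernel. -/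
noncomputable def Hom.quotientIso {P : Operad.{u, v} k} {Q : Operad.{u, w} k} (φ : Hom P Q)
    (I : P.OperadIdeal) (hI : ∀ (X : Type) [Finite X], I.carrier X = LinearMap.ker (φ.toLin X))
    (hφ : ∀ (X : Type) [Finite X], Surjective (φ.toLin X)) : Iso (P.quotient I) Q where
  equiv X _ := (Submodule.quotEquivOfEq _ _ (hI X)).trans
    ((φ.toLin X).quotKerEquivOfSurjective (hφ X))
  map_relabel {X Y} _ _ e a := by
    obtain ⟨a, rfl⟩ := P.toQuotient_surjective I X a
    exact φ.map_relabel e a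
  map_one := φ.map_one
  map_comp {Y} _ {X} _ a b := by
    obtain ⟨a, rfl⟩ := P.toQuotient_surjective I Y a
    choose b' hb using fun y => P.toQuotient_surjective I (X y) (b y)
    obtain rfl : (fun y => P.toQuotient I (X y) (b' y)) = b := funext hb
    exact (congrArg _ (P.comp_toQuotient I a b')).trans (φ.map_comp a b')

end Operad

theorem theorem1 {k : Type u} [Field k] [CharZero k] (O : Operad.{u, v} k) (μ : O.obj (Fin 2))
    (hgen : O.IsGeneratedBy {⟨2, μ⟩})
    (hgr : Nonempty ((Operad.idealFiltration (O.commutatorIdeal μ)).gr.Iso (almostPoisson k))) :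
    ∃ φ : Operad.Iso (almostPoisson k) O,
      φ.equiv (Fin 2) (almostPoissonMul k) = μ + O.opp μ ∧
      φ.equiv (Fin 2) (almostPoissonBracket k) = μ - O.opp μ := by
  obtain ⟨ψ⟩ := hgr
  refine ⟨(O.commutatorHom μ).quotientIso (AlmostPoisson.relations k) (fun X _ => ?_)
    (O.commutatorHom_surjective μ hgen), ?_, ?_⟩
  · exact le_antisymm (fun a ha => O.app_eq_zero_of_mem_relations μ hgen ψ ha)
      (fun a ha => O.mem_relations_of_app_eq_zero μ hgen ψ ha)
  · exact O.app_generator μ AlmostPoissonOp.mul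
  · exact O.app_generator μ AlmostPoissonOp.bracket
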